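/- **Setting.** For $f$ on $\mathbb R$ let $\mathcal Hf(x)=\mathrm{p.v.}\,\frac1\pi\int_{\mathbb R}\frac{f(x-y)}{y}\,dy$ and $D^{1/2}f=\mathcal F^{-1}[|\xi|^{1/2}\hat f]$, and write $\langle\cdot,\cdot\rangle$ for the $L^2(\mathbb R)$ inner product. Fix an integer $r\ge 2$. For $\Delta x>0$ let $S_{\Delta x}$ be the space of all real $v\in H^2(\mathbb R)$ which on each interval $I_j=[(j-1)\Delta x,j\Delta x]$, $j\in\mathbb Z$, are a polynomial of degree at most $r$. There are constants $C_1,C_2>0$, depending only on $r$, such that for all $\Delta x>0$ and all $z\in S_{\Delta x}$ $$\|z_x\|_{L^\infty}\le \frac{C_1^{1/2}}{\Delta x^{1/2}}\|z_x\|_{L^2}\le\frac{C_2^{1/2}}{\Delta x^{3/2}}\|z\|_{L^2},\qquad \|z\|_{L^\infty}\le \frac{C_1^{1/2}}{\Delta x^{1/2}}\|z\|_{L^2};$$ fix any such constants. Fix $R>0$ and $\varphi\in C^\infty(\mathbb R)$ with $1\le\varphi\le 2+2R$, $0\le\varphi_x\le 1$, $\varphi_x=1$ for $|x|<R$, $\varphi_x=0$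 for $|x|\ge R+1$, and $\sqrt{\varphi_x}\in C_c^\infty(\mathbb R)$. Fix $0<L<1$ and put $K=\frac{7-L}{1-L}$. **Scheme.** Let $u_0\in L^2(\mathbb R)$ be real-valued and $\Delta x,\Delta t>0$. Let $u^0$ be the $L^2$-orthogonal projection of $u_0$ onto $S_{\Delta x}$. Given $u^n$, the next iterate $u^{n+1}\in S_{\Delta x}$ is the solution of $$\langle u^{n+1},\varphi v\rangle-\Delta t\Big\langle \tfrac{(u^{n+1/2})^2}{2},(\varphi v)_x\Big\rangle+\Delta t\,\langle\mathcal H (u^{n+1/2})_x,(\varphi v)_x\rangle=\langle u^n,\varphi v\rangle\quad\text{for all }v\in S_{\Delta x},\qquad u^{n+1/2}=\tfrac{u^n+u^{n+1}}2,$$ which is obtained as the $L^2$-limit of iterates $w^\ell\in S_{\Delta x}$ with $w^0=u^n$ and, for all $\ell\ge 0$ and $v\in S_{\Delta x}$, $$\langle w^{\ell+1},\varphi v\rangle-\tfrac{\Delta t}{2}\Big\langle\Big(\tfrac{w^\ell+u^n}{2}\Big)^2,(\varphi v)_x\Big\rangle+\Delta t\Big\langle\mathcal H\Big(\tfrac{w^{\ell+1}+u^n}{2}\Big)_x,(\varphi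 v)_x\Big\rangle=\langle u^n,\varphi v\rangle .$$ **Lemma.** With $r,C_1,C_2,R,\varphi,L$ fixed, there are $\Delta t_0>0$ and $c>0$ such that the following holds. For every $M\ge0$ there are $T>0$ and $C$ (thus depending on $u_0$ only through $\|u_0\|_{L^2(\mathbb R)}$) such that the solution $y$ of $$y'=f\Big(\tfrac{K^2+1}{2}\,y\Big),\qquad y(0)=(2+2R)M^2,\qquad f(a)=c\,(a+a^2),$$ exists on $[0,T]$ and, with $Y:=y(T)$, for all $u_0$ with $\|u_0\|_{L^2(\mathbb R)}=M$, all $\Delta x>0$ and all $0<\Delta t\le\Delta t_0$ for which $\lambda:=\Delta t/\Delta x^{3/2}$ satisfies the CFL condition $$\lambda\cdot 2\sqrt2\,\sqrt{C_2}\,K\,\sqrt Y\le L ,$$ the scheme has a solution ($u^{n+1}$ being defined for all $n\ge0$ with $(n+\frac12)\Delta t\le T$), and every such solution satisfies $$\|u^n\|_{L^2(\mathbb R)}\le C\quad\text{for all } n\ge 0\text{ with }n\Delta t\le T,\qquad \Delta t\sum_{(n+\frac12)\Delta t\le T}\big\|D^{1/2}u^{n+1/2}\big\|_{L^2([-R,R])}^2\le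 C .$$ -/

import Mathlib

open MeasureTheory Filter Topology
open scoped FourierTransform ENNReal ContDiff

namespace BenjaminOno

/-- The Hilbert transform `ℋ f (x) = p.v. (1/π) ∫ f(x - y) / y dy`. -/
noncomputable def hilbert (f : ℝ → ℝ) (x : ℝ) : ℝ :=
  limUnder (𝓝[>] (0 : ℝ)) fun ε : ℝ => (1 / Real.pi) * ∫ y in {y : ℝ | ε < |y|}, f (x - y) / y

open Classical in
/-- The class in complex `L²(ℝ)` of a square integrable real function (zero if the function is
not square integrable). -/
noncomputable def toL2 (f : ℝ → ℝ) : Lp ℂ 2 (volume : Measure ℝ) :=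
  if h : MemLp (fun x => (f x : ℂ)) 2 volume then h.toLp _ else 0

open Classical in
/-- The homogeneous fractional derivative `D^β f = ℱ⁻¹[|ξ|^β ℱ f]`, for `f ∈ L²(ℝ)` with
`|ξ|^β ℱ f ∈ L²(ℝ)` (and zero for all other `f`). Mathlib's Fourier variable is the usual angular
frequency divided by `2π`, which is why the multiplier reads `|2πξ|^β`. -/
noncomputable def fracDeriv (β : ℝ) (f : ℝ → ℝ) : Lp ℂ 2 (volume : Measure ℝ) :=
  if h : MemLp (fun ξ : ℝ => ((|2 * Real.pi * ξ| ^ β : ℝ) : ℂ) * (𝓕 (toL2 f)) ξ) 2 volume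
    then 𝓕⁻ (h.toLp _) else 0

/-- The real-valued functions in the Sobolev space `H^s(ℝ)`. -/
def MemH (s : ℝ) (f : ℝ → ℝ) : Prop :=
  MemLp f 2 volume ∧
    TemperedDistribution.MemSobolev s 2 (Lp.toTemperedDistribution (toL2 f))

/-- The finite element space `S_{Δx}`: the functions in `H²(ℝ)` which agree on each element
`I_j = [(j-1)Δx, jΔx]`, `j ∈ ℤ`, with a polynomial of degree at most `r`. -/
def femSpace (r : ℕ) (Δx : ℝ) : Set (ℝ → ℝ) :=
  {v | MemH 2 v ∧ ∀ j : ℤ, ∃ p : Polynomial ℝ, p.natDegree ≤ r ∧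
    ∀ x ∈ Set.Icc (((j : ℝ) - 1) * Δx) ((j : ℝ) * Δx), v x = p.eval x}

/-- `C₁` and `C₂` are constants for which the inverse inequalities hold on all the spaces
`S_{Δx}`, `Δx > 0`. -/
structure IsInverseConstants (r : ℕ) (C₁ C₂ : ℝ) : Prop where
  pos₁ : 0 < C₁
  pos₂ : 0 < C₂
  sup_le : ∀ Δx : ℝ, 0 < Δx → ∀ z ∈ femSpace r Δx,
    eLpNorm z ∞ volume ≤
      ENNReal.ofReal (C₁ ^ (1 / 2 : ℝ) / Δx ^ (1 / 2 : ℝ)) * eLpNorm z 2 volume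
  sup_deriv_le : ∀ Δx : ℝ, 0 < Δx → ∀ z ∈ femSpace r Δx,
    eLpNorm (deriv z) ∞ volume ≤
      ENNReal.ofReal (C₁ ^ (1 / 2 : ℝ) / Δx ^ (1 / 2 : ℝ)) * eLpNorm (deriv z) 2 volume
  deriv_le : ∀ Δx : ℝ, 0 < Δx → ∀ z ∈ femSpace r Δx,
    ENNReal.ofReal (C₁ ^ (1 / 2 : ℝ) / Δx ^ (1 / 2 : ℝ)) * eLpNorm (deriv z) 2 volume ≤
      ENNReal.ofReal (C₂ ^ (1 / 2 : ℝ) / Δx ^ (3 / 2 : ℝ)) * eLpNorm z 2 volume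

/-- The smooth cut-off functions `φ` used as weights. -/
structure IsCutoff (R : ℝ) (φ : ℝ → ℝ) : Prop where
  smooth : ContDiff ℝ ∞ φ
  one_le : ∀ x, 1 ≤ φ x
  le : ∀ x, φ x ≤ 2 + 2 * R
  deriv_eq_one : ∀ x, |x| < R → deriv φ x = 1
  deriv_eq_zero : ∀ x, R + 1 ≤ |x| → deriv φ x = 0
  deriv_nonneg : ∀ x, 0 ≤ deriv φ x
  deriv_le_one : ∀ x, deriv φ x ≤ 1
  sqrt_smooth : ContDiff ℝ ∞ fun x => √(deriv φ x)
  sqrt_compact : HasCompactSupport fun x => √(deriv φ x)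

/-- `(u + u')/2`, i.e. `u^{n+1/2}` when `u = u^n` and `u' = u^{n+1}`. -/
noncomputable def midpoint (u u' : ℝ → ℝ) : ℝ → ℝ := fun x => (u x + u' x) / 2

/-- The Crank-Nicolson Galerkin equation relating `u = u^n` and `u' = u^{n+1}`. -/
def CNEquation (r : ℕ) (φ : ℝ → ℝ) (Δx Δt : ℝ) (u u' : ℝ → ℝ) : Prop :=
  ∀ v ∈ femSpace r Δx,
    (∫ x, u' x * (φ x * v x))
      - Δt * (∫ x, (midpoint u u' x) ^ 2 / 2 * deriv (fun s => φ s * v s) x)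
      + Δt * (∫ x, hilbert (deriv (midpoint u u')) x * deriv (fun s => φ s * v s) x)
      = ∫ x, u x * (φ x * v x)

/-- The linear equation which determines the iterate `w' = w^{ℓ+1}` from `w = w^ℓ` and
`u = u^n`. -/
def IterationEquation (r : ℕ) (φ : ℝ → ℝ) (Δx Δt : ℝ) (u w w' : ℝ → ℝ) : Prop :=
  ∀ v ∈ femSpace r Δx,
    (∫ x, w' x * (φ x * v x))
      - Δt / 2 * (∫ x, (midpoint w u x) ^ 2 * deriv (fun s => φ s * v s) x)
      + Δt * (∫ x, hilbert (deriv (midpoint w' u)) x * deriv (fun s => φ s * v s) x)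
      = ∫ x, u x * (φ x * v x)

/-- One time step of the scheme: `u' = u^{n+1} ∈ S_{Δx}` solves the Crank-Nicolson Galerkin
equation and is the `L²`-limit of the iterates `w^ℓ ∈ S_{Δx}` started at `w^0 = u^n`. -/
def IsStep (r : ℕ) (φ : ℝ → ℝ) (Δx Δt : ℝ) (u u' : ℝ → ℝ) : Prop :=
  u' ∈ femSpace r Δx ∧ CNEquation r φ Δx Δt u u' ∧
    ∃ w : ℕ → ℝ → ℝ, w 0 = u ∧ (∀ ℓ, w ℓ ∈ femSpace r Δx) ∧
      (∀ ℓ, IterationEquation r φ Δx Δt u (w ℓ) (w (ℓ + 1))) ∧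
      Tendsto (fun ℓ => eLpNorm (fun x => w ℓ x - u' x) 2 volume) atTop (𝓝 0)

/-- The sequence `u^0, u^1, …` is the solution of the scheme up to time `T` with initial data
`u₀`: `u^0` is the `L²`-orthogonal projection of `u₀` onto `S_{Δx}`, and `u^{n+1}` is obtained from
`u^n` by one step of the scheme whenever `(n + 1/2)Δt ≤ T`. -/
structure IsSchemeSolution (r : ℕ) (φ : ℝ → ℝ) (Δx Δt T : ℝ)
    (u₀ : Lp ℝ 2 (volume : Measure ℝ)) (u : ℕ → ℝ → ℝ) : Prop where
  init_mem : u 0 ∈ femSpace r Δx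
  init_proj : ∀ v ∈ femSpace r Δx, ∫ x, (u 0 x - u₀ x) * v x = 0
  step : ∀ n : ℕ, ((n : ℝ) + 1 / 2) * Δt ≤ T → IsStep r φ Δx Δt (u n) (u (n + 1))

/-- `λ > 0` with `λ² = Δt² / Δx³`. -/
noncomputable def cfl (Δx Δt : ℝ) : ℝ := √(Δt ^ 2 / Δx ^ 3)

/-- `y` solves `y' = f((K²+1)/2 · y)`, `y(0) = y₀`, on `[0, T]`, where `f(a) = c (a + a²)`. -/
def IsMajorant (c K y₀ T : ℝ) (y : ℝ → ℝ) : Prop :=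
  y 0 = y₀ ∧ ∀ t ∈ Set.Icc (0 : ℝ) T,
    HasDerivWithinAt y
      (c * ((K ^ 2 + 1) / 2 * y t + ((K ^ 2 + 1) / 2 * y t) ^ 2)) (Set.Icc 0 T) t

end BenjaminOno

/-! The scheme is tested against `φ v`, so its natural norm is the weighted norm `wnorm φ`, which is
equivalent to the `L²` norm because `1 ≤ φ ≤ 2 + 2R`. Write `N` for the squared weighted norm of
`u^n`, `w` for the midpoint of `u^n` and `u^{n+1}`, `μ` for `‖w‖²`, and `G` for the squared
Gagliardo seminorm of order `1/2` of `√φ' w`. Testing the Crank–Nicolson equation with `w` makes the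
time difference half the increment of `N`. It remains to control one dispersive and one cubic term.

The dispersive term is `⟨|D| w, (φ w)'⟩`. The operator `ℋ∂ₓ = |D|` is written as an absolutely
convergent integral of second differences (`lam`, `hilbert_deriv`). The part with `φ' w` is, up to
`O(μ)`, the form of `|D|` evaluated at `√φ' w`, hence `G/π` (`IsCutoff.exists_localisation`). The
part with `φ w'` is a commutator and is `O(μ)`: after integrating by parts in `x` and in the shift
`y`, only the error kernel of the trapezoidal rule for `φ'` survives, and that kernel is integrable
in `y` (`IsCutoff.exists_transport_le`). Together this is Kato's local smoothing gain
(`IsCutoff.exists_coercive`). The cubic term equals `(1/3) ∫ φ' w³`, which is `O(μ √G)` by the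
embedding of `H^{1/2}` in `L⁴` (`IsCutoff.sq_integral_cube_le`), so half of the gain absorbs it. The
result is `energy_step`: the increment of `N` plus `Δt G / π` is at most `2 Δt (D μ + π μ²)`.

To close this, `μ` must be bounded by the old value of `N` alone. This is what the CFL condition and
the fixed-point iteration provide: with the inverse inequalities each iteration contracts with
factor `L`, and all iterates, hence their limit, have weighted norm at most `K` times that of `u^n`
(`wnorm_iterate_le`). Hence `μ ≤ (K² + 1)/2 · N`, and `N` obeys an explicit Euler inequality for `y'
= f((K² + 1)/2 · y)`. Nonnegative solutions of this equation have nondecreasing slope, so they lie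
above their Euler polygon (`euler_le`), and `N ≤ y(n Δt)` follows by induction
(`wnorm_sq_le_majorant`).

Summing the energy estimates bounds `Δt ∑ G`. On the Fourier side the Gagliardo seminorm dominates
the `D^{1/2}` norm, and the commutator of `D^{1/2}` with the cutoff `√φ'` is bounded on `L²`. As
`√φ' = 1` on `(-R, R)`, this gives the local smoothing bound
(`exists_integral_norm_sq_fracDeriv_le`).

Three supporting facts complete the argument. The space `S_{Δx}` consists exactly of the `C¹`,
square integrable piecewise polynomials of degree at most `r` (`mem_femSpace_iff`). The inverse
inequalities hold on it by scaling from one element, and they make it closed in `L²`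
(`isClosed_femSubmodule`), so each linear iteration is solvable by Lax–Milgram. The CFL condition
controls only the contribution of `C₂`; that of `C₁` is made small by choosing `T` small, which
suffices because a step is taken only if `Δt ≤ 2T` (`cfl_smallness`). -/

namespace BenjaminOno

/-! ### Cauchy–Schwarz, translations and kernel integrals on `L²(ℝ)`. -/

/-- Cauchy–Schwarz for square integrable functions. -/
theorem abs_integral_mul_le {α : Type*} [MeasurableSpace α] {μ : Measure α} {f g : α → ℝ}
    (hf : MemLp f 2 μ) (hg : MemLp g 2 μ) :
    |∫ x, f x * g x ∂μ| ≤ √(∫ x, f x ^ 2 ∂μ) * √(∫ x, g x ^ 2 ∂μ) := by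
  have e : ∀ {u v : α → ℝ} (hu : MemLp u 2 μ) (hv : MemLp v 2 μ),
      inner ℝ (hu.toLp u) (hv.toLp v) = ∫ x, u x * v x ∂μ := by
    intro u v hu hv
    rw [L2.inner_def]
    refine integral_congr_ae ?_
    filter_upwards [hu.coeFn_toLp, hv.coeFn_toLp] with x h1 h2
    rw [h1, h2]
    simp [mul_comm]
  have n : ∀ {u : α → ℝ} (hu : MemLp u 2 μ), ‖hu.toLp u‖ = √(∫ x, u x ^ 2 ∂μ) := by
    intro u hu
    rw [@norm_eq_sqrt_real_inner, e]
    simp [sq]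
  have := abs_real_inner_le_norm (hf.toLp f) (hg.toLp g)
  rwa [e, n, n] at this

theorem sq_integral_mul_le {α : Type*} [MeasurableSpace α] {μ : Measure α} {f g : α → ℝ}
    (hf : MemLp f 2 μ) (hg : MemLp g 2 μ) :
    (∫ x, f x * g x ∂μ) ^ 2 ≤ (∫ x, f x ^ 2 ∂μ) * ∫ x, g x ^ 2 ∂μ := by
  have h := abs_integral_mul_le hf hg
  have h1 : 0 ≤ ∫ x, f x ^ 2 ∂μ := integral_nonneg fun x => sq_nonneg _
  have h2 : 0 ≤ ∫ x, g x ^ 2 ∂μ := integral_nonneg fun x => sq_nonneg _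
  calc (∫ x, f x * g x ∂μ) ^ 2 = |∫ x, f x * g x ∂μ| ^ 2 := (sq_abs _).symm
    _ ≤ (√(∫ x, f x ^ 2 ∂μ) * √(∫ x, g x ^ 2 ∂μ)) ^ 2 := by gcongr
    _ = _ := by rw [mul_pow, Real.sq_sqrt h1, Real.sq_sqrt h2]

theorem memLp_shift {f : ℝ → ℝ} (hf : MemLp f 2 volume) (y : ℝ) :
    MemLp (fun x => f (x + y)) 2 volume :=
  hf.comp_measurePreserving (measurePreserving_add_right volume y)

theorem memLp_shift_sub {f : ℝ → ℝ} (hf : MemLp f 2 volume) (y : ℝ) :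
    MemLp (fun x => f (x - y)) 2 volume :=
  hf.comp_measurePreserving (measurePreserving_sub_right volume y)

theorem memLp_bdd_mul {f k : ℝ → ℝ} (hf : MemLp f 2 volume)
    (hk : AEStronglyMeasurable k volume) {C : ℝ} (hC : ∀ x, |k x| ≤ C) :
    MemLp (fun x => k x * f x) 2 volume := by
  refine MemLp.of_le_mul (c := C) hf (hk.mul hf.1) (Eventually.of_forall fun x => ?_)
  rw [norm_mul]
  exact mul_le_mul_of_nonneg_right (hC x) (norm_nonneg _)

theorem integral_sq_shift (f : ℝ → ℝ) (y : ℝ) : ∫ x, f (x + y) ^ 2 = ∫ x, f x ^ 2 :=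
  integral_add_right_eq_self (fun x => f x ^ 2) y

theorem abs_integral_kernel_mul_le {f g k : ℝ → ℝ} (hf : MemLp f 2 volume)
    (hg : MemLp g 2 volume) {C : ℝ} (hC : ∀ x, |k x| ≤ C) :
    |∫ x, k x * (f x * g x)| ≤ C * (√(∫ x, f x ^ 2) * √(∫ x, g x ^ 2)) := by
  have hC0 : 0 ≤ C := (abs_nonneg _).trans (hC 0)
  have habs : ∀ u : ℝ → ℝ, ∫ x, |u x| ^ 2 = ∫ x, u x ^ 2 := fun u => by simp
  calc |∫ x, k x * (f x * g x)| ≤ ∫ x, |k x * (f x * g x)| := abs_integral_le_integral_abs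
    _ ≤ ∫ x, C * (|f x| * |g x|) := by
        refine integral_mono_of_nonneg (Eventually.of_forall fun x => abs_nonneg _) ?_
          (Eventually.of_forall fun x => ?_)
        · exact (hf.abs.integrable_mul hg.abs).const_mul C
        · simp only [abs_mul]
          exact mul_le_mul_of_nonneg_right (hC x) (by positivity)
    _ = C * ∫ x, |f x| * |g x| := integral_const_mul _ _
    _ ≤ C * (√(∫ x, f x ^ 2) * √(∫ x, g x ^ 2)) := by
        have := abs_integral_mul_le hf.abs hg.abs
        simp only [Pi.abs_apply, habs] at this
        exact mul_le_mul_of_nonneg_left ((le_abs_self _).trans this) hC0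

theorem measurePreserving_shear (ν : Measure ℝ) [SFinite ν] :
    MeasurePreserving (fun p : ℝ × ℝ => (p.1, p.2 + p.1)) (ν.prod volume) (ν.prod volume) :=
  (MeasurePreserving.id ν).skew_product (g := fun y x => x + y) (by fun_prop)
    (Eventually.of_forall fun y => (measurePreserving_add_right volume y).map_eq)

theorem integrable_shear {ν : Measure ℝ} [SFinite ν] {κ h : ℝ → ℝ} (hκ : Integrable κ ν)
    (hh : Integrable h) : Integrable (fun p : ℝ × ℝ => κ p.1 * h (p.2 + p.1)) (ν.prod volume) :=
  (measurePreserving_shear ν).integrable_comp_of_integrable (hκ.mul_prod hh)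

/-- Integrability of `κ(y) f(x) g(x+y)`-type kernels. -/
theorem integrable_kernel {ν : Measure ℝ} [SFinite ν] {k : ℝ → ℝ → ℝ} {κ f g : ℝ → ℝ}
    (hf : MemLp f 2 volume) (hg : MemLp g 2 volume) (hfm : Measurable f) (hgm : Measurable g)
    (hk : Measurable (Function.uncurry k)) (hκ : Integrable κ ν)
    (hle : ∀ᵐ y ∂ν, ∀ x, |k y x| ≤ κ y) :
    Integrable (fun p : ℝ × ℝ => k p.1 p.2 * (f p.2 * g (p.2 + p.1))) (ν.prod volume) := by
  have h1 : Integrable (fun p : ℝ × ℝ => κ p.1 * f p.2 ^ 2) (ν.prod volume) :=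
    hκ.mul_prod hf.integrable_sq
  have h2 : Integrable (fun p : ℝ × ℝ => κ p.1 * g (p.2 + p.1) ^ 2) (ν.prod volume) :=
    integrable_shear hκ hg.integrable_sq
  refine (h1.add h2).mono' ?_ ?_
  · have : Measurable fun p : ℝ × ℝ => k p.1 p.2 := hk
    exact (this.mul ((hfm.comp measurable_snd).mul
      (hgm.comp (measurable_snd.add measurable_fst)))).aestronglyMeasurable
  · have := (Measure.quasiMeasurePreserving_fst (μ := ν) (ν := (volume : Measure ℝ))).ae hle
    filter_upwards [this] with p hp
    have hp := hp p.2
    have h0 := abs_nonneg (k p.1 p.2)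
    simp only [Real.norm_eq_abs, abs_mul, Pi.add_apply]
    have : |f p.2| * |g (p.2 + p.1)| ≤ f p.2 ^ 2 + g (p.2 + p.1) ^ 2 := by
      nlinarith [sq_abs (f p.2), sq_abs (g (p.2 + p.1)), sq_nonneg (|f p.2| - |g (p.2 + p.1)|),
        sq_nonneg (|f p.2|), sq_nonneg (|g (p.2 + p.1)|)]
    rw [← mul_add]
    exact mul_le_mul hp this (by positivity) (h0.trans hp)

theorem abs_integral_kernel_le {ν : Measure ℝ} [SFinite ν] {k : ℝ → ℝ → ℝ} {κ f : ℝ → ℝ}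
    (hf : MemLp f 2 volume) (hκ : Integrable κ ν) (hle : ∀ᵐ y ∂ν, ∀ x, |k y x| ≤ κ y) :
    |∫ y, (∫ x, k y x * (f x * f (x + y))) ∂ν| ≤ (∫ y, κ y ∂ν) * ∫ x, f x ^ 2 := by
  rw [← integral_mul_const]
  refine abs_integral_le_integral_abs.trans (integral_mono_of_nonneg
    (Eventually.of_forall fun y => abs_nonneg _) (hκ.mul_const _) ?_)
  filter_upwards [hle] with y hy
  refine (abs_integral_kernel_mul_le hf (memLp_shift hf y) hy).trans_eq ?_
  rw [integral_sq_shift, Real.mul_self_sqrt (integral_nonneg fun x => sq_nonneg _)]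

/-! ### Functions in `H¹` and `H²`, and their first and second differences. -/

/-- Functions in `H¹(ℝ)`, with the derivative in the classical sense almost everywhere. -/
structure IsH1 (f : ℝ → ℝ) : Prop where
  memLp : MemLp f 2 volume
  memLp_deriv : MemLp (deriv f) 2 volume
  ftc : ∀ a b, ∫ x in a..b, deriv f x = f b - f a

/-- Continuously differentiable functions in `H²(ℝ)`. -/
structure IsH2 (w : ℝ → ℝ) : Prop where
  contDiff : ContDiff ℝ 1 w
  h1 : IsH1 w
  h1_deriv : IsH1 (deriv w)

theorem intervalIntegrable_of_memLp {f : ℝ → ℝ} (hf : MemLp f 2 volume) (a b : ℝ) :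
    IntervalIntegrable f volume a b := by
  have := (hf.locallyIntegrable (by norm_num)).integrableOn_isCompact (isCompact_uIcc (a := a) (b := b))
  exact (intervalIntegrable_iff').2 this

theorem IsH1.continuous {f : ℝ → ℝ} (hf : IsH1 f) : Continuous f := by
  have : f = fun x => f 0 + ∫ t in (0 : ℝ)..x, deriv f t := by
    funext x; rw [hf.ftc]; ring
  rw [this]
  exact continuous_const.add (intervalIntegral.continuous_primitive
    (fun a b => intervalIntegrable_of_memLp hf.memLp_deriv a b) 0)

theorem isH1_of_contDiff {f : ℝ → ℝ} (hf : ContDiff ℝ 1 f) (h : MemLp f 2 volume)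
    (h' : MemLp (deriv f) 2 volume) : IsH1 f :=
  ⟨h, h', fun a b => intervalIntegral.integral_deriv_eq_sub
    (fun x _ => (hf.differentiable (by norm_num)) x)
    ((hf.continuous_deriv le_rfl).intervalIntegrable a b)⟩

theorem IsH1.sq_sub_le {f : ℝ → ℝ} (hf : IsH1 f) (x : ℝ) {y : ℝ} (hy : 0 ≤ y) :
    (f (x + y) - f x) ^ 2 ≤ y * ∫ s in Set.Ioc 0 y, deriv f (x + s) ^ 2 := by
  have h1 : f (x + y) - f x = ∫ s in Set.Ioc 0 y, 1 * deriv f (x + s) := by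
    rw [← hf.ftc, ← intervalIntegral.integral_of_le hy]
    simp [intervalIntegral.integral_comp_add_left (fun s => deriv f s)]
  have hm : MemLp (fun s => deriv f (x + s)) 2 (volume.restrict (Set.Ioc 0 y)) :=
    (hf.memLp_deriv.comp_measurePreserving (measurePreserving_add_left volume x)).restrict _
  have hc : MemLp (fun _ : ℝ => (1 : ℝ)) 2 (volume.restrict (Set.Ioc 0 y)) := memLp_const _
  have := sq_integral_mul_le hc hm
  rw [h1]
  simpa [hy] using this

theorem IsH1.integral_sq_sub_le {f : ℝ → ℝ} (hf : IsH1 f) {y : ℝ} (hy : 0 ≤ y) :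
    ∫ x, (f (x + y) - f x) ^ 2 ≤ y ^ 2 * ∫ x, deriv f x ^ 2 := by
  have hi : Integrable (fun p : ℝ × ℝ => 1 * deriv f (p.2 + p.1) ^ 2)
      ((volume.restrict (Set.Ioc 0 y)).prod volume) :=
    integrable_shear (integrable_const _) hf.memLp_deriv.integrable_sq
  simp only [one_mul] at hi
  have hsw := integral_integral_swap (f := fun s x => deriv f (x + s) ^ 2) hi
  calc ∫ x, (f (x + y) - f x) ^ 2 ≤ ∫ x, y * ∫ s in Set.Ioc 0 y, deriv f (x + s) ^ 2 :=
        integral_mono_of_nonneg (Eventually.of_forall fun x => sq_nonneg _)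
          (hi.integral_prod_right.const_mul y) (Eventually.of_forall fun x => hf.sq_sub_le x hy)
    _ = y * ∫ s in Set.Ioc 0 y, ∫ x, deriv f (x + s) ^ 2 := by
        rw [integral_const_mul, hsw]
    _ = y ^ 2 * ∫ x, deriv f x ^ 2 := by
        simp only [integral_sq_shift]
        simp [hy, sq, mul_assoc]

/-- One-dimensional Sobolev embedding: average `f(x)² ≤ 2 f(x+y)² + 2 (f(x+y) - f(x))²` over the
unit interval `0 < y ≤ 1`. -/
theorem IsH1.exists_bound {f : ℝ → ℝ} (hf : IsH1 f) : ∃ C, ∀ x, |f x| ≤ C := by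
  refine ⟨√(2 * (∫ x, f x ^ 2) + 2 * ∫ x, deriv f x ^ 2), fun x => Real.abs_le_sqrt ?_⟩
  have hd : ∀ y ∈ Set.Ioc (0 : ℝ) 1, f x ^ 2 ≤ 2 * f (x + y) ^ 2 + 2 * ∫ x, deriv f x ^ 2 := by
    intro y hy
    have h1 := hf.sq_sub_le x hy.1.le
    have h2 : ∫ s in Set.Ioc 0 y, deriv f (x + s) ^ 2 ≤ ∫ s, deriv f s ^ 2 := by
      rw [← integral_add_left_eq_self (fun s => deriv f s ^ 2) x]
      exact setIntegral_le_integral ((hf.memLp_deriv.comp_measurePreserving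
        (measurePreserving_add_left volume x)).integrable_sq) (Eventually.of_forall fun s => sq_nonneg _)
    have h3 : 0 ≤ ∫ s in Set.Ioc 0 y, deriv f (x + s) ^ 2 := integral_nonneg fun s => sq_nonneg _
    nlinarith [sq_nonneg (2 * f (x + y) - f x), hy.2, hy.1]
  have hsq : Integrable (fun y => f (x + y) ^ 2) := (hf.memLp.comp_measurePreserving
        (measurePreserving_add_left volume x)).integrable_sq
  have := setIntegral_mono_on (μ := volume) (s := Set.Ioc (0 : ℝ) 1) (f := fun _ => f x ^ 2)
    (g := fun y => 2 * f (x + y) ^ 2 + 2 * ∫ x, deriv f x ^ 2) (integrable_const _)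
    (((hsq.const_mul 2).integrableOn).add (integrable_const _)) measurableSet_Ioc hd
  have h5 : ∫ y in Set.Ioc (0 : ℝ) 1, f (x + y) ^ 2 ≤ ∫ y, f y ^ 2 := by
    rw [← integral_add_left_eq_self (fun s => f s ^ 2) x]
    exact setIntegral_le_integral hsq (Eventually.of_forall fun s => sq_nonneg _)
  rw [integral_add ((hsq.const_mul 2).integrableOn) (integrable_const _), integral_const_mul] at this
  simp at this
  linarith

theorem IsH2.measurable {w : ℝ → ℝ} (hw : IsH2 w) : Measurable w := hw.contDiff.continuous.measurable

theorem IsH2.hasDerivAt {w : ℝ → ℝ} (hw : IsH2 w) (x : ℝ) : HasDerivAt w (deriv w x) x :=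
  ((hw.contDiff.differentiable (by norm_num)) x).hasDerivAt

/-- The second difference. -/
def secondDiff (w : ℝ → ℝ) (y x : ℝ) : ℝ := 2 * w x - w (x - y) - w (x + y)

theorem memLp_secondDiff {w : ℝ → ℝ} (hw : MemLp w 2 volume) (y : ℝ) :
    MemLp (secondDiff w y) 2 volume :=
  ((hw.const_mul 2).sub (memLp_shift_sub hw y)).sub (memLp_shift hw y)

theorem integral_sq_secondDiff_le {w : ℝ → ℝ} (hw : MemLp w 2 volume) (y : ℝ) :
    ∫ x, secondDiff w y x ^ 2 ≤ 16 * ∫ x, w x ^ 2 := by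
  have h0 := hw.integrable_sq
  have h1 := (memLp_shift_sub hw y).integrable_sq
  have h2 := (memLp_shift hw y).integrable_sq
  calc ∫ x, secondDiff w y x ^ 2
      ≤ ∫ x, (8 * w x ^ 2 + 4 * w (x - y) ^ 2 + 4 * w (x + y) ^ 2) := by
        refine integral_mono (memLp_secondDiff hw y).integrable_sq
          (((h0.const_mul 8).add (h1.const_mul 4)).add (h2.const_mul 4)) fun x => ?_
        simp only [secondDiff]
        nlinarith [sq_nonneg (w (x - y) - w (x + y)), sq_nonneg (2 * w x + w (x - y) + w (x + y))]
    _ = 16 * ∫ x, w x ^ 2 := by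
        rw [integral_add (f := fun x => 8 * w x ^ 2 + 4 * w (x - y) ^ 2)
          ((h0.const_mul 8).add (h1.const_mul 4)) (h2.const_mul 4), integral_add (h0.const_mul 8) (h1.const_mul 4)]
        simp only [integral_const_mul]
        rw [integral_sq_shift, integral_sub_right_eq_self (fun x => w x ^ 2)]
        ring

/-- A second difference is, up to sign and translation, a first difference of the first difference
`e`, and each difference gains one factor `y` in `L²` against one derivative. -/
theorem IsH2.integral_sq_secondDiff_le {w : ℝ → ℝ} (hw : IsH2 w) {y : ℝ} (hy : 0 ≤ y) :
    ∫ x, secondDiff w y x ^ 2 ≤ y ^ 4 * ∫ x, deriv (deriv w) x ^ 2 := by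
  set e : ℝ → ℝ := fun x => w (x + y) - w x with he
  have hde : deriv e = fun x => deriv w (x + y) - deriv w x := by
    funext x
    exact (((hw.hasDerivAt (x + y)).comp_add_const x y).sub (hw.hasDerivAt x)).deriv
  have he1 : IsH1 e := by
    refine isH1_of_contDiff ?_ ((memLp_shift hw.h1.memLp y).sub hw.h1.memLp) ?_
    · exact (hw.contDiff.comp (contDiff_id.add contDiff_const)).sub hw.contDiff
    · rw [hde]
      exact (memLp_shift hw.h1.memLp_deriv y).sub hw.h1.memLp_deriv
  have h1 := he1.integral_sq_sub_le hy
  have h2 := hw.h1_deriv.integral_sq_sub_le hy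
  have h3 : ∫ x, secondDiff w y x ^ 2 = ∫ x, (e (x + y) - e x) ^ 2 := by
    rw [← integral_sub_right_eq_self (fun x => (e (x + y) - e x) ^ 2) y]
    refine integral_congr_ae (Eventually.of_forall fun x => ?_)
    simp only [secondDiff, he, sub_add_cancel]
    ring
  rw [h3]
  rw [hde] at h1
  calc _ ≤ _ := h1
    _ ≤ y ^ 2 * (y ^ 2 * ∫ x, deriv (deriv w) x ^ 2) := by gcongr
    _ = _ := by ring

/-- The integrable weight `min(1, y⁻²)` on the half line. -/
noncomputable def rho (y : ℝ) : ℝ := min 1 (y ^ 2)⁻¹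

theorem measurable_rho : Measurable rho := by unfold rho; fun_prop

theorem rho_nonneg (y : ℝ) : 0 ≤ rho y := by unfold rho; positivity

theorem rho_pos {y : ℝ} (hy : 0 < y) : 0 < rho y := by unfold rho; positivity

theorem integrableOn_inv_sq_Ioi {a : ℝ} (ha : 0 < a) :
    IntegrableOn (fun y : ℝ => (y ^ 2)⁻¹) (Set.Ioi a) := by
  refine (integrableOn_Ioi_rpow_of_lt (by norm_num : (-2 : ℝ) < -1) ha).congr_fun ?_
    measurableSet_Ioi
  intro y hy
  have hy : 0 < y := ha.trans hy
  simp only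
  rw [Real.rpow_neg hy.le]
  norm_num

theorem integrableOn_rho : IntegrableOn rho (Set.Ioi 0) := by
  rw [← Set.Ioc_union_Ioi_eq_Ioi (zero_le_one' ℝ)]
  refine IntegrableOn.union ?_ ?_
  · refine Integrable.mono' (g := fun _ => (1 : ℝ)) (integrable_const _)
      measurable_rho.aestronglyMeasurable (Eventually.of_forall fun y => ?_)
    rw [Real.norm_eq_abs, abs_of_nonneg (rho_nonneg y)]
    exact min_le_left _ _
  · refine (integrableOn_inv_sq_Ioi one_pos).mono' measurable_rho.aestronglyMeasurable
      (Eventually.of_forall fun y => ?_)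
    rw [Real.norm_eq_abs, abs_of_nonneg (rho_nonneg y)]
    exact min_le_right _ _

/-! ### A weighted substitute for Minkowski's integral inequality. -/

section weighted

variable {ν : Measure ℝ} {ρ : ℝ → ℝ} {F : ℝ → ℝ → ℝ} {A : ℝ}

/-- An integrable weight, positive almost everywhere. -/
structure IsWeight (ν : Measure ℝ) (ρ : ℝ → ℝ) : Prop where
  measurable : Measurable ρ
  integrable : Integrable ρ ν
  nonneg : ∀ y, 0 ≤ ρ y
  pos : ∀ᵐ y ∂ν, 0 < ρ y

theorem IsWeight.integrable_sq (hρ : IsWeight ν ρ) (hF : Measurable (Function.uncurry F))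
    (hm : ∀ᵐ y ∂ν, MemLp (F y) 2 volume) (hle : ∀ᵐ y ∂ν, ∫ x, F y x ^ 2 ≤ (A * ρ y) ^ 2) :
    Integrable (fun p : ℝ × ℝ => F p.1 p.2 ^ 2 / ρ p.1) (ν.prod volume) := by
  have hF' : Measurable fun p : ℝ × ℝ => F p.1 p.2 := hF
  have hmeas : Measurable fun p : ℝ × ℝ => F p.1 p.2 ^ 2 / ρ p.1 :=
    (hF'.pow_const 2).div (hρ.measurable.comp measurable_fst)
  rw [integrable_prod_iff hmeas.aestronglyMeasurable]
  constructor
  · filter_upwards [hm] with y hy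
    exact hy.integrable_sq.div_const _
  · refine Integrable.mono' (g := fun y => A ^ 2 * ρ y) (hρ.integrable.const_mul _)
      hmeas.norm.stronglyMeasurable.integral_prod_right.aestronglyMeasurable ?_
    filter_upwards [hle, hρ.pos] with y hy hρ
    have : ∫ x, ‖F y x ^ 2 / ρ y‖ = (∫ x, F y x ^ 2) / ρ y := by
      rw [← integral_div]
      refine integral_congr_ae (Eventually.of_forall fun x => ?_)
      simp only [Real.norm_eq_abs]
      exact abs_of_nonneg (by positivity)
    rw [this, Real.norm_eq_abs, abs_of_nonneg
      (div_nonneg (integral_nonneg fun x => sq_nonneg _) hρ.le), div_le_iff₀ hρ]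
    exact hy.trans_eq (by ring)

theorem IsWeight.integrable_mul [SFinite ν] (hρ : IsWeight ν ρ) (hF : Measurable (Function.uncurry F))
    (hm : ∀ᵐ y ∂ν, MemLp (F y) 2 volume) (hle : ∀ᵐ y ∂ν, ∫ x, F y x ^ 2 ≤ (A * ρ y) ^ 2)
    {g : ℝ → ℝ} (hg : MemLp g 2 volume) (hgm : Measurable g) :
    Integrable (fun p : ℝ × ℝ => F p.1 p.2 * g p.2) (ν.prod volume) := by
  have hF' : Measurable fun p : ℝ × ℝ => F p.1 p.2 := hF
  have h1 := hρ.integrable_sq hF hm hle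
  have h2 : Integrable (fun p : ℝ × ℝ => ρ p.1 * g p.2 ^ 2) (ν.prod volume) :=
    Integrable.mul_prod hρ.integrable hg.integrable_sq
  refine (h1.add h2).mono' (hF'.mul (hgm.comp measurable_snd)).aestronglyMeasurable ?_
  have := (Measure.quasiMeasurePreserving_fst (μ := ν) (ν := (volume : Measure ℝ))).ae hρ.pos
  filter_upwards [this] with p hρ
  simp only [Pi.add_apply, Real.norm_eq_abs]
  rw [div_add' _ _ _ hρ.ne', le_div_iff₀ hρ, abs_mul, ← sq_abs (F p.1 p.2), ← sq_abs (g p.2)]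
  nlinarith [sq_nonneg (|F p.1 p.2| - ρ p.1 * |g p.2|), sq_nonneg |F p.1 p.2|,
    sq_nonneg (ρ p.1 * |g p.2|)]

/-- Minkowski's inequality when `‖F y‖ ≤ A ρ(y)`: apply Cauchy–Schwarz in `y` to `√ρ · (F/√ρ)` at
each `x`, then Fubini to `∫∫ F²/ρ`. -/
theorem IsWeight.memLp_integral [SFinite ν] (hρ : IsWeight ν ρ) (hF : Measurable (Function.uncurry F))
    (hm : ∀ᵐ y ∂ν, MemLp (F y) 2 volume) (hle : ∀ᵐ y ∂ν, ∫ x, F y x ^ 2 ≤ (A * ρ y) ^ 2) :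
    MemLp (fun x => ∫ y, F y x ∂ν) 2 volume ∧
      ∫ x, (∫ y, F y x ∂ν) ^ 2 ≤ (A * ∫ y, ρ y ∂ν) ^ 2 := by
  have hF' : Measurable fun p : ℝ × ℝ => F p.1 p.2 := hF
  have h1 := hρ.integrable_sq hF hm hle
  have hI0 : 0 ≤ ∫ y, ρ y ∂ν := integral_nonneg hρ.nonneg
  have hmeas : AEStronglyMeasurable (fun x => ∫ y, F y x ∂ν) volume :=
    hF'.stronglyMeasurable.integral_prod_left.aestronglyMeasurable
  have hcs : ∀ᵐ x, (∫ y, F y x ∂ν) ^ 2 ≤ (∫ y, ρ y ∂ν) * ∫ y, F y x ^ 2 / ρ y ∂ν := by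
    filter_upwards [h1.prod_left_ae] with x hx
    have m1 : MemLp (fun y => √(ρ y)) 2 ν := by
      rw [memLp_two_iff_integrable_sq hρ.measurable.sqrt.aestronglyMeasurable]
      simp only [Real.sq_sqrt (hρ.nonneg _)]
      exact hρ.integrable
    have m2 : MemLp (fun y => F y x / √(ρ y)) 2 ν := by
      have hmx : Measurable fun y => F y x / √(ρ y) :=
        (hF'.comp measurable_prodMk_right).div hρ.measurable.sqrt
      rw [memLp_two_iff_integrable_sq hmx.aestronglyMeasurable]
      simpa only [div_pow, Real.sq_sqrt (hρ.nonneg _)] using hx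
    have := sq_integral_mul_le m1 m2
    simp only [div_pow, Real.sq_sqrt (hρ.nonneg _)] at this
    refine le_trans (le_of_eq ?_) this
    congr 1
    refine integral_congr_ae ?_
    filter_upwards [hρ.pos] with y hy
    have := (Real.sqrt_pos.2 hy).ne'
    field_simp
  have hint : Integrable fun x => ∫ y, F y x ^ 2 / ρ y ∂ν := h1.integral_prod_right
  have hsq : Integrable fun x => (∫ y, F y x ∂ν) ^ 2 := by
    refine (hint.const_mul (∫ y, ρ y ∂ν)).mono' (hmeas.pow 2) ?_
    filter_upwards [hcs] with x hx
    rwa [Real.norm_eq_abs, abs_of_nonneg (sq_nonneg _)]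
  refine ⟨(memLp_two_iff_integrable_sq hmeas).2 hsq, ?_⟩
  calc ∫ x, (∫ y, F y x ∂ν) ^ 2
      ≤ ∫ x, (∫ y, ρ y ∂ν) * ∫ y, F y x ^ 2 / ρ y ∂ν :=
        integral_mono_ae hsq (hint.const_mul _) hcs
    _ = (∫ y, ρ y ∂ν) * ∫ y, (∫ x, F y x ^ 2 / ρ y) ∂ν := by
        rw [integral_const_mul, integral_integral_swap (f := fun y x => F y x ^ 2 / ρ y) h1]
    _ ≤ (∫ y, ρ y ∂ν) * ∫ y, A ^ 2 * ρ y ∂ν := by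
        refine mul_le_mul_of_nonneg_left ?_ hI0
        refine integral_mono_ae h1.integral_prod_left (hρ.integrable.const_mul _) ?_
        filter_upwards [hle, hρ.pos] with y hy hy0
        rw [integral_div, div_le_iff₀ hy0]
        exact hy.trans_eq (by ring)
    _ = _ := by rw [integral_const_mul]; ring

theorem isWeight_rho : IsWeight (volume.restrict (Set.Ioi 0)) rho where
  measurable := measurable_rho
  integrable := integrableOn_rho
  nonneg := rho_nonneg
  pos := by
    filter_upwards [ae_restrict_mem measurableSet_Ioi] with y hy
    exact rho_pos hy

end weighted

/-! ### The operator `|D|` as an integral of second differences, and its identification with `ℋ∂ₓ`.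
-/

/-- The operator `ℋ∂ₓ = |D|`, written as an absolutely convergent integral. -/
noncomputable def lam (w : ℝ → ℝ) (x : ℝ) : ℝ :=
  (1 / Real.pi) * ∫ y in Set.Ioi 0, secondDiff w y x / y ^ 2

theorem measurable_secondDiff {w : ℝ → ℝ} (hw : Measurable w) :
    Measurable fun p : ℝ × ℝ => secondDiff w p.1 p.2 := by
  unfold secondDiff
  fun_prop

section lam

variable {w : ℝ → ℝ}

/-- The `H²` bound `y²‖w''‖` serves for small `y` and the trivial bound `4‖w‖` for large `y`; after
division by `y²` both fit under `rho`, so `lam w` is square integrable. -/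
theorem integral_sq_secondDiff_div_le (hw : IsH2 w) {y : ℝ} (hy : 0 < y) :
    ∫ x, (secondDiff w y x / y ^ 2) ^ 2 ≤
      (√(16 * (∫ x, w x ^ 2) + ∫ x, deriv (deriv w) x ^ 2) * rho y) ^ 2 := by
  have h0 : 0 ≤ ∫ x, w x ^ 2 := integral_nonneg fun x => sq_nonneg _
  have h2 : 0 ≤ ∫ x, deriv (deriv w) x ^ 2 := integral_nonneg fun x => sq_nonneg _
  rw [mul_pow, Real.sq_sqrt (by positivity)]
  simp only [div_pow]
  rw [integral_div]
  have hy4 : 0 < (y ^ 2) ^ 2 := by positivity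
  rw [div_le_iff₀ hy4]
  rcases le_total 1 ((y ^ 2)⁻¹) with h | h
  · rw [rho, min_eq_left h]
    have := hw.integral_sq_secondDiff_le hy.le
    nlinarith [mul_nonneg h0 hy4.le]
  · rw [rho, min_eq_right h]
    have := BenjaminOno.integral_sq_secondDiff_le hw.h1.memLp y
    have e : (y ^ 2)⁻¹ ^ 2 * (y ^ 2) ^ 2 = 1 := by field_simp
    rw [mul_assoc, e]
    linarith

theorem measurable_secondDiff_div (hw : Measurable w) :
    Measurable (Function.uncurry fun y x => secondDiff w y x / y ^ 2) :=
  (measurable_secondDiff hw).div (measurable_fst.pow_const 2)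

theorem memLp_secondDiff_div (hw : MemLp w 2 volume) (y : ℝ) :
    MemLp (fun x => secondDiff w y x / y ^ 2) 2 volume := by
  simpa only [div_eq_inv_mul] using (memLp_secondDiff hw y).const_mul (y ^ 2)⁻¹

theorem memLp_lam (hw : IsH2 w) : MemLp (lam w) 2 volume :=
  (isWeight_rho.memLp_integral (measurable_secondDiff_div hw.measurable)
    (Eventually.of_forall fun y => memLp_secondDiff_div hw.h1.memLp y)
    ((ae_restrict_mem measurableSet_Ioi).mono fun _ hy => integral_sq_secondDiff_div_le hw hy)).1.const_mul _

theorem exists_integral_sq_lam_le : ∃ C, 0 ≤ C ∧ ∀ w : ℝ → ℝ, IsH2 w →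
    ∫ x, lam w x ^ 2 ≤ C * ((∫ x, w x ^ 2) + ∫ x, deriv (deriv w) x ^ 2) := by
  refine ⟨(1 / Real.pi) ^ 2 * (16 * (∫ y in Set.Ioi 0, rho y) ^ 2), by positivity,
    fun w hw => ?_⟩
  have h0 : 0 ≤ ∫ x, w x ^ 2 := integral_nonneg fun x => sq_nonneg _
  have h2 : 0 ≤ ∫ x, deriv (deriv w) x ^ 2 := integral_nonneg fun x => sq_nonneg _
  have := (isWeight_rho.memLp_integral (measurable_secondDiff_div hw.measurable)
    (Eventually.of_forall fun y => memLp_secondDiff_div hw.h1.memLp y)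
    ((ae_restrict_mem measurableSet_Ioi).mono fun _ hy => integral_sq_secondDiff_div_le hw hy)).2
  rw [mul_pow, Real.sq_sqrt (by positivity)] at this
  simp only [lam, mul_pow]
  rw [integral_const_mul, mul_assoc]
  refine mul_le_mul_of_nonneg_left (this.trans ?_) (by positivity)
  nlinarith [mul_nonneg (sq_nonneg (∫ y in Set.Ioi 0, rho y)) h2]

theorem integrable_secondDiff_mul (hw : IsH2 w) {g : ℝ → ℝ} (hg : MemLp g 2 volume)
    (hgm : Measurable g) :
    Integrable (fun p : ℝ × ℝ => secondDiff w p.1 p.2 / p.1 ^ 2 * g p.2)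
      ((volume.restrict (Set.Ioi 0)).prod volume) :=
  isWeight_rho.integrable_mul (measurable_secondDiff_div hw.measurable)
    (Eventually.of_forall fun y => memLp_secondDiff_div hw.h1.memLp y)
    ((ae_restrict_mem measurableSet_Ioi).mono fun _ hy => integral_sq_secondDiff_div_le hw hy)
    hg hgm

theorem integral_lam_mul (hw : IsH2 w) {g : ℝ → ℝ} (hg : MemLp g 2 volume)
    (hgm : Measurable g) :
    ∫ x, lam w x * g x =
      (1 / Real.pi) * ∫ y in Set.Ioi 0, (∫ x, secondDiff w y x * g x) / y ^ 2 := by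
  have h := integral_integral_swap (f := fun y x => secondDiff w y x / y ^ 2 * g x)
    (integrable_secondDiff_mul hw hg hgm)
  simp only [lam, mul_assoc]
  rw [integral_const_mul]
  congr 1
  simp_rw [← integral_mul_const, ← h]
  refine integral_congr_ae (Eventually.of_forall fun y => ?_)
  simp only
  rw [← integral_div]
  refine integral_congr_ae (Eventually.of_forall fun x => ?_)
  simp only
  ring

theorem integrableOn_integral_secondDiff_mul (hw : IsH2 w) {g : ℝ → ℝ} (hg : MemLp g 2 volume)
    (hgm : Measurable g) :
    IntegrableOn (fun y => (∫ x, secondDiff w y x * g x) / y ^ 2) (Set.Ioi 0) := by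
  refine (integrable_secondDiff_mul hw hg hgm).integral_prod_left.congr
    (Eventually.of_forall fun y => ?_)
  simp only
  rw [← integral_div]
  refine integral_congr_ae (Eventually.of_forall fun x => ?_)
  simp only
  ring

/-- A pointwise bound of order `y^{3/2}`: one factor `√y` from integrating the first difference of
`w'`, and a full `y` from integrating once more. It makes `secondDiff w y x / y²` integrable at `0`
and `secondDiff w y x / y` vanish there. -/
theorem IsH2.sq_secondDiff_le (hw : IsH2 w) (x : ℝ) {y : ℝ} (hy : 0 ≤ y) :
    secondDiff w y x ^ 2 ≤ y ^ 3 * ∫ x, deriv (deriv w) x ^ 2 := by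
  set e : ℝ → ℝ := fun x => w (x + y) - w x with he
  have hde : deriv e = fun x => deriv w (x + y) - deriv w x := by
    funext x
    exact (((hw.hasDerivAt (x + y)).comp_add_const x y).sub (hw.hasDerivAt x)).deriv
  have he1 : IsH1 e := by
    refine isH1_of_contDiff ?_ ((memLp_shift hw.h1.memLp y).sub hw.h1.memLp) ?_
    · exact (hw.contDiff.comp (contDiff_id.add contDiff_const)).sub hw.contDiff
    · rw [hde]
      exact (memLp_shift hw.h1.memLp_deriv y).sub hw.h1.memLp_deriv
  have h1 := he1.sq_sub_le (x - y) hy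
  have h3 : secondDiff w y x ^ 2 = (e (x - y + y) - e (x - y)) ^ 2 := by
    simp only [secondDiff, he, sub_add_cancel]
    ring
  rw [h3]
  refine h1.trans ?_
  have h4 : ∫ s in Set.Ioc 0 y, deriv e (x - y + s) ^ 2 ≤
      ∫ s in Set.Ioc 0 y, y * ∫ x, deriv (deriv w) x ^ 2 := by
    refine integral_mono_of_nonneg (Eventually.of_forall fun s => sq_nonneg _)
      (integrable_const _) (Eventually.of_forall fun s => ?_)
    simp only [hde]
    refine (hw.h1_deriv.sq_sub_le _ hy).trans (mul_le_mul_of_nonneg_left ?_ hy)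
    rw [← integral_add_left_eq_self (fun t => deriv (deriv w) t ^ 2) (x - y + s)]
    exact setIntegral_le_integral ((hw.h1_deriv.memLp_deriv.comp_measurePreserving
      (measurePreserving_add_left volume _)).integrable_sq) (Eventually.of_forall fun s => sq_nonneg _)
  simp only [integral_const, measureReal_restrict_apply_univ, smul_eq_mul] at h4
  rw [Real.volume_real_Ioc_of_le hy] at h4
  nlinarith

theorem integrableOn_secondDiff_div (hw : IsH2 w) (x : ℝ) :
    IntegrableOn (fun y => secondDiff w y x / y ^ 2) (Set.Ioi 0) := by
  have hm : Measurable fun y => secondDiff w y x / y ^ 2 :=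
    (measurable_secondDiff_div hw.measurable).comp measurable_prodMk_right
  obtain ⟨B, hB⟩ := hw.h1.exists_bound
  set D := ∫ x, deriv (deriv w) x ^ 2
  have hD : 0 ≤ D := integral_nonneg fun x => sq_nonneg _
  rw [← Set.Ioc_union_Ioi_eq_Ioi (zero_le_one' ℝ)]
  refine IntegrableOn.union ?_ ?_
  · have hi : IntegrableOn (fun y : ℝ => √D * y ^ (-(1 / 2) : ℝ)) (Set.Ioc 0 1) := by
      have := (intervalIntegral.intervalIntegrable_rpow' (a := 0) (b := 1)
        (by norm_num : (-1 : ℝ) < -(1 / 2)))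
      rw [intervalIntegrable_iff_integrableOn_Ioc_of_le zero_le_one] at this
      exact this.const_mul _
    refine hi.mono' hm.aestronglyMeasurable ?_
    filter_upwards [ae_restrict_mem measurableSet_Ioc] with y hy
    have hy0 := hy.1
    have := Real.abs_le_sqrt (hw.sq_secondDiff_le x hy0.le)
    rw [Real.norm_eq_abs, abs_div, abs_of_pos (by positivity : 0 < y ^ 2),
      div_le_iff₀ (by positivity)]
    refine this.trans_eq ?_
    rw [Real.sqrt_mul (by positivity), mul_comm, mul_assoc]
    congr 1
    rw [← Real.sqrt_sq (show 0 ≤ y ^ (-(1 / 2) : ℝ) * y ^ 2 by positivity)]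
    congr 1
    rw [mul_pow, ← Real.rpow_natCast (y ^ (-(1 / 2) : ℝ)), ← Real.rpow_mul hy0.le]
    norm_num
    rw [Real.rpow_neg_one]
    field_simp
  · refine Integrable.mono' ((integrableOn_inv_sq_Ioi one_pos).const_mul (4 * B))
      hm.aestronglyMeasurable (Eventually.of_forall fun y => ?_)
    rw [Real.norm_eq_abs, abs_div, abs_of_nonneg (by positivity : 0 ≤ y ^ 2), div_eq_mul_inv]
    refine mul_le_mul_of_nonneg_right ?_ (by positivity)
    have h1 := abs_le.1 (hB x)
    have h2 := abs_le.1 (hB (x - y))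
    have h3 := abs_le.1 (hB (x + y))
    rw [abs_le, secondDiff]
    constructor <;> linarith

theorem tendsto_secondDiff_div_zero (hw : IsH2 w) (x : ℝ) :
    Tendsto (fun y => secondDiff w y x / y) (𝓝[>] 0) (𝓝 0) := by
  set D := ∫ x, deriv (deriv w) x ^ 2
  have h : Tendsto (fun y : ℝ => √(y * D)) (𝓝[>] 0) (𝓝 0) := by
    have : Continuous fun y : ℝ => √(y * D) := by fun_prop
    have := (this.tendsto 0).mono_left (nhdsWithin_le_nhds (s := Set.Ioi 0))
    simpa using this
  refine squeeze_zero_norm' ?_ h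
  filter_upwards [self_mem_nhdsWithin] with y hy
  have hy : 0 < y := hy
  refine Real.abs_le_sqrt ?_
  rw [div_pow, div_le_iff₀ (by positivity)]
  exact (hw.sq_secondDiff_le x hy.le).trans_eq (by ring)

theorem integrableOn_deriv_div (hw : IsH2 w) (x : ℝ) {ε : ℝ} (hε : 0 < ε) :
    IntegrableOn (fun y => deriv w (x - y) / y) (Set.Ioi ε) ∧
    IntegrableOn (fun y => deriv w (x + y) / y) (Set.Ioi ε) := by
  have h1 : MemLp (fun y => deriv w (x - y)) 2 (volume.restrict (Set.Ioi ε)) :=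
    (hw.h1.memLp_deriv.comp_measurePreserving (Measure.measurePreserving_sub_left volume x)).restrict _
  have h2 : MemLp (fun y => deriv w (x + y)) 2 (volume.restrict (Set.Ioi ε)) :=
    (hw.h1.memLp_deriv.comp_measurePreserving (measurePreserving_add_left volume x)).restrict _
  have h3 : MemLp (fun y : ℝ => y⁻¹) 2 (volume.restrict (Set.Ioi ε)) := by
    rw [memLp_two_iff_integrable_sq (by fun_prop)]
    simp only [inv_pow]
    exact integrableOn_inv_sq_Ioi hε
  exact ⟨h1.integrable_mul h3, h2.integrable_mul h3⟩

/-- Folding the negative half line onto the positive one leaves `(w'(x-y) - w'(x+y))/y`, whose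
numerator is the `y`-derivative of the second difference. Integration by parts leaves only the
boundary term at `ε`, since `w` is bounded. -/
theorem truncated_hilbert_deriv (hw : IsH2 w) (x : ℝ) {ε : ℝ} (hε : 0 < ε) :
    ∫ y in {y : ℝ | ε < |y|}, deriv w (x - y) / y =
      (∫ y in Set.Ioi ε, secondDiff w y x / y ^ 2) - secondDiff w ε x / ε := by
  obtain ⟨i1, i2⟩ := integrableOn_deriv_div hw x hε
  have hset : {y : ℝ | ε < |y|} = Set.Ioi ε ∪ Set.Iio (-ε) := by
    ext y
    simp only [Set.mem_ofPred_eq, lt_abs, Set.mem_union, Set.mem_Ioi, Set.mem_Iio]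
    constructor <;> rintro (h | h)
    · exact Or.inl h
    · exact Or.inr (by linarith)
    · exact Or.inl h
    · exact Or.inr (by linarith)
  have i3 : IntegrableOn (fun y => deriv w (x - y) / y) (Set.Iio (-ε)) := by
    have h := (Measure.measurePreserving_neg (volume : Measure ℝ)).integrableOn_comp_preimage
      (Homeomorph.neg ℝ).measurableEmbedding (f := fun y => deriv w (x - y) / y) (s := Set.Iio (-ε))
    rw [← h]
    simpa [Function.comp_def, div_neg] using i2.neg
  have e3 : ∫ y in Set.Iio (-ε), deriv w (x - y) / y = - ∫ y in Set.Ioi ε, deriv w (x + y) / y := by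
    rw [← integral_neg, ← integral_Iic_eq_integral_Iio, ← integral_comp_neg_Ioi]
    refine integral_congr_ae (Eventually.of_forall fun y => ?_)
    simp [div_neg]
  rw [hset, setIntegral_union ?_ measurableSet_Iio i1 i3, e3, ← sub_eq_add_neg,
    ← integral_sub i1 i2]
  · have hi : IntegrableOn (fun y => secondDiff w y x / y ^ 2) (Set.Ioi ε) :=
      (integrableOn_secondDiff_div hw x).mono_set (Set.Ioi_subset_Ioi hε.le)
    obtain ⟨B, hB⟩ := hw.h1.exists_bound
    have hlim : Tendsto (fun y => secondDiff w y x / y) atTop (𝓝 0) := by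
      refine squeeze_zero_norm' (a := fun y => 4 * B / y) ?_
        (tendsto_const_nhds.div_atTop tendsto_id)
      filter_upwards [eventually_gt_atTop 0] with y hy
      rw [Real.norm_eq_abs, abs_div, abs_of_pos hy]
      refine div_le_div_of_nonneg_right ?_ hy.le
      have h1 := abs_le.1 (hB x)
      have h2 := abs_le.1 (hB (x - y))
      have h3 := abs_le.1 (hB (x + y))
      rw [abs_le, secondDiff]
      constructor <;> linarith
    have hder : ∀ y ∈ Set.Ici ε, HasDerivAt (fun y => secondDiff w y x / y)
        (deriv w (x - y) / y - deriv w (x + y) / y - secondDiff w y x / y ^ 2) y := by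
      intro y hy
      have hy : y ≠ 0 := (hε.trans_le hy).ne'
      have d1 : HasDerivAt (fun y => secondDiff w y x) (deriv w (x - y) - deriv w (x + y)) y := by
        have a1 := (hw.hasDerivAt (x - y)).comp_const_sub x y
        have a2 := (hw.hasDerivAt (x + y)).comp_const_add x y
        have := ((hasDerivAt_const y (2 * w x)).sub a1).sub a2
        exact this.congr_deriv (by simp)
      have := d1.div (hasDerivAt_id y) hy
      refine this.congr_deriv ?_
      simp only [id]
      field_simp
    have := integral_Ioi_of_hasDerivAt_of_tendsto' hder ((i1.sub i2).sub hi) hlim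
    rw [integral_sub (f := fun y => deriv w (x - y) / y - deriv w (x + y) / y) (i1.sub i2) hi]
      at this
    linarith
  · rw [Set.disjoint_left]
    intro y h1 h2
    simp only [Set.mem_Ioi, Set.mem_Iio] at h1 h2
    linarith

/-- In the truncated formula the boundary term tends to `0` and the integral converges absolutely,
so the principal value exists and `limUnder` returns it. -/
theorem hilbert_deriv (hw : IsH2 w) : hilbert (deriv w) = lam w := by
  funext x
  refine Tendsto.limUnder_eq ?_
  have hi := integrableOn_secondDiff_div hw x
  have h1 : Tendsto (fun ε : ℝ => ∫ y in Set.Ioi ε, secondDiff w y x / y ^ 2) (𝓝[>] 0)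
      (𝓝 (∫ y in Set.Ioi 0, secondDiff w y x / y ^ 2)) := by
    have hc := (aecover_Ioi_of_Ioi (μ := (volume : Measure ℝ)) (l := 𝓝[>] (0 : ℝ)) (a := id)
      (A := 0) (tendsto_id.mono_left nhdsWithin_le_nhds)).integral_tendsto_of_countably_generated hi
    refine hc.congr' ?_
    filter_upwards [self_mem_nhdsWithin] with ε hε
    have hε : 0 < ε := hε
    rw [Measure.restrict_restrict measurableSet_Ioi, id,
      Set.inter_eq_left.2 (Set.Ioi_subset_Ioi hε.le)]
  have := ((h1.sub (tendsto_secondDiff_div_zero hw x)).const_mul (1 / Real.pi))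
  rw [sub_zero] at this
  refine this.congr' ?_
  filter_upwards [self_mem_nhdsWithin] with ε hε
  rw [truncated_hilbert_deriv hw x hε]

end lam

/-! ### The Gagliardo seminorm and the embedding of `H^{1/2}` in `L⁴`. -/

/-- The (one-sided) Gagliardo seminorm of order `1/2`, squared. -/
noncomputable def gagliardo (f : ℝ → ℝ) : ℝ :=
  ∫ y in Set.Ioi 0, (∫ x, (f (x + y) - f x) ^ 2) / y ^ 2

theorem gagliardo_nonneg (f : ℝ → ℝ) : 0 ≤ gagliardo f :=
  integral_nonneg fun _ => div_nonneg (integral_nonneg fun _ => sq_nonneg _) (sq_nonneg _)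

theorem integral_sq_shift_sub_le {f : ℝ → ℝ} (hf : MemLp f 2 volume) (y : ℝ) :
    ∫ x, (f (x + y) - f x) ^ 2 ≤ 4 * ∫ x, f x ^ 2 := by
  have h1 := hf.integrable_sq
  have h2 := (memLp_shift hf y).integrable_sq
  calc ∫ x, (f (x + y) - f x) ^ 2 ≤ ∫ x, (2 * f (x + y) ^ 2 + 2 * f x ^ 2) := by
        refine integral_mono ((memLp_shift hf y).sub hf).integrable_sq
          ((h2.const_mul 2).add (h1.const_mul 2)) fun x => ?_
        nlinarith [sq_nonneg (f (x + y) + f x)]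
    _ = 4 * ∫ x, f x ^ 2 := by
        rw [integral_add (h2.const_mul 2) (h1.const_mul 2), integral_const_mul, integral_const_mul,
          integral_sq_shift]
        ring

theorem IsH1.integrable_gagliardo {f : ℝ → ℝ} (hf : IsH1 f) :
    Integrable (fun p : ℝ × ℝ => (f (p.2 + p.1) - f p.2) ^ 2 / p.1 ^ 2)
      ((volume.restrict (Set.Ioi 0)).prod volume) := by
  have hfm := hf.continuous.measurable
  have hmeas : Measurable fun p : ℝ × ℝ => (f (p.2 + p.1) - f p.2) ^ 2 / p.1 ^ 2 := by fun_prop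
  have h0 : 0 ≤ ∫ x, f x ^ 2 := integral_nonneg fun x => sq_nonneg _
  have h1 : 0 ≤ ∫ x, deriv f x ^ 2 := integral_nonneg fun x => sq_nonneg _
  rw [integrable_prod_iff hmeas.aestronglyMeasurable]
  constructor
  · exact Eventually.of_forall fun y =>
      (((memLp_shift hf.memLp y).sub hf.memLp).integrable_sq.div_const (y ^ 2) :)
  · refine Integrable.mono' (integrableOn_rho.const_mul (4 * (∫ x, f x ^ 2) + ∫ x, deriv f x ^ 2))
      hmeas.norm.stronglyMeasurable.integral_prod_right.aestronglyMeasurable ?_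
    filter_upwards [ae_restrict_mem measurableSet_Ioi] with y hy
    have hy : 0 < y := hy
    have e : ∫ x, ‖(f (x + y) - f x) ^ 2 / y ^ 2‖ = (∫ x, (f (x + y) - f x) ^ 2) / y ^ 2 := by
      rw [← integral_div]
      refine integral_congr_ae (Eventually.of_forall fun x => ?_)
      simp only [Real.norm_eq_abs]
      exact abs_of_nonneg (by positivity)
    have h3 : 0 ≤ ∫ x, (f (x + y) - f x) ^ 2 := integral_nonneg fun x => sq_nonneg _
    rw [e, Real.norm_eq_abs, abs_of_nonneg (by positivity), div_le_iff₀ (by positivity)]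
    rcases le_total 1 ((y ^ 2)⁻¹) with h | h
    · rw [rho, min_eq_left h]
      nlinarith [hf.integral_sq_sub_le hy.le, mul_nonneg h0 (sq_nonneg y)]
    · rw [rho, min_eq_right h, mul_assoc, inv_mul_cancel₀ (by positivity)]
      linarith [integral_sq_shift_sub_le hf.memLp y]

theorem IsH1.integrableOn_gagliardo {f : ℝ → ℝ} (hf : IsH1 f) :
    IntegrableOn (fun y => (∫ x, (f (x + y) - f x) ^ 2) / y ^ 2) (Set.Ioi 0) := by
  have := hf.integrable_gagliardo.integral_prod_left
  simp only [integral_div] at this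
  exact this

/-- The pointwise interpolation inequality behind `H^{1/2} ⊂ L⁴`. -/
theorem pow_four_le {f : ℝ → ℝ} (hf : MemLp f 2 volume) (x : ℝ)
    (hx : IntegrableOn (fun y => (f (x + y) - f x) ^ 2 / y ^ 2) (Set.Ioi 0)) :
    f x ^ 4 ≤ 16 * (∫ x, f x ^ 2) *
      ∫ y in Set.Ioi 0, (f (x + y) - f x) ^ 2 / y ^ 2 := by
  set A := ∫ x, f x ^ 2
  set G := ∫ y in Set.Ioi 0, (f (x + y) - f x) ^ 2 / y ^ 2
  have hA : 0 ≤ A := integral_nonneg fun x => sq_nonneg _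
  have hG : 0 ≤ G := integral_nonneg fun y => by positivity
  -- Average `f(x)² ≤ 2 f(x+y)² + 2 (f(x+y) - f(x))²` over `0 < y ≤ h` and use `y² ≤ h²` to insert
  -- the weight `1/y²`.
  have key : ∀ h : ℝ, 0 < h → h * f x ^ 2 ≤ 2 * A + 2 * h ^ 2 * G := by
    intro h hh
    have hsq : Integrable fun y => f (x + y) ^ 2 := (hf.comp_measurePreserving
      (measurePreserving_add_left volume x)).integrable_sq
    have h1 : ∫ y in Set.Ioc 0 h, f x ^ 2 ≤
        ∫ y in Set.Ioc 0 h, (2 * f (x + y) ^ 2 + 2 * h ^ 2 * ((f (x + y) - f x) ^ 2 / y ^ 2)) := by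
      refine setIntegral_mono_on (integrable_const _) ?_ measurableSet_Ioc fun y hy => ?_
      · exact (hsq.const_mul 2).integrableOn.add
          ((hx.mono_set Set.Ioc_subset_Ioi_self).const_mul _)
      · have hy0 := hy.1
        have hd : 0 ≤ (f (x + y) - f x) ^ 2 / y ^ 2 := by positivity
        have e : (f (x + y) - f x) ^ 2 = y ^ 2 * ((f (x + y) - f x) ^ 2 / y ^ 2) := by field_simp
        have : y ^ 2 ≤ h ^ 2 := pow_le_pow_left₀ hy0.le hy.2 2
        nlinarith [sq_nonneg (2 * f (x + y) - f x), mul_le_mul_of_nonneg_right this hd]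
    rw [integral_add (hsq.const_mul 2).integrableOn
      ((hx.mono_set Set.Ioc_subset_Ioi_self).const_mul _), integral_const_mul,
      integral_const_mul] at h1
    have h2 : ∫ y in Set.Ioc 0 h, f (x + y) ^ 2 ≤ A := by
      rw [show A = ∫ y, f (x + y) ^ 2 from (integral_add_left_eq_self (fun s => f s ^ 2) x).symm]
      exact setIntegral_le_integral hsq (Eventually.of_forall fun s => sq_nonneg _)
    have h3 : ∫ y in Set.Ioc 0 h, (f (x + y) - f x) ^ 2 / y ^ 2 ≤ G :=
      setIntegral_mono_set hx (Eventually.of_forall fun y => by positivity)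
        Set.Ioc_subset_Ioi_self.eventuallyLE
    simp only [integral_const, measureReal_restrict_apply_univ, smul_eq_mul] at h1
    rw [Real.volume_real_Ioc_of_le hh.le] at h1
    nlinarith [mul_le_mul_of_nonneg_left h3 (show 0 ≤ 2 * h ^ 2 by positivity)]
  set s := f x ^ 2 with hs
  have hs0 : 0 ≤ s := sq_nonneg _
  have e4 : f x ^ 4 = s ^ 2 := by rw [hs]; ring
  rw [e4]
  rcases hs0.eq_or_lt with h | hspos
  · rw [← h, zero_pow two_ne_zero]; exact mul_nonneg (mul_nonneg (by norm_num) hA) hG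
  rcases hG.eq_or_lt with h | hGpos
  · exfalso
    -- If `G = 0`, the bound `h s ≤ 2A` would hold for every `h`; this `h` violates it.
    have := key ((2 * A + 1) / s) (by positivity)
    rw [← h, div_mul_cancel₀ _ hspos.ne'] at this
    linarith
  -- This `h` makes the term `2h²G` half of the left side, so it can be absorbed.
  · have := key (s / (4 * G)) (by positivity)
    have e1 : s / (4 * G) * s = s ^ 2 / (4 * G) := by ring
    have e2 : 2 * (s / (4 * G)) ^ 2 * G = (s ^ 2 / (4 * G)) / 2 := by field_simp; ring
    rw [e1, e2] at this
    have h5 : s ^ 2 / (4 * G) ≤ 4 * A := by linarith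
    rw [div_le_iff₀ (by positivity)] at h5
    nlinarith

theorem IsH1.integral_pow_four_le {f : ℝ → ℝ} (hf : IsH1 f) :
    Integrable (fun x => f x ^ 4) ∧ ∫ x, f x ^ 4 ≤ 16 * (∫ x, f x ^ 2) * gagliardo f := by
  have hi := hf.integrable_gagliardo
  have hle : ∀ᵐ x, f x ^ 4 ≤ 16 * (∫ x, f x ^ 2) *
      ∫ y in Set.Ioi 0, (f (x + y) - f x) ^ 2 / y ^ 2 := by
    filter_upwards [hi.prod_left_ae] with x hx
    exact pow_four_le hf.memLp x hx
  have hint := hi.integral_prod_right.const_mul (16 * (∫ x, f x ^ 2))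
  have h4 : Integrable (fun x => f x ^ 4) := by
    refine hint.mono' (hf.continuous.pow 4).aestronglyMeasurable ?_
    filter_upwards [hle] with x hx
    rwa [Real.norm_eq_abs, abs_of_nonneg (by positivity)]
  refine ⟨h4, (integral_mono_ae h4 hint hle).trans_eq ?_⟩
  rw [integral_const_mul, gagliardo,
    ← integral_integral_swap (f := fun y x => (f (x + y) - f x) ^ 2 / y ^ 2) hi]
  simp only [integral_div]

theorem isH1_mul {k f : ℝ → ℝ} {B B' : ℝ} (hk : ContDiff ℝ 1 k) (hkB : ∀ x, |k x| ≤ B)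
    (hkB' : ∀ x, |deriv k x| ≤ B') (hf : ContDiff ℝ 1 f) (hf1 : IsH1 f) :
    IsH1 fun x => k x * f x := by
  have hd : deriv (fun x => k x * f x) = fun x => deriv k x * f x + k x * deriv f x := by
    funext x
    exact deriv_fun_mul (hk.differentiable (by norm_num) x) (hf.differentiable (by norm_num) x)
  refine isH1_of_contDiff (hk.mul hf)
    (memLp_bdd_mul hf1.memLp hk.continuous.aestronglyMeasurable hkB) ?_
  rw [hd]
  exact (memLp_bdd_mul hf1.memLp (hk.continuous_deriv le_rfl).aestronglyMeasurable hkB').add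
    (memLp_bdd_mul hf1.memLp_deriv hk.continuous.aestronglyMeasurable hkB)

/-! ### Properties of the cutoff, and localisation of the quadratic form of `|D|`. -/

section cutoff

variable {R : ℝ} {φ : ℝ → ℝ}

theorem IsCutoff.contDiff_deriv (hφ : IsCutoff R φ) : ContDiff ℝ ∞ (deriv φ) :=
  (contDiff_infty_iff_deriv.1 hφ.smooth).2

theorem IsCutoff.hasCompactSupport_deriv (hφ : IsCutoff R φ) : HasCompactSupport (deriv φ) := by
  refine HasCompactSupport.of_support_subset_isCompact (isCompact_Icc (a := -(R + 1)) (b := R + 1))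
    fun x hx => ?_
  by_contra h
  refine hx (hφ.deriv_eq_zero x ?_)
  by_contra h'
  exact h (abs_le.1 (not_le.1 h').le)

theorem exists_bound_of_hasCompactSupport {f : ℝ → ℝ} (hf : Continuous f)
    (hc : HasCompactSupport f) : ∃ C, 0 ≤ C ∧ ∀ x, |f x| ≤ C := by
  obtain ⟨C, hC⟩ := hf.bounded_above_of_compact_support hc
  exact ⟨C, (norm_nonneg _).trans (hC 0), hC⟩

theorem IsCutoff.exists_deriv2 (hφ : IsCutoff R φ) :
    ∃ C, 0 ≤ C ∧ ∀ x, |deriv (deriv φ) x| ≤ C :=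
  exists_bound_of_hasCompactSupport (hφ.contDiff_deriv.continuous_deriv (by norm_num))
    hφ.hasCompactSupport_deriv.deriv

theorem IsCutoff.contDiff_deriv2 (hφ : IsCutoff R φ) : ContDiff ℝ ∞ (deriv (deriv φ)) :=
  (contDiff_infty_iff_deriv.1 hφ.contDiff_deriv).2

theorem IsCutoff.exists_deriv3 (hφ : IsCutoff R φ) :
    ∃ C, 0 ≤ C ∧ ∀ x, |deriv (deriv (deriv φ)) x| ≤ C :=
  exists_bound_of_hasCompactSupport (hφ.contDiff_deriv2.continuous_deriv (by norm_num))
    hφ.hasCompactSupport_deriv.deriv.deriv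

theorem IsCutoff.exists_deriv_sqrt (hφ : IsCutoff R φ) :
    ∃ C, 0 ≤ C ∧ ∀ x, |deriv (fun x => √(deriv φ x)) x| ≤ C :=
  exists_bound_of_hasCompactSupport (hφ.sqrt_smooth.continuous_deriv (by norm_num))
    hφ.sqrt_compact.deriv

theorem IsCutoff.abs_deriv_le (hφ : IsCutoff R φ) (x : ℝ) : |deriv φ x| ≤ 1 := by
  rw [abs_of_nonneg (hφ.deriv_nonneg x)]
  exact hφ.deriv_le_one x

theorem IsCutoff.abs_apply_le (hφ : IsCutoff R φ) (x : ℝ) : |φ x| ≤ 2 + 2 * R := by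
  rw [abs_of_nonneg (zero_le_one.trans (hφ.one_le x))]
  exact hφ.le x

theorem IsCutoff.sqrt_le_one (hφ : IsCutoff R φ) (x : ℝ) : √(deriv φ x) ≤ 1 :=
  Real.sqrt_le_one.2 (hφ.deriv_le_one x)

theorem abs_sub_le_of_deriv {k : ℝ → ℝ} (hk : Differentiable ℝ k) {C : ℝ}
    (hC : ∀ x, |deriv k x| ≤ C) (x y : ℝ) : |k (x + y) - k x| ≤ C * |y| := by
  have := Convex.norm_image_sub_le_of_norm_deriv_le (f := k) (s := Set.univ) (C := C)
    (fun x _ => hk x) (fun x _ => hC x) convex_univ (Set.mem_univ x) (Set.mem_univ (x + y))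
  simpa using this

theorem IsCutoff.isH1_sqrt_mul (hφ : IsCutoff R φ) {w : ℝ → ℝ} (hw : IsH2 w) :
    IsH1 fun x => √(deriv φ x) * w x := by
  obtain ⟨C, _, hC⟩ := hφ.exists_deriv_sqrt
  exact isH1_mul (hφ.sqrt_smooth.of_le (by norm_num))
    (fun x => by rw [abs_of_nonneg (Real.sqrt_nonneg _)]; exact hφ.sqrt_le_one x) hC
    hw.contDiff hw.h1

theorem IsCutoff.isH1_deriv_mul (hφ : IsCutoff R φ) {w : ℝ → ℝ} (hw : IsH2 w) :
    IsH1 fun x => deriv φ x * w x := by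
  obtain ⟨C, _, hC⟩ := hφ.exists_deriv2
  exact isH1_mul (hφ.contDiff_deriv.of_le (by norm_num)) hφ.abs_deriv_le hC hw.contDiff hw.h1

theorem IsCutoff.isH1_mul (hφ : IsCutoff R φ) {w : ℝ → ℝ} (hw : IsH2 w) :
    IsH1 fun x => φ x * w x :=
  BenjaminOno.isH1_mul (hφ.smooth.of_le (by norm_num)) hφ.abs_apply_le hφ.abs_deriv_le hw.contDiff hw.h1

theorem integrable_mul_shift {f g : ℝ → ℝ} (hf : MemLp f 2 volume) (hg : MemLp g 2 volume)
    (y : ℝ) : Integrable fun x => f x * g (x + y) :=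
  hf.integrable_mul (memLp_shift hg y)

theorem integral_secondDiff_mul {w g : ℝ → ℝ} (hw : MemLp w 2 volume) (hg : MemLp g 2 volume)
    (y : ℝ) : ∫ x, secondDiff w y x * g x =
      2 * (∫ x, w x * g x) - (∫ x, w x * g (x + y)) - ∫ x, g x * w (x + y) := by
  have i1 : Integrable fun x => w x * g x := hw.integrable_mul hg
  have i2 : Integrable fun x => w (x - y) * g x := (memLp_shift_sub hw y).integrable_mul hg
  have i3 := integrable_mul_shift hg hw y
  have e : ∫ x, w x * g (x + y) = ∫ x, w (x - y) * g x := by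
    rw [← integral_sub_right_eq_self (fun x => w x * g (x + y)) y]
    simp
  rw [e, ← integral_const_mul, ← integral_sub (i1.const_mul 2) i2,
    ← integral_sub (f := fun x => 2 * (w x * g x) - w (x - y) * g x) ((i1.const_mul 2).sub i2) i3]
  refine integral_congr_ae (Eventually.of_forall fun x => ?_)
  simp only [secondDiff]
  ring

/-- Localisation of the quadratic form of `|D|`. -/
theorem integral_secondDiff_mul_sq_mul {k w : ℝ → ℝ} {B : ℝ} (hw : MemLp w 2 volume)
    (hk : Continuous k) (hB : ∀ x, |k x| ≤ B) (y : ℝ) :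
    ∫ x, secondDiff w y x * (k x ^ 2 * w x) =
      (∫ x, (k (x + y) * w (x + y) - k x * w x) ^ 2) -
        ∫ x, (k (x + y) - k x) ^ 2 * (w x * w (x + y)) := by
  have hB2 : ∀ x, |k x ^ 2| ≤ B ^ 2 := fun x => by
    rw [abs_pow]; exact pow_le_pow_left₀ (abs_nonneg _) (hB x) 2
  have hg : MemLp (fun x => k x ^ 2 * w x) 2 volume :=
    memLp_bdd_mul hw (hk.pow 2).aestronglyMeasurable hB2
  have hf : MemLp (fun x => k x * w x) 2 volume :=
    memLp_bdd_mul hw hk.aestronglyMeasurable hB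
  rw [integral_secondDiff_mul hw hg]
  have i1 : Integrable fun x => w x * (k x ^ 2 * w x) := hw.integrable_mul hg
  have i1' : Integrable fun x => w (x + y) * (k (x + y) ^ 2 * w (x + y)) :=
    (memLp_shift hw y).integrable_mul (memLp_shift hg y)
  have i2 : Integrable fun x => w x * (k (x + y) ^ 2 * w (x + y)) := integrable_mul_shift hw hg y
  have i3 : Integrable fun x => (k x ^ 2 * w x) * w (x + y) := integrable_mul_shift hg hw y
  have i4 : Integrable fun x => (k (x + y) * w (x + y) - k x * w x) ^ 2 :=
    ((memLp_shift hf y).sub hf).integrable_sq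
  have e1 : ∫ x, w x * (k x ^ 2 * w x) = ∫ x, w (x + y) * (k (x + y) ^ 2 * w (x + y)) :=
    (integral_add_right_eq_self (fun x => w x * (k x ^ 2 * w x)) y).symm
  have e2 : ∫ x, (k (x + y) - k x) ^ 2 * (w x * w (x + y)) =
      ∫ x, ((k (x + y) * w (x + y) - k x * w x) ^ 2 - w x * (k x ^ 2 * w x)
        - w (x + y) * (k (x + y) ^ 2 * w (x + y)) + w x * (k (x + y) ^ 2 * w (x + y))
        + (k x ^ 2 * w x) * w (x + y)) := by
    refine integral_congr_ae (Eventually.of_forall fun x => ?_)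
    simp only
    ring
  have j1 := i4.sub i1
  have j2 := j1.sub i1'
  have e3 := integral_add (j2.add i2) i3
  simp only [Pi.add_apply, Pi.sub_apply] at e3
  have e4 := integral_add j2 i2
  have e5 := integral_sub j1 i1'
  have e6 := integral_sub i4 i1
  simp only [Pi.sub_apply] at e4 e5
  rw [e2, e3, e4, e5, e6, ← e1]
  ring

/-- Apply the localisation identity with `k = √φ'`, at each shift `y`. The error kernel `(χ(x+y) -
χ(x))²/y²` is bounded by a multiple of `rho`, because `χ = √φ'` is Lipschitz and takes values in
`[0, 1]`; this is where smoothness of the square root is needed. -/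
theorem IsCutoff.exists_localisation (hφ : IsCutoff R φ) : ∃ C, 0 ≤ C ∧ ∀ w, IsH2 w →
    (1 / Real.pi) * gagliardo (fun x => √(deriv φ x) * w x) - C * ∫ x, w x ^ 2 ≤
      ∫ x, lam w x * (deriv φ x * w x) := by
  obtain ⟨C, hC0, hC⟩ := hφ.exists_deriv_sqrt
  set χ : ℝ → ℝ := fun x => √(deriv φ x) with hχ
  have hχc : Continuous χ := hφ.sqrt_smooth.continuous
  have hχ0 : ∀ x, 0 ≤ χ x := fun x => Real.sqrt_nonneg _
  have hχ1 : ∀ x, χ x ≤ 1 := hφ.sqrt_le_one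
  set k : ℝ → ℝ → ℝ := fun y x => (χ (x + y) - χ x) ^ 2 / y ^ 2 with hk
  have hkm : Measurable (Function.uncurry k) := by
    have := hχc.measurable
    simp only [hk, Function.uncurry_def]
    fun_prop
  have hkle : ∀ y, 0 < y → ∀ x, |k y x| ≤ (C ^ 2 + 1) * rho y := by
    intro y hy x
    rw [abs_of_nonneg (by positivity), div_le_iff₀ (by positivity)]
    rcases le_total 1 ((y ^ 2)⁻¹) with h | h
    · rw [rho, min_eq_left h, ← sq_abs]
      have := abs_sub_le_of_deriv (hφ.sqrt_smooth.differentiable (by norm_num)) hC x y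
      rw [abs_of_pos hy] at this
      have := pow_le_pow_left₀ (abs_nonneg _) this 2
      nlinarith [sq_nonneg y]
    · rw [rho, min_eq_right h, mul_assoc, inv_mul_cancel₀ (by positivity)]
      have : |χ (x + y) - χ x| ≤ 1 := by
        rw [abs_le]
        constructor <;> linarith [hχ0 x, hχ1 x, hχ0 (x + y), hχ1 (x + y)]
      have := pow_le_pow_left₀ (abs_nonneg _) this 2
      rw [sq_abs] at this
      nlinarith [sq_nonneg C]
  have hkae : ∀ᵐ y ∂(volume.restrict (Set.Ioi (0 : ℝ))), ∀ x, |k y x| ≤ (C ^ 2 + 1) * rho y := by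
    filter_upwards [ae_restrict_mem measurableSet_Ioi] with y hy
    exact hkle y hy
  have hI : 0 ≤ ∫ y in Set.Ioi 0, rho y := integral_nonneg fun y => rho_nonneg y
  refine ⟨(1 / Real.pi) * ((C ^ 2 + 1) * ∫ y in Set.Ioi 0, rho y), by positivity, fun w hw => ?_⟩
  have hκ : Integrable (fun y => (C ^ 2 + 1) * rho y) (volume.restrict (Set.Ioi 0)) :=
    integrableOn_rho.const_mul _
  have hb := abs_integral_kernel_le hw.h1.memLp hκ hkae
  have hi := (integrable_kernel hw.h1.memLp hw.h1.memLp hw.measurable hw.measurable hkm hκ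
    hkae).integral_prod_left
  rw [integral_const_mul] at hb
  have hg : IsH1 fun x => deriv φ x * w x := hφ.isH1_deriv_mul hw
  rw [integral_lam_mul hw hg.memLp hg.continuous.measurable]
  have e : ∀ y, (∫ x, secondDiff w y x * (deriv φ x * w x)) / y ^ 2 =
      (∫ x, (χ (x + y) * w (x + y) - χ x * w x) ^ 2) / y ^ 2 -
        ∫ x, k y x * (w x * w (x + y)) := by
    intro y
    have h1 := integral_secondDiff_mul_sq_mul hw.h1.memLp hχc
      (fun x => by rw [abs_of_nonneg (hχ0 x)]; exact hχ1 x) y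
    have h2 : ∀ x, χ x ^ 2 = deriv φ x := fun x => Real.sq_sqrt (hφ.deriv_nonneg x)
    simp only [h2] at h1
    rw [h1, sub_div, ← integral_div (y ^ 2) fun x => (χ (x + y) - χ x) ^ 2 * (w x * w (x + y))]
    congr 1
    refine integral_congr_ae (Eventually.of_forall fun x => ?_)
    simp only [hk]
    ring
  simp only [e]
  rw [integral_sub (hφ.isH1_sqrt_mul hw).integrableOn_gagliardo hi, mul_sub, gagliardo,
    mul_assoc (1 / Real.pi)]
  have := (_root_.abs_le.1 hb).2
  have hpi : 0 ≤ 1 / Real.pi := by positivity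
  linarith [mul_le_mul_of_nonneg_left this hpi]

end cutoff

/-! ### The commutator of the weight with `∂ₓ|D|`, coercivity, and the cubic term. -/

section transport

variable {R : ℝ} {φ w : ℝ → ℝ}

/-- The trapezoidal error kernel, which represents the commutator of `φ` with `∂ₓ|D|`. -/
noncomputable def trapKernel (φ : ℝ → ℝ) (y x : ℝ) : ℝ :=
  (deriv φ x + deriv φ (x + y)) / y ^ 2 - 2 * (φ (x + y) - φ x) / y ^ 3

theorem IsCutoff.hasDerivAt (hφ : IsCutoff R φ) (x : ℝ) : HasDerivAt φ (deriv φ x) x :=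
  (hφ.smooth.differentiable (by norm_num) x).hasDerivAt

theorem IsCutoff.hasDerivAt_deriv (hφ : IsCutoff R φ) (x : ℝ) :
    HasDerivAt (deriv φ) (deriv (deriv φ) x) x :=
  (hφ.contDiff_deriv.differentiable (by norm_num) x).hasDerivAt

theorem abs_le_mul_of_deriv_le {h h' : ℝ → ℝ} {y C : ℝ} (hy : 0 ≤ y) (h0 : h 0 = 0)
    (hd : ∀ t, HasDerivAt h (h' t) t) (hC : ∀ t ∈ Set.Icc 0 y, |h' t| ≤ C) : |h y| ≤ C * y := by
  have := Convex.norm_image_sub_le_of_norm_hasDerivWithin_le (f := h) (f' := h')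
    (s := Set.Icc 0 y) (C := C) (fun t _ => (hd t).hasDerivWithinAt) hC (convex_Icc 0 y)
    (Set.left_mem_Icc.2 hy) (Set.right_mem_Icc.2 hy)
  simpa [h0, abs_of_nonneg hy] using this

/-- The kernel is `2/y³` times the error of the trapezoidal rule for `φ'` on `[x, x+y]`. That error
is `O(y³)` as `φ'''` is bounded, and also `O(y)` as `φ'` is bounded; the two cover small and large
`y`. -/
theorem IsCutoff.exists_trapKernel_le (hφ : IsCutoff R φ) :
    ∃ C, 0 ≤ C ∧ ∀ y, 0 < y → ∀ x, |trapKernel φ y x| ≤ C * rho y := by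
  obtain ⟨C, hC0, hC⟩ := hφ.exists_deriv3
  refine ⟨C + 4, by positivity, fun y hy x => ?_⟩
  have e : trapKernel φ y x =
      (y * (deriv φ x + deriv φ (x + y)) - 2 * (φ (x + y) - φ x)) / y ^ 3 := by
    rw [trapKernel]; field_simp
  rw [e, abs_div, abs_of_pos (by positivity : 0 < y ^ 3), div_le_iff₀ (by positivity)]
  rcases le_total 1 ((y ^ 2)⁻¹) with h | h
  · rw [rho, min_eq_left h]
    -- The trapezoidal error, as a function of the interval length `t`, vanishes at `0` with its
    -- first derivative, and its second derivative is `t φ'''(x+t)`. The mean value inequality is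
    -- applied twice.
    have d1 : ∀ t, HasDerivAt (fun t => deriv φ x - deriv φ (x + t) + t * deriv (deriv φ) (x + t))
        (t * deriv (deriv (deriv φ)) (x + t)) t := by
      intro t
      have a1 := (hφ.hasDerivAt_deriv (x + t)).comp_const_add x t
      have a2 := ((hφ.contDiff_deriv2.differentiable (by norm_num) (x + t)).hasDerivAt).comp_const_add x t
      refine (((hasDerivAt_const t (deriv φ x)).sub a1).add ((hasDerivAt_id t).mul a2)).congr_deriv ?_
      simp
    have d2 : ∀ t, HasDerivAt (fun t => t * (deriv φ x + deriv φ (x + t)) - 2 * (φ (x + t) - φ x))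
        (deriv φ x - deriv φ (x + t) + t * deriv (deriv φ) (x + t)) t := by
      intro t
      have a1 := (hφ.hasDerivAt_deriv (x + t)).comp_const_add x t
      have a0 := (hφ.hasDerivAt (x + t)).comp_const_add x t
      refine (((hasDerivAt_id t).mul (a1.const_add (deriv φ x))).sub
        ((a0.sub_const (φ x)).const_mul 2)).congr_deriv ?_
      simp only [id]
      ring
    have b1 : ∀ s ∈ Set.Icc 0 y,
        |deriv φ x - deriv φ (x + s) + s * deriv (deriv φ) (x + s)| ≤ C * y ^ 2 := by
      intro s hs
      have := abs_le_mul_of_deriv_le (C := C * y) hs.1 (by simp) d1 fun t ht => by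
        rw [abs_mul, abs_of_nonneg ht.1, mul_comm]
        exact mul_le_mul (hC _) (ht.2.trans hs.2) ht.1 hC0
      refine this.trans ?_
      rw [sq, ← mul_assoc]
      exact mul_le_mul_of_nonneg_left hs.2 (by positivity)
    have b2 := abs_le_mul_of_deriv_le hy.le (by simp) d2 b1
    have h3 : 0 < y ^ 3 := by positivity
    nlinarith
  · rw [rho, min_eq_right h]
    have h1 := _root_.abs_le.1 (hφ.abs_deriv_le x)
    have h2 := _root_.abs_le.1 (hφ.abs_deriv_le (x + y))
    have h3 := abs_sub_le_of_deriv (hφ.smooth.differentiable (by norm_num)) hφ.abs_deriv_le x y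
    rw [abs_of_pos hy, one_mul] at h3
    have h3 := _root_.abs_le.1 h3
    have e2 : (C + 4) * (y ^ 2)⁻¹ * y ^ 3 = (C + 4) * y := by field_simp
    rw [e2, _root_.abs_le]
    have := mul_nonneg hC0 hy.le
    constructor <;> nlinarith

theorem integral_mul_deriv_eq_neg {f g f' g' : ℝ → ℝ} (hf : ∀ x, HasDerivAt f (f' x) x)
    (hg : ∀ x, HasDerivAt g (g' x) x) (h1 : Integrable fun x => f x * g' x)
    (h2 : Integrable fun x => f' x * g x) (h3 : Integrable fun x => f x * g x) :
    ∫ x, f x * g' x = - ∫ x, f' x * g x :=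
  integral_mul_deriv_eq_deriv_mul_of_integrable (fun x _ => hf x) (fun x _ => hg x) h1 h2 h3

/-- The derivative in `y` of `w(x) w(x+y) (φ(x+y) - φ(x)) / y²`. -/
noncomputable def transportDeriv (φ w : ℝ → ℝ) (y x : ℝ) : ℝ :=
  (φ (x + y) - φ x) / y ^ 2 * (w x * deriv w (x + y)) +
    (deriv φ (x + y) / y ^ 2 - 2 * (φ (x + y) - φ x) / y ^ 3) * (w x * w (x + y))

/-- Integration by parts in `x` rewrites the products of `φ w` with `w'` and with its translate. The
remainder is a kernel term without derivatives of `w`, an exact `y`-derivative, and the singular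
term `∫ φ' w² / y²`, which later cancels a boundary contribution of the exact derivative. -/
theorem integral_secondDiff_mul_deriv (hφ : IsCutoff R φ) (hw : IsH2 w) {y : ℝ} (hy : 0 < y) :
    (∫ x, secondDiff w y x * (φ x * deriv w x)) / y ^ 2 =
      (∫ x, trapKernel φ y x * (w x * w (x + y))) - (∫ x, deriv φ x * w x ^ 2) / y ^ 2 -
        ∫ x, transportDeriv φ w y x := by
  have L := hw.h1.memLp
  have L' := hw.h1.memLp_deriv
  have hφc := hφ.smooth.continuous
  have hφc' := hφ.contDiff_deriv.continuous
  have Lφ : MemLp (fun x => φ x * w x) 2 volume :=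
    memLp_bdd_mul L hφc.aestronglyMeasurable hφ.abs_apply_le
  have Lφ' : MemLp (fun x => deriv φ x * w x) 2 volume :=
    memLp_bdd_mul L hφc'.aestronglyMeasurable hφ.abs_deriv_le
  have Ld : MemLp (fun x => φ x * deriv w x) 2 volume :=
    memLp_bdd_mul L' hφc.aestronglyMeasurable hφ.abs_apply_le
  have dφw : ∀ x, HasDerivAt (fun x => φ x * w x) (deriv φ x * w x + φ x * deriv w x) x :=
    fun x => (hφ.hasDerivAt x).mul (hw.hasDerivAt x)
  have s1 : ∫ x, (φ x * w x) * deriv w x = - ∫ x, (deriv φ x * w x + φ x * deriv w x) * w x :=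
    integral_mul_deriv_eq_neg dφw hw.hasDerivAt (Lφ.integrable_mul L')
      ((Lφ'.add Ld).integrable_mul L) (Lφ.integrable_mul L)
  have s2 : ∫ x, (φ x * w x) * deriv w (x + y) =
      - ∫ x, (deriv φ x * w x + φ x * deriv w x) * w (x + y) :=
    integral_mul_deriv_eq_neg dφw (fun x => (hw.hasDerivAt (x + y)).comp_add_const x y)
      (integrable_mul_shift Lφ L' y) (integrable_mul_shift (Lφ'.add Ld) L y)
      (integrable_mul_shift Lφ L y)
  have i1 : Integrable fun x => (deriv φ x * w x) * w x := Lφ'.integrable_mul L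
  have i2 : Integrable fun x => (φ x * deriv w x) * w x := Ld.integrable_mul L
  have i3 : Integrable fun x => (deriv φ x * w x) * w (x + y) := integrable_mul_shift Lφ' L y
  have i4 : Integrable fun x => (φ x * deriv w x) * w (x + y) := integrable_mul_shift Ld L y
  have i5 : Integrable fun x => w x * (φ (x + y) * deriv w (x + y)) := integrable_mul_shift L Ld y
  have i6 : Integrable fun x => (φ x * w x) * deriv w (x + y) := integrable_mul_shift Lφ L' y
  simp only [add_mul] at s1 s2
  rw [integral_add i1 i2] at s1
  rw [integral_add i3 i4] at s2
  have e1 : ∫ x, (φ x * w x) * deriv w x = ∫ x, w x * (φ x * deriv w x) :=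
    integral_congr_ae (Eventually.of_forall fun x => by simp only; ring)
  have e2 : ∫ x, (φ x * deriv w x) * w x = ∫ x, w x * (φ x * deriv w x) :=
    integral_congr_ae (Eventually.of_forall fun x => by simp only; ring)
  have e3 : ∫ x, (deriv φ x * w x) * w x = ∫ x, deriv φ x * w x ^ 2 :=
    integral_congr_ae (Eventually.of_forall fun x => by simp only; ring)
  have e4 : (∫ x, trapKernel φ y x * (w x * w (x + y))) - ∫ x, transportDeriv φ w y x =
      ((∫ x, (deriv φ x * w x) * w (x + y)) - (∫ x, w x * (φ (x + y) * deriv w (x + y))) +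
        ∫ x, (φ x * w x) * deriv w (x + y)) / y ^ 2 := by
    have t1 : Integrable fun x => trapKernel φ y x * (w x * w (x + y)) := by
      obtain ⟨C, _, hC⟩ := hφ.exists_trapKernel_le
      refine (integrable_mul_shift L L y).bdd_mul (c := C * rho y) ?_
        (Eventually.of_forall fun x => hC y hy x)
      unfold trapKernel
      have : Continuous fun x => (deriv φ x + deriv φ (x + y)) / y ^ 2 -
        2 * (φ (x + y) - φ x) / y ^ 3 := by fun_prop
      exact this.aestronglyMeasurable
    have t2 : Integrable fun x => ((deriv φ x * w x) * w (x + y) -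
        w x * (φ (x + y) * deriv w (x + y)) + (φ x * w x) * deriv w (x + y)) / y ^ 2 :=
      ((i3.sub i5).add i6).div_const _
    have t3 : ∀ x, transportDeriv φ w y x = trapKernel φ y x * (w x * w (x + y)) -
        ((deriv φ x * w x) * w (x + y) -
        w x * (φ (x + y) * deriv w (x + y)) + (φ x * w x) * deriv w (x + y)) / y ^ 2 := by
      intro x
      rw [transportDeriv, trapKernel]
      ring
    simp only [t3]
    rw [integral_sub t1 t2, integral_div, integral_add (f := fun x => (deriv φ x * w x) * w (x + y) -
        w x * (φ (x + y) * deriv w (x + y))) (i3.sub i5) i6, integral_sub i3 i5]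
    ring
  rw [integral_secondDiff_mul L Ld]
  have hy2 : y ^ 2 ≠ 0 := by positivity
  rw [eq_div_iff hy2] at e4
  rw [sub_mul] at e4
  rw [div_eq_iff hy2, sub_mul, sub_mul, div_mul_cancel₀ _ hy2]
  linarith

theorem integrable_transportDeriv (hφ : IsCutoff R φ) (hw : IsH2 w) {a b : ℝ} (ha : 0 < a) :
    Integrable (fun p : ℝ × ℝ => transportDeriv φ w p.1 p.2)
      ((volume.restrict (Set.Ioc a b)).prod volume) := by
  have hφm := hφ.smooth.continuous.measurable
  have hφm' := hφ.contDiff_deriv.continuous.measurable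
  have h3 := abs_sub_le_of_deriv (hφ.smooth.differentiable (by norm_num)) hφ.abs_deriv_le
  have hκ1 : Integrable (fun _ : ℝ => 1 / a) (volume.restrict (Set.Ioc a b)) := integrable_const _
  have hκ2 : Integrable (fun _ : ℝ => 3 / a ^ 2) (volume.restrict (Set.Ioc a b)) :=
    integrable_const _
  unfold transportDeriv
  refine Integrable.add (integrable_kernel (k := fun y x => (φ (x + y) - φ x) / y ^ 2)
    hw.h1.memLp hw.h1.memLp_deriv hw.measurable
    (measurable_deriv w) ?_ hκ1 ?_) (integrable_kernel (k := fun y x => deriv φ (x + y) / y ^ 2 -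
      2 * (φ (x + y) - φ x) / y ^ 3) hw.h1.memLp hw.h1.memLp hw.measurable
    hw.measurable ?_ hκ2 ?_)
  · simp only [Function.uncurry_def]; fun_prop
  · filter_upwards [ae_restrict_mem measurableSet_Ioc] with y hy x
    have hy0 : 0 < y := ha.trans hy.1
    have := h3 x y
    rw [abs_of_pos hy0, one_mul] at this
    rw [abs_div, abs_of_pos (by positivity : 0 < y ^ 2)]
    calc |φ (x + y) - φ x| / y ^ 2 ≤ y / y ^ 2 := by gcongr
      _ = 1 / y := by field_simp
      _ ≤ 1 / a := by gcongr; exact hy.1.le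
  · simp only [Function.uncurry_def]; fun_prop
  · filter_upwards [ae_restrict_mem measurableSet_Ioc] with y hy x
    have hy0 : 0 < y := ha.trans hy.1
    have h1 := h3 x y
    rw [abs_of_pos hy0, one_mul] at h1
    have h2 := hφ.abs_deriv_le (x + y)
    have e : deriv φ (x + y) / y ^ 2 - 2 * (φ (x + y) - φ x) / y ^ 3 =
        (deriv φ (x + y) * y - 2 * (φ (x + y) - φ x)) / y ^ 3 := by field_simp
    have h4 : |deriv φ (x + y) * y - 2 * (φ (x + y) - φ x)| ≤ 3 * y := by
      have h1 := _root_.abs_le.1 h1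
      have h2 := _root_.abs_le.1 h2
      rw [_root_.abs_le]
      constructor <;> nlinarith
    rw [e, abs_div, abs_of_pos (by positivity : 0 < y ^ 3)]
    calc _ ≤ 3 * y / y ^ 3 := by gcongr
      _ = 3 / y ^ 2 := by field_simp
      _ ≤ 3 / a ^ 2 := by gcongr; exact hy.1.le

/-- The correlation `∫ w(x) w(x+y) (φ(x+y) - φ(x)) dx`. -/
noncomputable def transportCorr (φ w : ℝ → ℝ) (y : ℝ) : ℝ :=
  ∫ x, (φ (x + y) - φ x) * (w x * w (x + y))

/-- Fubini and the fundamental theorem of calculus in `y`. The interval stays away from `0`, where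
the two boundary terms and the singular term are not separately bounded. -/
theorem integral_transportDeriv (hφ : IsCutoff R φ) (hw : IsH2 w) {a b : ℝ} (ha : 0 < a)
    (hab : a ≤ b) : ∫ y in Set.Ioc a b, ∫ x, transportDeriv φ w y x =
      transportCorr φ w b / b ^ 2 - transportCorr φ w a / a ^ 2 := by
  have hi := integrable_transportDeriv hφ hw (b := b) ha
  have hφc := hφ.smooth.continuous
  have hφc' := hφ.contDiff_deriv.continuous
  have hwc := hw.contDiff.continuous
  have hwc' := hw.contDiff.continuous_deriv le_rfl
  rw [integral_integral_swap hi]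
  have e : ∀ x, ∫ y in Set.Ioc a b, transportDeriv φ w y x =
      (φ (x + b) - φ x) * (w x * w (x + b)) / b ^ 2 -
        (φ (x + a) - φ x) * (w x * w (x + a)) / a ^ 2 := by
    intro x
    rw [← intervalIntegral.integral_of_le hab]
    have hsub : ∀ y ∈ Set.uIcc a b, y ≠ 0 := by
      intro y hy
      rw [Set.uIcc_of_le hab] at hy
      exact (ha.trans_le hy.1).ne'
    refine intervalIntegral.integral_eq_sub_of_hasDerivAt
      (f := fun y => (φ (x + y) - φ x) * (w x * w (x + y)) / y ^ 2) (fun y hy => ?_) ?_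
    · have hy0 := hsub y hy
      have a0 := (hφ.hasDerivAt (x + y)).comp_const_add x y
      have a1 := (hw.hasDerivAt (x + y)).comp_const_add x y
      refine (((a0.sub_const (φ x)).mul (a1.const_mul (w x))).div
        (hasDerivAt_pow 2 y) (pow_ne_zero 2 hy0)).congr_deriv ?_
      simp only [transportDeriv, Pi.mul_apply]
      field_simp
      push_cast
      ring
    · refine ContinuousOn.intervalIntegrable ?_
      unfold transportDeriv
      have h2 : ∀ y ∈ Set.uIcc a b, y ^ 2 ≠ 0 := fun y hy => pow_ne_zero 2 (hsub y hy)
      have h3 : ∀ y ∈ Set.uIcc a b, y ^ 3 ≠ 0 := fun y hy => pow_ne_zero 3 (hsub y hy)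
      fun_prop (disch := assumption)
  have hint : ∀ y, Integrable fun x => (φ (x + y) - φ x) * (w x * w (x + y)) / y ^ 2 := by
    intro y
    have h1 := (integrable_mul_shift hw.h1.memLp hw.h1.memLp y).bdd_mul (c := |y|)
      (f := fun x => φ (x + y) - φ x) (by fun_prop) (Eventually.of_forall fun x => by
        simpa using abs_sub_le_of_deriv (hφ.smooth.differentiable (by norm_num))
          hφ.abs_deriv_le x y)
    exact h1.div_const _
  simp only [e]
  rw [integral_sub (hint b) (hint a), integral_div, integral_div, transportCorr, transportCorr]

/-- Near `y = 0` the correlation is `y ∫ φ' w²` up to `O(y³)`. The trapezoidal rule replaces `φ(x+y)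
- φ(x)` by `y (φ'(x) + φ'(x+y))/2`, and polarisation turns the result into `y ∫ φ' w²` minus `y/2`
times a product of differences of `w` and `φ' w`, each of size `O(y)` in `L²`. The constant may
depend on derivatives of `w`, as the term is only used in the limit. -/
theorem transportCorr_sub_le (hφ : IsCutoff R φ) (hw : IsH2 w) {y : ℝ} (hy : 0 < y) :
    |(transportCorr φ w y - y * ∫ x, deriv φ x * w x ^ 2) / y ^ 2| ≤
      y * (|∫ x, trapKernel φ y x * (w x * w (x + y))| +
        √(∫ x, deriv w x ^ 2) * √(∫ x, deriv (fun x => deriv φ x * w x) x ^ 2)) := by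
  have L := hw.h1.memLp
  have hφc := hφ.smooth.continuous
  have hφc' := hφ.contDiff_deriv.continuous
  have hg := hφ.isH1_deriv_mul hw
  have Lg := hg.memLp
  set g : ℝ → ℝ := fun x => deriv φ x * w x with hgdef
  have t1 : Integrable fun x => trapKernel φ y x * (w x * w (x + y)) := by
    obtain ⟨C, _, hC⟩ := hφ.exists_trapKernel_le
    refine (integrable_mul_shift L L y).bdd_mul (c := C * rho y) ?_
      (Eventually.of_forall fun x => hC y hy x)
    unfold trapKernel
    have : Continuous fun x => (deriv φ x + deriv φ (x + y)) / y ^ 2 -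
      2 * (φ (x + y) - φ x) / y ^ 3 := by fun_prop
    exact this.aestronglyMeasurable
  have i1 : Integrable fun x => w x * g x := L.integrable_mul Lg
  have i1' : Integrable fun x => w (x + y) * g (x + y) :=
    (memLp_shift L y).integrable_mul (memLp_shift Lg y)
  have i2 : Integrable fun x => (w (x + y) - w x) * (g (x + y) - g x) :=
    ((memLp_shift L y).sub L).integrable_mul ((memLp_shift Lg y).sub Lg)
  have e0 : ∫ x, deriv φ x * w x ^ 2 = ∫ x, w x * g x :=
    integral_congr_ae (Eventually.of_forall fun x => by simp only [hgdef]; ring)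
  have e0' : ∫ x, w x * g x = ∫ x, w (x + y) * g (x + y) :=
    (integral_add_right_eq_self (fun x => w x * g x) y).symm
  have key : transportCorr φ w y = y / 2 * ((∫ x, w x * g x) + (∫ x, w (x + y) * g (x + y)) -
      ∫ x, (w (x + y) - w x) * (g (x + y) - g x)) -
      y ^ 3 / 2 * ∫ x, trapKernel φ y x * (w x * w (x + y)) := by
    have j := (((i1.add i1').sub i2).const_mul (y / 2))
    rw [← integral_add i1 i1', ← integral_sub (f := fun x => w x * g x + w (x + y) * g (x + y))
      (i1.add i1') i2, ← integral_const_mul, ← integral_const_mul,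
      ← integral_sub (f := fun x => y / 2 * (w x * g x + w (x + y) * g (x + y) -
        (w (x + y) - w x) * (g (x + y) - g x))) j (t1.const_mul _), transportCorr]
    refine integral_congr_ae (Eventually.of_forall fun x => ?_)
    simp only [trapKernel, hgdef]
    field_simp
    ring
  have e1 : (transportCorr φ w y - y * ∫ x, deriv φ x * w x ^ 2) / y ^ 2 =
      -(y / 2) * (∫ x, trapKernel φ y x * (w x * w (x + y))) -
        (∫ x, (w (x + y) - w x) * (g (x + y) - g x)) / (2 * y) := by
    rw [key, e0, ← e0']
    field_simp
    ring
  have e2 : |∫ x, (w (x + y) - w x) * (g (x + y) - g x)| ≤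
      y ^ 2 * (√(∫ x, deriv w x ^ 2) * √(∫ x, deriv g x ^ 2)) := by
    refine (abs_integral_mul_le ((memLp_shift L y).sub L) ((memLp_shift Lg y).sub Lg)).trans ?_
    have b1 := Real.sqrt_le_sqrt (hw.h1.integral_sq_sub_le hy.le)
    have b2 := Real.sqrt_le_sqrt (hg.integral_sq_sub_le hy.le)
    rw [Real.sqrt_mul (by positivity), Real.sqrt_sq hy.le] at b1 b2
    refine (mul_le_mul b1 b2 (by positivity) (by positivity)).trans_eq (by ring)
  rw [e1]
  set S := √(∫ x, deriv w x ^ 2) * √(∫ x, deriv g x ^ 2)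
  have hS : 0 ≤ S := by positivity
  have e3 : |(∫ x, (w (x + y) - w x) * (g (x + y) - g x)) / (2 * y)| ≤ y / 2 * S := by
    rw [abs_div, abs_of_pos (by positivity : 0 < 2 * y), div_le_iff₀ (by positivity)]
    refine e2.trans_eq (by ring)
  refine (abs_sub _ _).trans ?_
  rw [abs_mul, abs_neg, abs_of_pos (by positivity : 0 < y / 2)]
  have := abs_nonneg (∫ x, trapKernel φ y x * (w x * w (x + y)))
  nlinarith [mul_nonneg hy.le hS, mul_nonneg hy.le this]

/-- On `a < y ≤ b` the terms of order `1/a` cancel, so as `a → 0` and `b → ∞` only the trapezoidal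
kernel contributes, and it is bounded by a multiple of `rho` times `‖w‖²`. No derivative of `w`
survives in the constant. -/
theorem IsCutoff.exists_transport_le (hφ : IsCutoff R φ) : ∃ C, 0 ≤ C ∧ ∀ w, IsH2 w →
    |∫ x, lam w x * (φ x * deriv w x)| ≤ C * ∫ x, w x ^ 2 := by
  obtain ⟨C, hC0, hC⟩ := hφ.exists_trapKernel_le
  have hI : 0 ≤ ∫ y in Set.Ioi 0, rho y := integral_nonneg fun y => rho_nonneg y
  have hR : 0 ≤ 2 + 2 * R := (abs_nonneg _).trans (hφ.abs_apply_le 0)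
  refine ⟨(1 / Real.pi) * (C * ∫ y in Set.Ioi 0, rho y), by positivity, fun w hw => ?_⟩
  have L := hw.h1.memLp
  have hW : 0 ≤ ∫ x, w x ^ 2 := integral_nonneg fun x => sq_nonneg _
  have hg : MemLp (fun x => φ x * deriv w x) 2 volume :=
    memLp_bdd_mul hw.h1.memLp_deriv hφ.smooth.continuous.aestronglyMeasurable hφ.abs_apply_le
  have hgm : Measurable fun x => φ x * deriv w x :=
    hφ.smooth.continuous.measurable.mul (measurable_deriv w)
  rw [integral_lam_mul hw hg hgm, abs_mul, abs_of_pos (by positivity : 0 < 1 / Real.pi), mul_assoc]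
  refine mul_le_mul_of_nonneg_left ?_ (by positivity)
  have hJ := integrableOn_integral_secondDiff_mul hw hg hgm
  set J : ℝ → ℝ := fun y => (∫ x, secondDiff w y x * (φ x * deriv w x)) / y ^ 2 with hJdef
  set n0 := ∫ x, deriv φ x * w x ^ 2 with hn0
  set M : ℝ → ℝ := fun y => ∫ x, trapKernel φ y x * (w x * w (x + y)) with hM
  set S := √(∫ x, deriv w x ^ 2) * √(∫ x, deriv (fun x => deriv φ x * w x) x ^ 2)
  have hMle : ∀ y, 0 < y → |M y| ≤ C * rho y * ∫ x, w x ^ 2 := by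
    intro y hy
    refine (abs_integral_kernel_mul_le L (memLp_shift L y) (hC y hy)).trans_eq ?_
    rw [integral_sq_shift, Real.mul_self_sqrt hW]
  have hkm : Measurable (Function.uncurry (trapKernel φ)) := by
    have h1 := hφ.smooth.continuous.measurable
    have h2 := hφ.contDiff_deriv.continuous.measurable
    simp only [trapKernel, Function.uncurry_def]
    fun_prop
  have hMi : IntegrableOn M (Set.Ioi 0) := by
    have hae : ∀ᵐ y ∂(volume.restrict (Set.Ioi (0 : ℝ))), ∀ x, |trapKernel φ y x| ≤ C * rho y := by
      filter_upwards [ae_restrict_mem measurableSet_Ioi] with y hy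
      exact hC y hy
    exact (integrable_kernel L L hw.measurable hw.measurable hkm
      (integrableOn_rho.const_mul C) hae).integral_prod_left
  -- The first term on the right is the final bound; the bracket vanishes as `a → 0` and `b → ∞`.
  have hbound : ∀ a b : ℝ, 0 < a → a ≤ b → |∫ y in Set.Ioc a b, J y| ≤
      C * (∫ y in Set.Ioi 0, rho y) * (∫ x, w x ^ 2) +
        (|n0| * b⁻¹ + (2 + 2 * R) * (∫ x, w x ^ 2) * (b⁻¹) ^ 2 +
          a * (C * (∫ x, w x ^ 2) + S)) := by
    intro a b ha hab
    have hb := ha.trans_le hab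
    have hsub : Set.Ioc a b ⊆ Set.Ioi 0 := fun y hy => ha.trans hy.1
    have i1 : IntegrableOn M (Set.Ioc a b) := hMi.mono_set hsub
    have i2 : IntegrableOn (fun y => n0 / y ^ 2) (Set.Ioc a b) := by
      simp only [div_eq_mul_inv]
      exact ((integrableOn_inv_sq_Ioi ha).mono_set Set.Ioc_subset_Ioi_self).const_mul n0
    have i3 : IntegrableOn (fun y => ∫ x, transportDeriv φ w y x) (Set.Ioc a b) :=
      (integrable_transportDeriv hφ hw ha).integral_prod_left
    have e1 : ∫ y in Set.Ioc a b, J y =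
        ∫ y in Set.Ioc a b, (M y - n0 / y ^ 2 - ∫ x, transportDeriv φ w y x) :=
      setIntegral_congr_fun measurableSet_Ioc fun y hy =>
        integral_secondDiff_mul_deriv hφ hw (hsub hy)
    have e2 : ∫ y in Set.Ioc a b, n0 / y ^ 2 = n0 * (a⁻¹ - b⁻¹) := by
      simp only [div_eq_mul_inv]
      rw [integral_const_mul, ← intervalIntegral.integral_of_le hab]
      congr 1
      have hsub' : ∀ y ∈ Set.uIcc a b, y ≠ 0 := by
        intro y hy
        rw [Set.uIcc_of_le hab] at hy
        exact (ha.trans_le hy.1).ne'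
      rw [intervalIntegral.integral_eq_sub_of_hasDerivAt (f := fun y => -y⁻¹)]
      · ring
      · intro y hy
        exact (hasDerivAt_inv (hsub' y hy)).neg.congr_deriv (by ring)
      · refine ContinuousOn.intervalIntegrable ?_
        have h2 : ∀ y ∈ Set.uIcc a b, y ^ 2 ≠ 0 := fun y hy => pow_ne_zero 2 (hsub' y hy)
        fun_prop (disch := assumption)
    rw [e1, integral_sub (f := fun y => M y - n0 / y ^ 2) (Integrable.sub i1 i2) i3, integral_sub i1 i2, e2,
      integral_transportDeriv hφ hw ha hab]
    have b1 : |∫ y in Set.Ioc a b, M y| ≤ C * (∫ y in Set.Ioi 0, rho y) * (∫ x, w x ^ 2) := by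
      calc |∫ y in Set.Ioc a b, M y| ≤ ∫ y in Set.Ioc a b, |M y| := abs_integral_le_integral_abs
        _ ≤ ∫ y in Set.Ioc a b, C * rho y * ∫ x, w x ^ 2 :=
            setIntegral_mono_on i1.abs
              ((Integrable.mul_const ((integrableOn_rho.mono_set hsub).const_mul C)
                (∫ x, w x ^ 2) :)) measurableSet_Ioc fun y hy => hMle y (hsub hy)
        _ ≤ ∫ y in Set.Ioi 0, C * rho y * ∫ x, w x ^ 2 :=
            setIntegral_mono_set ((integrableOn_rho.const_mul C).mul_const (∫ x, w x ^ 2) :)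
              (Eventually.of_forall fun y => mul_nonneg (mul_nonneg hC0 (rho_nonneg y)) hW)
              hsub.eventuallyLE
        _ = _ := by rw [integral_mul_const, integral_const_mul]
    have b2 : |transportCorr φ w b / b ^ 2| ≤ (2 + 2 * R) * (∫ x, w x ^ 2) * (b⁻¹) ^ 2 := by
      rw [abs_div, abs_of_pos (by positivity : 0 < b ^ 2), inv_pow, div_eq_mul_inv]
      refine mul_le_mul_of_nonneg_right ?_ (by positivity)
      refine (abs_integral_kernel_mul_le L (memLp_shift L b) (C := 2 + 2 * R) fun x => ?_).trans_eq ?_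
      · rw [_root_.abs_le]
        constructor <;>
          linarith [hφ.one_le x, hφ.le x, hφ.one_le (x + b), hφ.le (x + b)]
      · rw [integral_sq_shift, Real.mul_self_sqrt hW]
    have b3 := transportCorr_sub_le hφ hw ha
    have b4 : |M a| ≤ C * ∫ x, w x ^ 2 := by
      refine (hMle a ha).trans (mul_le_mul_of_nonneg_right ?_ hW)
      exact mul_le_of_le_one_right hC0 (min_le_left _ _)
    have b5 : |(transportCorr φ w a - a * n0) / a ^ 2| ≤ a * (C * (∫ x, w x ^ 2) + S) :=
      b3.trans (mul_le_mul_of_nonneg_left (add_le_add_left b4 S) ha.le)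
    have b6 : |n0 * b⁻¹| ≤ |n0| * b⁻¹ := by rw [abs_mul, abs_of_pos (inv_pos.2 hb)]
    -- The singular part `n0/a` is paired with the boundary term at `a`; the difference is small by
    -- `b5`.
    have e3 : (∫ y in Set.Ioc a b, M y) - n0 * (a⁻¹ - b⁻¹) -
        (transportCorr φ w b / b ^ 2 - transportCorr φ w a / a ^ 2) =
        (∫ y in Set.Ioc a b, M y) + n0 * b⁻¹ - transportCorr φ w b / b ^ 2 +
          (transportCorr φ w a - a * n0) / a ^ 2 := by field_simp; ring
    rw [e3]
    rw [_root_.abs_le] at b1 b2 b5 b6 ⊢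
    constructor <;> linarith [b1.1, b1.2, b2.1, b2.2, b5.1, b5.2, b6.1, b6.2]
  -- The half line is exhausted by the intervals with `a = 1/(n+1)` and `b = n+1`.
  have ta : Tendsto (fun n : ℕ => 1 / ((n : ℝ) + 1)) atTop (𝓝 0) :=
    tendsto_one_div_add_atTop_nhds_zero_nat
  have tb : Tendsto (fun n : ℕ => (n : ℝ) + 1) atTop atTop :=
    tendsto_atTop_add_const_right _ _ tendsto_natCast_atTop_atTop
  have hcov := ((aecover_Ioi_of_Ioi (μ := (volume : Measure ℝ)) ta).inter
    ((aecover_Iic (μ := volume.restrict (Set.Ioi (0 : ℝ))) tb))).integral_tendsto_of_countably_generated hJ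
  have hlim : Tendsto (fun n : ℕ => ∫ y in Set.Ioc (1 / ((n : ℝ) + 1)) ((n : ℝ) + 1), J y) atTop
      (𝓝 (∫ y in Set.Ioi 0, J y)) := by
    refine hcov.congr fun n => ?_
    have : Set.Ioi (1 / ((n : ℝ) + 1)) ∩ Set.Iic ((n : ℝ) + 1) =
      Set.Ioc (1 / ((n : ℝ) + 1)) ((n : ℝ) + 1) := rfl
    rw [this, Measure.restrict_restrict measurableSet_Ioc, Set.inter_eq_left.2]
    intro y hy
    have : (0 : ℝ) < 1 / ((n : ℝ) + 1) := by positivity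
    exact this.trans hy.1
  have tinv : Tendsto (fun n : ℕ => ((n : ℝ) + 1)⁻¹) atTop (𝓝 0) := tb.inv_tendsto_atTop
  have hrhs := ((tinv.const_mul |n0|).add
    ((tinv.pow 2).const_mul ((2 + 2 * R) * (∫ x, w x ^ 2)))).add
      (ta.mul_const (C * (∫ x, w x ^ 2) + S))
  have hrhs := hrhs.const_add (C * (∫ y in Set.Ioi 0, rho y) * (∫ x, w x ^ 2))
  norm_num only [mul_zero, zero_mul, add_zero] at hrhs
  refine le_of_tendsto_of_tendsto' hlim.abs hrhs fun n => ?_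
  refine hbound _ _ (by positivity) ?_
  have : (0 : ℝ) ≤ n := n.cast_nonneg
  rw [div_le_iff₀ (by positivity)]
  nlinarith

/-- Kato's smoothing effect: expanding `(φ w)'`, the part with `φ' w` yields half a derivative on
the support of `φ'`, and the part with `φ w'` costs only the `L²` norm. -/
theorem IsCutoff.exists_coercive (hφ : IsCutoff R φ) : ∃ C, 0 ≤ C ∧ ∀ w, IsH2 w →
    (1 / Real.pi) * gagliardo (fun x => √(deriv φ x) * w x) - C * ∫ x, w x ^ 2 ≤
      ∫ x, lam w x * deriv (fun s => φ s * w s) x := by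
  obtain ⟨C1, h1, hC1⟩ := hφ.exists_localisation
  obtain ⟨C2, h2, hC2⟩ := hφ.exists_transport_le
  refine ⟨C1 + C2, by positivity, fun w hw => ?_⟩
  have e : ∀ x, lam w x * deriv (fun s => φ s * w s) x =
      lam w x * (deriv φ x * w x) + lam w x * (φ x * deriv w x) := by
    intro x
    have : HasDerivAt (fun s => φ s * w s) (deriv φ x * w x + φ x * deriv w x) x :=
      (hφ.hasDerivAt x).mul (hw.hasDerivAt x)
    rw [this.deriv, mul_add]
  simp only [e]
  rw [integral_add]
  · have a1 := hC1 w hw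
    have a2 := (_root_.abs_le.1 (hC2 w hw)).1
    linarith
  · exact (memLp_lam hw).integrable_mul (hφ.isH1_deriv_mul hw).memLp
  · exact (memLp_lam hw).integrable_mul (memLp_bdd_mul hw.h1.memLp_deriv
      hφ.smooth.continuous.aestronglyMeasurable hφ.abs_apply_le)

/-- The nonlinear term in the energy identity. -/
theorem IsCutoff.integral_sq_mul_deriv (hφ : IsCutoff R φ) (hw : IsH2 w) :
    ∫ x, w x ^ 2 / 2 * deriv (fun s => φ s * w s) x = 1 / 3 * ∫ x, deriv φ x * w x ^ 3 := by
  obtain ⟨B, hB⟩ := hw.h1.exists_bound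
  have hφc := hφ.smooth.continuous
  have hφc' := hφ.contDiff_deriv.continuous
  have hwc := hw.contDiff.continuous
  have L2 : MemLp (fun x => w x * w x) 2 volume :=
    memLp_bdd_mul hw.h1.memLp hwc.aestronglyMeasurable hB
  have i1 : Integrable fun x => deriv φ x * w x ^ 3 := by
    have := (memLp_bdd_mul hw.h1.memLp hφc'.aestronglyMeasurable hφ.abs_deriv_le).integrable_mul L2
    refine this.congr (Eventually.of_forall fun x => ?_)
    simp only [Pi.mul_apply]; ring
  have i2 : Integrable fun x => φ x * (w x ^ 2 * deriv w x) := by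
    have := (memLp_bdd_mul hw.h1.memLp_deriv hφc.aestronglyMeasurable
      hφ.abs_apply_le).integrable_mul L2
    refine this.congr (Eventually.of_forall fun x => ?_)
    simp only [Pi.mul_apply]; ring
  have i3 : Integrable fun x => φ x * (w x ^ 3 / 3) := by
    have := ((memLp_bdd_mul hw.h1.memLp hφc.aestronglyMeasurable
      hφ.abs_apply_le).integrable_mul L2).div_const 3
    refine this.congr (Eventually.of_forall fun x => ?_)
    simp only [Pi.mul_apply]; ring
  have i4 : Integrable fun x => deriv φ x * (w x ^ 3 / 3) := by
    refine (i1.div_const 3).congr (Eventually.of_forall fun x => ?_)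
    simp only; ring
  have ibp := integral_mul_deriv_eq_neg (g := fun x => w x ^ 3 / 3)
    (g' := fun x => w x ^ 2 * deriv w x) hφ.hasDerivAt
    (fun x => (((hw.hasDerivAt x).pow 3).div_const 3).congr_deriv (by push_cast; ring)) i2 i4 i3
  have e : ∀ x, w x ^ 2 / 2 * deriv (fun s => φ s * w s) x =
      1 / 2 * (deriv φ x * w x ^ 3) + 1 / 2 * (φ x * (w x ^ 2 * deriv w x)) := by
    intro x
    have : HasDerivAt (fun s => φ s * w s) (deriv φ x * w x + φ x * deriv w x) x :=
      (hφ.hasDerivAt x).mul (hw.hasDerivAt x)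
    rw [this.deriv]
    ring
  have e2 : ∫ x, deriv φ x * (w x ^ 3 / 3) = (∫ x, deriv φ x * w x ^ 3) / 3 := by
    rw [← integral_div]
    exact integral_congr_ae (Eventually.of_forall fun x => by simp only; ring)
  simp only [e]
  rw [integral_add (i1.const_mul _) (i2.const_mul _), integral_const_mul, integral_const_mul, ibp,
    e2]
  ring

/-- With `f = √φ' w` the integrand is `f² · w`. Cauchy–Schwarz and the `L⁴` estimate leave the cubic
term linear in `√(gagliardo f)`, so the smoothing term can absorb it. -/
theorem IsCutoff.sq_integral_cube_le (hφ : IsCutoff R φ) (hw : IsH2 w) :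
    (∫ x, deriv φ x * w x ^ 3) ^ 2 ≤
      16 * (∫ x, w x ^ 2) ^ 2 * gagliardo fun x => √(deriv φ x) * w x := by
  have hf := hφ.isH1_sqrt_mul hw
  obtain ⟨h4, h4le⟩ := hf.integral_pow_four_le
  set f : ℝ → ℝ := fun x => √(deriv φ x) * w x with hfdef
  have hf2 : MemLp (fun x => f x ^ 2) 2 volume := by
    have hc : Continuous fun x => f x ^ 2 := hf.continuous.pow 2
    rw [memLp_two_iff_integrable_sq hc.aestronglyMeasurable]
    refine h4.congr (Eventually.of_forall fun x => ?_)
    simp only; ring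
  have := sq_integral_mul_le hf2 hw.h1.memLp
  have e1 : ∫ x, f x ^ 2 * w x = ∫ x, deriv φ x * w x ^ 3 :=
    integral_congr_ae (Eventually.of_forall fun x => by
      simp only [hfdef, mul_pow, Real.sq_sqrt (hφ.deriv_nonneg x)]; ring)
  have e2 : ∫ x, (f x ^ 2) ^ 2 = ∫ x, f x ^ 4 :=
    integral_congr_ae (Eventually.of_forall fun x => by simp only; ring)
  rw [e1, e2] at this
  have h5 : ∫ x, f x ^ 2 ≤ ∫ x, w x ^ 2 := by
    refine integral_mono hf.memLp.integrable_sq hw.h1.memLp.integrable_sq fun x => ?_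
    simp only [hfdef, mul_pow, Real.sq_sqrt (hφ.deriv_nonneg x)]
    exact mul_le_of_le_one_left (sq_nonneg _) (hφ.deriv_le_one x)
  have hW : 0 ≤ ∫ x, w x ^ 2 := integral_nonneg fun x => sq_nonneg _
  have hG := gagliardo_nonneg f
  calc _ ≤ _ := this
    _ ≤ (16 * (∫ x, f x ^ 2) * gagliardo f) * ∫ x, w x ^ 2 := by gcongr
    _ ≤ (16 * (∫ x, w x ^ 2) * gagliardo f) * ∫ x, w x ^ 2 := by gcongr
    _ = _ := by ring

end transport

/-! ### Fourier side: Gagliardo seminorm against `D^{1/2}`, and the commutator with a cutoff. -/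

section fourier

/-- The `L²` Fourier transform agrees with the distributional one; with smooth compactly supported
tests this identifies `L²` transforms almost everywhere below. -/
theorem integral_mul_fourier (F : Lp ℂ 2 (volume : Measure ℝ)) {ψ : ℝ → ℂ}
    (hψ : ContDiff ℝ ∞ ψ) (hc : HasCompactSupport ψ) :
    ∫ x, ψ x * (𝓕 F) x = ∫ x, (𝓕 ψ) x * F x := by
  have h := congrArg (fun T => T (hc.toSchwartzMap hψ)) (Lp.fourier_toTemperedDistribution_eq F)
  simp only [TemperedDistribution.fourier_apply, Lp.toTemperedDistribution_apply, smul_eq_mul] at h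
  exact h.symm

theorem ae_eq_of_integral_mul {f g : ℝ → ℂ} (hf : LocallyIntegrable f)
    (hg : LocallyIntegrable g)
    (h : ∀ ψ : ℝ → ℂ, ContDiff ℝ ∞ ψ → HasCompactSupport ψ → ∫ x, ψ x * f x = ∫ x, ψ x * g x) :
    f =ᵐ[volume] g := by
  have key : ∀ k : ℝ → ℝ, ContDiff ℝ ∞ k → HasCompactSupport k →
      ∫ x, k x • f x = ∫ x, k x • g x := by
    intro k hk hkc
    have h1 : HasCompactSupport fun x => (k x : ℂ) := hkc.comp_left Complex.ofReal_zero
    have h2 : ContDiff ℝ ∞ fun x => (k x : ℂ) := Complex.ofRealCLM.contDiff.comp hk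
    have := h (fun x => (k x : ℂ)) h2 h1
    simp only [Complex.real_smul]
    exact this
  exact ae_eq_of_integral_contDiff_smul_eq hf hg key

theorem locallyIntegrable_of_memLp {f : ℝ → ℂ} (hf : MemLp f 2 volume) : LocallyIntegrable f :=
  hf.locallyIntegrable (by norm_num)

/-- The character `ξ ↦ e^{2πiyξ}`. -/
noncomputable def char (y ξ : ℝ) : ℂ := Complex.exp (2 * Real.pi * y * ξ * Complex.I)

theorem contDiff_char (y : ℝ) : ContDiff ℝ ∞ (char y) := by
  unfold char
  have : ContDiff ℝ ∞ fun ξ : ℝ => (ξ : ℂ) := Complex.ofRealCLM.contDiff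
  exact ((contDiff_const.mul this).mul contDiff_const).cexp

theorem norm_char (y ξ : ℝ) : ‖char y ξ‖ = 1 := by
  rw [char, show (2 * Real.pi * y * ξ * Complex.I : ℂ) =
    ((2 * Real.pi * y * ξ : ℝ) : ℂ) * Complex.I by push_cast; ring]
  exact Complex.norm_exp_ofReal_mul_I _

theorem fourier_eq_char (f : ℝ → ℂ) (x : ℝ) : 𝓕 f x = ∫ v, char (-x) v * f v := by
  rw [Real.fourier_real_eq_integral_exp_smul]
  refine integral_congr_ae (Eventually.of_forall fun v => ?_)
  simp only [char, smul_eq_mul]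
  congr 2
  push_cast
  ring

theorem char_add (x y ξ : ℝ) : char (x + y) ξ = char x ξ * char y ξ := by
  rw [char, char, char, ← Complex.exp_add]
  congr 1
  push_cast
  ring

theorem fourier_char_mul (ψ : ℝ → ℂ) (x y : ℝ) :
    𝓕 (fun ξ => ψ ξ * char y ξ) x = 𝓕 ψ (x - y) := by
  rw [fourier_eq_char, fourier_eq_char]
  refine integral_congr_ae (Eventually.of_forall fun v => ?_)
  simp only
  rw [neg_sub, sub_eq_neg_add, char_add]
  ring

/-- The Fourier transform turns translations into modulations. -/
theorem fourier_shift {f : ℝ → ℂ} (hf : MemLp f 2 volume) (y : ℝ)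
    (hfy : MemLp (fun x => f (x + y)) 2 volume) :
    (𝓕 (hfy.toLp _) : Lp ℂ 2 (volume : Measure ℝ)) =ᵐ[volume]
      fun ξ => char y ξ * (𝓕 (hf.toLp f) : Lp ℂ 2 (volume : Measure ℝ)) ξ := by
  have hm : MemLp (fun ξ => char y ξ * (𝓕 (hf.toLp f) : Lp ℂ 2 (volume : Measure ℝ)) ξ) 2
      volume := by
    refine MemLp.of_le (Lp.memLp (𝓕 (hf.toLp f) : Lp ℂ 2 (volume : Measure ℝ)))
      ((contDiff_char y).continuous.aestronglyMeasurable.mul (Lp.memLp _).1)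
      (Eventually.of_forall fun ξ => ?_)
    rw [norm_mul, norm_char, one_mul]
  refine ae_eq_of_integral_mul (locallyIntegrable_of_memLp (Lp.memLp _))
    (locallyIntegrable_of_memLp hm) fun ψ hψ hc => ?_
  have hc' : HasCompactSupport fun ξ => ψ ξ * char y ξ := hc.mul_right
  -- The modulation is moved onto the test function, where the transform turns it into a
  -- translation.
  have h1 := integral_mul_fourier (hf.toLp f) (hψ.mul (contDiff_char y)) hc'
  rw [integral_mul_fourier _ hψ hc]
  simp only [← mul_assoc]
  rw [h1]
  simp only [fourier_char_mul]
  rw [← integral_add_right_eq_self (fun x => 𝓕 ψ (x - y) * (hf.toLp f) x) y]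
  have q : ∀ᵐ x, (hf.toLp f) (x + y) = f (x + y) :=
    (measurePreserving_add_right volume y).quasiMeasurePreserving.ae hf.coeFn_toLp
  refine integral_congr_ae ?_
  filter_upwards [hfy.coeFn_toLp, q] with x h1 h2
  rw [h1, h2, add_sub_cancel_right]

theorem integral_norm_sq_fourier_eq {f : ℝ → ℂ} (hf : MemLp f 2 volume) :
    ∫ ξ, ‖(𝓕 (hf.toLp f) : Lp ℂ 2 (volume : Measure ℝ)) ξ‖ ^ 2 = ∫ x, ‖f x‖ ^ 2 := by
  have e : ∀ g : Lp ℂ 2 (volume : Measure ℝ), ‖g‖ ^ 2 = ∫ x, ‖g x‖ ^ 2 := by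
    intro g
    rw [@norm_sq_eq_re_inner ℂ, L2.inner_def, ← integral_re (L2.integrable_inner g g)]
    refine integral_congr_ae (Eventually.of_forall fun x => ?_)
    simp only
    rw [← norm_sq_eq_re_inner]
  rw [← e, Lp.norm_fourier_eq, e]
  refine integral_congr_ae ?_
  filter_upwards [hf.coeFn_toLp] with x hx
  rw [hx]

theorem integral_norm_sq_char_sub_one_mul {f : ℝ → ℂ} (hf : MemLp f 2 volume) (y : ℝ)
    (hfy : MemLp (fun x => f (x + y)) 2 volume) :
    ∫ ξ, ‖(char y ξ - 1) * (𝓕 (hf.toLp f) : Lp ℂ 2 (volume : Measure ℝ)) ξ‖ ^ 2 =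
      ∫ x, ‖f (x + y) - f x‖ ^ 2 := by
  have e0 := integral_norm_sq_fourier_eq (hfy.sub hf)
  simp only [Pi.sub_apply] at e0
  rw [← e0]
  have e : (𝓕 ((hfy.sub hf).toLp _) : Lp ℂ 2 (volume : Measure ℝ)) =
      𝓕 (hfy.toLp _) - 𝓕 (hf.toLp f) := by
    rw [MemLp.toLp_sub]
    exact map_sub (Lp.fourierTransformₗᵢ ℝ ℂ) _ _
  rw [e]
  refine integral_congr_ae ?_
  filter_upwards [fourier_shift hf y hfy, Lp.coeFn_sub
    (𝓕 (hfy.toLp _) : Lp ℂ 2 (volume : Measure ℝ)) (𝓕 (hf.toLp f))] with ξ h1 h2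
  rw [h2, Pi.sub_apply, h1]
  congr 2
  ring

/-- `|e^{iθ} - 1|² ≥ 4θ²/π²` for `|θ| ≤ π`. -/
theorem norm_sq_char_sub_one_ge {y ξ : ℝ} (h : |2 * y * ξ| ≤ 1) :
    16 * y ^ 2 * ξ ^ 2 ≤ ‖char y ξ - 1‖ ^ 2 := by
  have e : ‖char y ξ - 1‖ ^ 2 = 2 - 2 * Real.cos (2 * Real.pi * y * ξ) := by
    rw [char, show (2 * Real.pi * y * ξ * Complex.I : ℂ) =
      ((2 * Real.pi * y * ξ : ℝ) : ℂ) * Complex.I by push_cast; ring, Complex.exp_mul_I,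
      ← Complex.normSq_eq_norm_sq, Complex.normSq_apply]
    simp only [Complex.sub_re, Complex.add_re, Complex.mul_re, Complex.I_re, Complex.I_im,
      Complex.one_re, Complex.sub_im, Complex.add_im, Complex.mul_im, Complex.one_im,
      ← Complex.ofReal_cos, ← Complex.ofReal_sin, Complex.ofReal_re, Complex.ofReal_im]
    nlinarith [Real.sin_sq_add_cos_sq (2 * Real.pi * y * ξ)]
  have hx : |2 * Real.pi * y * ξ| ≤ Real.pi := by
    rw [show 2 * Real.pi * y * ξ = Real.pi * (2 * y * ξ) by ring, abs_mul,
      abs_of_pos Real.pi_pos]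
    exact mul_le_of_le_one_right Real.pi_pos.le h
  have := Real.cos_le_one_sub_mul_cos_sq hx
  rw [e]
  have e2 : 2 / Real.pi ^ 2 * (2 * Real.pi * y * ξ) ^ 2 = 8 * y ^ 2 * ξ ^ 2 := by
    have := Real.pi_pos.ne'
    field_simp
    ring
  linarith

theorem memLp_ofReal {f : ℝ → ℝ} (hf : MemLp f 2 volume) :
    MemLp (fun x => (f x : ℂ)) 2 volume := hf.ofReal

theorem toL2_eq {f : ℝ → ℝ} (hf : MemLp f 2 volume) : toL2 f = (memLp_ofReal hf).toLp _ :=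
  dif_pos (memLp_ofReal hf)

theorem integral_norm_sq_char_sub_one_mul_toL2 {f : ℝ → ℝ} (hf : MemLp f 2 volume) (y : ℝ) :
    ∫ ξ, ‖(char y ξ - 1) * (𝓕 (toL2 f) : Lp ℂ 2 (volume : Measure ℝ)) ξ‖ ^ 2 =
      ∫ x, (f (x + y) - f x) ^ 2 := by
  rw [toL2_eq hf, integral_norm_sq_char_sub_one_mul (f := fun x => (f x : ℂ)) (memLp_ofReal hf) y
    (memLp_ofReal (memLp_shift hf y))]
  refine integral_congr_ae (Eventually.of_forall fun x => ?_)
  simp only [← Complex.ofReal_sub, Complex.norm_real, Real.norm_eq_abs, sq_abs]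

theorem integrable_norm_sq_char_sub_one_mul (F : Lp ℂ 2 (volume : Measure ℝ)) (y : ℝ) :
    Integrable fun ξ => ‖(char y ξ - 1) * F ξ‖ ^ 2 := by
  have hmem : MemLp (fun ξ => (char y ξ - 1) * F ξ) 2 volume := by
    refine MemLp.of_le_mul (c := 2) (Lp.memLp F)
      (((contDiff_char y).continuous.sub continuous_const).aestronglyMeasurable.mul
        (Lp.memLp F).1) (Eventually.of_forall fun ξ => ?_)
    rw [norm_mul]
    refine mul_le_mul_of_nonneg_right ((norm_sub_le _ _).trans ?_) (norm_nonneg _)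
    rw [norm_char, norm_one]
    norm_num
  exact (memLp_two_iff_integrable_sq_norm hmem.1).1 hmem

theorem Measurable.char {α : Type*} [MeasurableSpace α] {y ξ : α → ℝ} (hy : Measurable y)
    (hξ : Measurable ξ) : Measurable fun a => char (y a) (ξ a) := by
  unfold BenjaminOno.char
  fun_prop

/-- The Gagliardo seminorm controls `‖D^{1/2} f‖`. -/
theorem IsH1.lintegral_mul_fourier_le {f : ℝ → ℝ} (hf : IsH1 f) :
    ∫⁻ ξ, ENNReal.ofReal (|2 * Real.pi * ξ| * ‖(𝓕 (toL2 f)) ξ‖ ^ 2) ≤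
      ENNReal.ofReal (Real.pi / 4 * gagliardo f) := by
  have hpi := Real.pi_pos
  set F : Lp ℂ 2 (volume : Measure ℝ) := 𝓕 (toL2 f) with hF
  have hFm : Measurable F := (Lp.stronglyMeasurable F).measurable
  -- Only shifts `y ≤ 1/(2|ξ|)` are kept. There `|e^{2πiyξ} - 1|²/y² ≥ 16 ξ²`, whose integral over
  -- these shifts is `8|ξ|`; the factor `π/4` turns this into `2π|ξ|`.
  have hpt : ∀ ξ, ENNReal.ofReal (|2 * Real.pi * ξ| * ‖F ξ‖ ^ 2) ≤ ENNReal.ofReal (Real.pi / 4) *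
      ∫⁻ y in Set.Ioi 0, ENNReal.ofReal (‖(char y ξ - 1) * F ξ‖ ^ 2 / y ^ 2) := by
    intro ξ
    rcases eq_or_ne ξ 0 with rfl | hξ
    · simp
    have hξ' : 0 < |ξ| := abs_pos.2 hξ
    calc ENNReal.ofReal (|2 * Real.pi * ξ| * ‖F ξ‖ ^ 2)
        = ENNReal.ofReal (Real.pi / 4) *
            ∫⁻ _ in Set.Ioc 0 (1 / (2 * |ξ|)), ENNReal.ofReal (16 * ξ ^ 2 * ‖F ξ‖ ^ 2) := by
          rw [setLIntegral_const, Real.volume_Ioc, ← ENNReal.ofReal_mul (by positivity),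
            ← ENNReal.ofReal_mul (by positivity)]
          congr 1
          rw [abs_mul, abs_of_pos (by positivity : 0 < 2 * Real.pi), ← sq_abs ξ]
          field_simp
          ring
      _ ≤ ENNReal.ofReal (Real.pi / 4) * ∫⁻ y in Set.Ioc 0 (1 / (2 * |ξ|)),
            ENNReal.ofReal (‖(char y ξ - 1) * F ξ‖ ^ 2 / y ^ 2) := by
          refine mul_le_mul_right ?_ _
          refine setLIntegral_mono' measurableSet_Ioc fun y hy => ENNReal.ofReal_le_ofReal ?_
          have hy0 := hy.1
          have h1 : |2 * y * ξ| ≤ 1 := by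
            rw [abs_mul, abs_of_pos (by positivity : 0 < 2 * y)]
            have := (le_div_iff₀ (by positivity)).1 hy.2
            linarith
          rw [le_div_iff₀ (by positivity), norm_mul, mul_pow]
          have := mul_le_mul_of_nonneg_right (norm_sq_char_sub_one_ge h1) (sq_nonneg ‖F ξ‖)
          linarith
      _ ≤ _ := by
          refine mul_le_mul_right ?_ _
          exact lintegral_mono_set Set.Ioc_subset_Ioi_self
  have hmeas : Measurable fun p : ℝ × ℝ =>
      ENNReal.ofReal (‖(char p.2 p.1 - 1) * F p.1‖ ^ 2 / p.2 ^ 2) := by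
    have h1 : Measurable fun p : ℝ × ℝ => char p.2 p.1 :=
      Measurable.char measurable_snd measurable_fst
    have h2 : Measurable fun p : ℝ × ℝ => F p.1 := hFm.comp measurable_fst
    have h3 : Measurable fun p : ℝ × ℝ => (char p.2 p.1 - 1) * F p.1 := (h1.sub_const 1).mul h2
    exact (h3.norm.pow_const 2 |>.div (measurable_snd.pow_const 2)).ennreal_ofReal
  have hin : ∀ y, ∫⁻ ξ, ENNReal.ofReal (‖(char y ξ - 1) * F ξ‖ ^ 2 / y ^ 2) =
      ENNReal.ofReal ((∫ x, (f (x + y) - f x) ^ 2) / y ^ 2) := by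
    intro y
    have hint := (integrable_norm_sq_char_sub_one_mul F y).div_const (y ^ 2)
    rw [← ofReal_integral_eq_lintegral_ofReal hint (Eventually.of_forall fun ξ => by positivity),
      integral_div, hF, integral_norm_sq_char_sub_one_mul_toL2 hf.memLp]
  calc _ ≤ ∫⁻ ξ, ENNReal.ofReal (Real.pi / 4) *
      ∫⁻ y in Set.Ioi 0, ENNReal.ofReal (‖(char y ξ - 1) * F ξ‖ ^ 2 / y ^ 2) := lintegral_mono hpt
    _ = ENNReal.ofReal (Real.pi / 4) *
      ∫⁻ y in Set.Ioi 0, ∫⁻ ξ, ENNReal.ofReal (‖(char y ξ - 1) * F ξ‖ ^ 2 / y ^ 2) := by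
        rw [lintegral_const_mul' _ _ ENNReal.ofReal_ne_top, lintegral_lintegral_swap]
        exact hmeas.aemeasurable
    _ = _ := by
        simp only [hin]
        rw [← ofReal_integral_eq_lintegral_ofReal hf.integrableOn_gagliardo
          (Eventually.of_forall fun y => div_nonneg (integral_nonneg fun x => sq_nonneg _)
            (sq_nonneg _)), ← ENNReal.ofReal_mul (by positivity)]
        rfl

/-- Young's inequality `L¹ * L² ⊂ L²`. -/
theorem IsWeight.memLp_convolution {ρ k h : ℝ → ℝ} (hρ : IsWeight volume ρ) (hk : Measurable k)
    (hkρ : ∀ ζ, |k ζ| ≤ ρ ζ) (hh : MemLp h 2 volume) (hhm : Measurable h) :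
    MemLp (fun ξ => ∫ ζ, k ζ * h (ξ + ζ)) 2 volume ∧
      ∫ ξ, (∫ ζ, k ζ * h (ξ + ζ)) ^ 2 ≤ (∫ ζ, ρ ζ) ^ 2 * ∫ ξ, h ξ ^ 2 := by
  have hA : 0 ≤ ∫ ξ, h ξ ^ 2 := integral_nonneg fun x => sq_nonneg _
  have hm : Measurable (Function.uncurry fun ζ ξ => k ζ * h (ξ + ζ)) := by
    simp only [Function.uncurry_def]
    fun_prop
  have := hρ.memLp_integral (F := fun ζ ξ => k ζ * h (ξ + ζ)) (A := √(∫ ξ, h ξ ^ 2)) hm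
    (Eventually.of_forall fun ζ => (memLp_shift hh ζ).const_mul (k ζ))
    (Eventually.of_forall fun ζ => by
      simp only [mul_pow]
      rw [integral_const_mul, integral_sq_shift, Real.sq_sqrt hA, mul_comm, ← sq_abs (k ζ)]
      exact mul_le_mul_of_nonneg_left (pow_le_pow_left₀ (abs_nonneg _) (hkρ ζ) 2) hA)
  refine ⟨this.1, this.2.trans_eq ?_⟩
  rw [mul_pow, Real.sq_sqrt hA, mul_comm]

/-- A single multiple of `1/(1 + ζ²)` dominates both `c` and `√|2πζ| c`. It serves as the integrable
majorant in Young's inequality for the convolution and for its commutator with `√|2πξ|`. -/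
theorem exists_isWeight_schwartz (c : SchwartzMap ℝ ℂ) : ∃ ρ : ℝ → ℝ, IsWeight volume ρ ∧
    MemLp ρ 2 volume ∧ ∀ ζ, ‖c ζ‖ * (1 + √|2 * Real.pi * ζ|) ≤ ρ ζ := by
  obtain ⟨C0, h0p, h0⟩ := c.decay 0 0
  obtain ⟨C1, h1p, h1⟩ := c.decay 1 0
  obtain ⟨C2, h2p, h2⟩ := c.decay 2 0
  obtain ⟨C3, h3p, h3⟩ := c.decay 3 0
  simp only [norm_iteratedFDeriv_zero, pow_zero, one_mul, pow_one, Real.norm_eq_abs] at h0 h1 h2 h3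
  have hpi := Real.pi_pos
  set C := 2 * C0 + 2 * Real.pi * C1 + 2 * C2 + 2 * Real.pi * C3 with hC
  have hC0 : 0 ≤ C := by positivity
  have hi : Integrable fun ζ : ℝ => C * (1 + ζ ^ 2)⁻¹ := integrable_inv_one_add_sq.const_mul C
  refine ⟨fun ζ => C * (1 + ζ ^ 2)⁻¹, ⟨by fun_prop, hi, fun y => by positivity,
    Eventually.of_forall fun y => by positivity⟩, ?_, fun ζ => ?_⟩
  · refine (memLp_two_iff_integrable_sq hi.1).2 ((hi.const_mul C).mono'
      (hi.1.pow 2) (Eventually.of_forall fun y => ?_))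
    have h1 : (1 + y ^ 2)⁻¹ ≤ 1 := inv_le_one_of_one_le₀ (by nlinarith [sq_nonneg y])
    have h2 : 0 ≤ (1 + y ^ 2)⁻¹ := by positivity
    rw [Real.norm_of_nonneg (by positivity), sq]
    exact mul_le_mul_of_nonneg_right (mul_le_of_le_one_right hC0 h1) (mul_nonneg hC0 h2)
  show _ ≤ C * (1 + ζ ^ 2)⁻¹
  rw [← div_eq_mul_inv, le_div_iff₀ (by positivity)]
  have hs : √|2 * Real.pi * ζ| ≤ 1 + 2 * Real.pi * |ζ| := by
    rw [abs_mul, abs_of_pos (by positivity : 0 < 2 * Real.pi)]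
    rw [Real.sqrt_le_left (by positivity)]
    nlinarith [mul_nonneg hpi.le (abs_nonneg ζ)]
  have hn := norm_nonneg (c ζ)
  calc ‖c ζ‖ * (1 + √|2 * Real.pi * ζ|) * (1 + ζ ^ 2)
      ≤ ‖c ζ‖ * (1 + (1 + 2 * Real.pi * |ζ|)) * (1 + ζ ^ 2) := by gcongr
    _ = 2 * ‖c ζ‖ + 2 * Real.pi * (|ζ| * ‖c ζ‖) + 2 * (|ζ| ^ 2 * ‖c ζ‖) +
        2 * Real.pi * (|ζ| ^ 3 * ‖c ζ‖) := by rw [← sq_abs ζ]; ring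
    _ ≤ C := by
        have b1 := mul_le_mul_of_nonneg_left (h1 ζ) (by positivity : 0 ≤ 2 * Real.pi)
        have b3 := mul_le_mul_of_nonneg_left (h3 ζ) (by positivity : 0 ≤ 2 * Real.pi)
        linarith [h0 ζ, h2 ζ]

theorem memLp_schwartz (c : SchwartzMap ℝ ℂ) : MemLp c 2 (volume : Measure ℝ) := c.memLp 2 volume

theorem integrable_schwartz_mul_shift (c : SchwartzMap ℝ ℂ) {h : ℝ → ℂ} (hh : MemLp h 2 volume)
    (ξ : ℝ) : Integrable fun ζ => c ζ * h (ξ + ζ) :=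
  (memLp_schwartz c).integrable_mul
    (hh.comp_measurePreserving (measurePreserving_add_left volume ξ))

theorem memLp_schwartz_convolution (c : SchwartzMap ℝ ℂ) (H : Lp ℂ 2 (volume : Measure ℝ)) :
    MemLp (fun ξ => ∫ ζ, c ζ * H (ξ + ζ)) 2 volume := by
  have hHm : StronglyMeasurable H := Lp.stronglyMeasurable H
  have hH2 : MemLp H 2 volume := Lp.memLp H
  have hcc : Continuous c := c.continuous
  obtain ⟨ρ, hρ, -, hcρ⟩ := exists_isWeight_schwartz c
  have hcρ' : ∀ ζ, |‖c ζ‖| ≤ ρ ζ := fun ζ => by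
    rw [abs_norm]
    exact (le_mul_of_one_le_right (norm_nonneg _)
      (by linarith [Real.sqrt_nonneg |2 * Real.pi * ζ|])).trans (hcρ ζ)
  refine MemLp.of_le (hρ.memLp_convolution hcc.norm.measurable hcρ' hH2.norm
    hHm.norm.measurable).1 ?_ (Eventually.of_forall fun ξ => ?_)
  · refine AEStronglyMeasurable.integral_prod_right' (f := fun p : ℝ × ℝ =>
      c p.2 * H (p.1 + p.2)) ?_
    have : Measurable fun p : ℝ × ℝ => c p.2 * H (p.1 + p.2) :=
      (hcc.measurable.comp measurable_snd).mul
        (hHm.measurable.comp (measurable_fst.add measurable_snd))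
    exact this.aestronglyMeasurable
  · refine (norm_integral_le_integral_norm _).trans ((le_abs_self _).trans_eq ?_)
    simp only [norm_mul, Real.norm_eq_abs]

theorem integrable_schwartz_mul_mul_shift (c : SchwartzMap ℝ ℂ) {ψ : ℝ → ℂ} (hψ : Continuous ψ)
    (hψ2 : MemLp ψ 2 volume) (H : Lp ℂ 2 (volume : Measure ℝ)) :
    Integrable (fun p : ℝ × ℝ => c p.1 * (ψ p.2 * H (p.2 + p.1)))
      ((volume : Measure ℝ).prod volume) := by
  have hHm : StronglyMeasurable H := Lp.stronglyMeasurable H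
  have hH2 : MemLp H 2 volume := Lp.memLp H
  have hcc : Continuous c := c.continuous
  have hk := integrable_kernel (ν := volume) (k := fun ζ _ => ‖c ζ‖) (κ := fun ζ => ‖c ζ‖)
    hψ2.norm hH2.norm hψ.norm.measurable hHm.norm.measurable
    (hcc.norm.measurable.comp measurable_fst) c.integrable.norm
    (Eventually.of_forall fun ζ x => by rw [abs_norm])
  refine hk.mono' ?_ (Eventually.of_forall fun p => ?_)
  · exact ((hcc.measurable.comp measurable_fst).mul ((hψ.measurable.comp
      measurable_snd).mul (hHm.measurable.comp
        (measurable_snd.add measurable_fst)))).aestronglyMeasurable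
  · simp only [norm_mul]
    exact le_rfl

theorem integral_mul_fourier_shift {ψ h : ℝ → ℂ} (hψ : ContDiff ℝ ∞ ψ) (hψc : HasCompactSupport ψ)
    (hh : MemLp h 2 volume) (ζ : ℝ) :
    ∫ ξ, ψ ξ * (𝓕 (hh.toLp h) : Lp ℂ 2 (volume : Measure ℝ)) (ξ + ζ) =
      ∫ x, char (-x) ζ * (𝓕 ψ x * h x) := by
  have hψs : ContDiff ℝ ∞ fun ξ => ψ (ξ - ζ) := hψ.comp (contDiff_id.sub contDiff_const)
  have hψsc : HasCompactSupport fun ξ => ψ (ξ - ζ) :=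
    hψc.comp_homeomorph (Homeomorph.subRight ζ)
  have h1 := integral_mul_fourier (hh.toLp h) hψs hψsc
  rw [← integral_add_right_eq_self (fun ξ => ψ (ξ - ζ) * _) ζ] at h1
  simp only [add_sub_cancel_right] at h1
  rw [h1]
  refine integral_congr_ae ?_
  filter_upwards [hh.coeFn_toLp] with x hx
  rw [hx, ← mul_assoc]
  congr 1
  rw [fourier_eq_char, fourier_eq_char,
    ← integral_add_right_eq_self (fun v => char (-x) v * ψ (v - ζ)) ζ, ← integral_const_mul]
  refine integral_congr_ae (Eventually.of_forall fun v => ?_)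
  simp only [add_sub_cancel_right]
  rw [← mul_assoc]
  congr 1
  rw [char, char, char, ← Complex.exp_add]
  congr 1
  push_cast
  ring

theorem integrable_mul_char_mul {c g : ℝ → ℂ} (hc : Integrable c) (hg : Integrable g) :
    Integrable (fun p : ℝ × ℝ => c p.1 * char (-p.2) p.1 * g p.2)
      ((volume : Measure ℝ).prod volume) := by
  have hp : Integrable (fun p : ℝ × ℝ => c p.1 * g p.2) ((volume : Measure ℝ).prod volume) :=
    hc.mul_prod hg
  have hcm : Measurable fun p : ℝ × ℝ => char (-p.2) p.1 :=
    Measurable.char measurable_snd.neg measurable_fst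
  have e : (fun p : ℝ × ℝ => c p.1 * char (-p.2) p.1 * g p.2) =
      fun p : ℝ × ℝ => char (-p.2) p.1 * (c p.1 * g p.2) := by
    funext p
    ring
  rw [e]
  exact hp.bdd_mul (c := 1) hcm.aestronglyMeasurable
    (Eventually.of_forall fun p => (norm_char _ _).le)

/-- The Fourier transform of a product with a test function is a convolution. -/
theorem fourier_mul {χ h : ℝ → ℂ} (hχ : ContDiff ℝ ∞ χ) (hχc : HasCompactSupport χ)
    (hh : MemLp h 2 volume) (hχh : MemLp (fun x => χ x * h x) 2 volume) :
    (𝓕 (hχh.toLp _) : Lp ℂ 2 (volume : Measure ℝ)) =ᵐ[volume] fun ξ =>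
      ∫ ζ, (𝓕⁻ (hχc.toSchwartzMap hχ)) ζ *
        (𝓕 (hh.toLp h) : Lp ℂ 2 (volume : Measure ℝ)) (ξ + ζ) := by
  set c : SchwartzMap ℝ ℂ := 𝓕⁻ (hχc.toSchwartzMap hχ) with hc
  set H : Lp ℂ 2 (volume : Measure ℝ) := 𝓕 (hh.toLp h) with hH
  refine ae_eq_of_integral_mul (locallyIntegrable_of_memLp (Lp.memLp _))
    (locallyIntegrable_of_memLp (memLp_schwartz_convolution c H)) fun ψ hψ hψc => ?_
  have hψ2 : MemLp ψ 2 volume := hψ.continuous.memLp_of_hasCompactSupport hψc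
  have hΨ2 : MemLp (𝓕 ψ) 2 volume := memLp_schwartz (𝓕 (hψc.toSchwartzMap hψ))
  rw [integral_mul_fourier _ hψ hψc]
  -- Fourier inversion writes the cutoff as a superposition of characters, and multiplication of `h`
  -- by each character shifts its transform by `ζ`.
  have ex : ∀ x, χ x = ∫ ζ, char (-x) ζ * c ζ := by
    intro x
    have : (𝓕 c) x = χ x := by
      rw [hc, FourierTransform.fourier_fourierInv_eq]
      rfl
    rw [← this, SchwartzMap.fourier_coe, fourier_eq_char]
  have i2 := integrable_mul_char_mul c.integrable (hΨ2.integrable_mul hh)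
  calc ∫ x, 𝓕 ψ x * (hχh.toLp _) x = ∫ x, ∫ ζ, (c ζ * char (-x) ζ) * (𝓕 ψ x * h x) := by
        refine integral_congr_ae ?_
        filter_upwards [hχh.coeFn_toLp] with x hx
        rw [hx, integral_mul_const, ex x]
        simp only [mul_comm (c _)]
        ring
    _ = ∫ ζ, ∫ x, (c ζ * char (-x) ζ) * (𝓕 ψ x * h x) :=
        (integral_integral_swap (f := fun ζ x => (c ζ * char (-x) ζ) * (𝓕 ψ x * h x)) i2).symm
    _ = ∫ ζ, ∫ ξ, c ζ * (ψ ξ * H (ξ + ζ)) := by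
        refine integral_congr_ae (Eventually.of_forall fun ζ => ?_)
        simp only [mul_assoc]
        rw [integral_const_mul, integral_const_mul, integral_mul_fourier_shift hψ hψc hh]
    _ = ∫ ξ, ∫ ζ, c ζ * (ψ ξ * H (ξ + ζ)) :=
        integral_integral_swap (f := fun ζ ξ => c ζ * (ψ ξ * H (ξ + ζ)))
          (integrable_schwartz_mul_mul_shift c hψ.continuous hψ2 H)
    _ = ∫ ξ, ψ ξ * ∫ ζ, c ζ * H (ξ + ζ) := by
        refine integral_congr_ae (Eventually.of_forall fun ξ => ?_)
        simp only
        rw [← integral_const_mul]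
        refine integral_congr_ae (Eventually.of_forall fun ζ => ?_)
        simp only
        ring

/-- The commutator of convolution by `c` with the multiplier `√|2πξ|` has a kernel bounded by
`|c(ζ)| √|2πζ|`, because `t ↦ √|t|` is subadditive. Thus localisation costs no half derivative. -/
theorem norm_convolution_sub_le (c : SchwartzMap ℝ ℂ) {W : ℝ → ℂ} (hW : MemLp W 2 volume)
    (hm : MemLp (fun ξ => ((√|2 * Real.pi * ξ| : ℝ) : ℂ) * W ξ) 2 volume) (ξ : ℝ) :
    ‖(∫ ζ, c ζ * (((√|2 * Real.pi * (ξ + ζ)| : ℝ) : ℂ) * W (ξ + ζ))) -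
        ((√|2 * Real.pi * ξ| : ℝ) : ℂ) * ∫ ζ, c ζ * W (ξ + ζ)‖ ≤
      ∫ ζ, ‖c ζ‖ * √|2 * Real.pi * ζ| * ‖W (ξ + ζ)‖ := by
  obtain ⟨ρ, hρ, hρ2, hcρ⟩ := exists_isWeight_schwartz c
  have hWs : MemLp (fun ζ => W (ξ + ζ)) 2 volume :=
    hW.comp_measurePreserving (measurePreserving_add_left volume ξ)
  have hk : MemLp (fun ζ => ‖c ζ‖ * √|2 * Real.pi * ζ|) 2 volume := by
    refine hρ2.of_le ?_ (Eventually.of_forall fun ζ => ?_)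
    · exact (c.continuous.norm.mul (by fun_prop)).aestronglyMeasurable
    · rw [Real.norm_of_nonneg (by positivity), Real.norm_of_nonneg (hρ.nonneg ζ)]
      refine le_trans ?_ (hcρ ζ)
      exact mul_le_mul_of_nonneg_left (by linarith) (norm_nonneg _)
  have i1 := integrable_schwartz_mul_shift c hm ξ
  have i2 := (integrable_schwartz_mul_shift c hW ξ).const_mul ((√|2 * Real.pi * ξ| : ℝ) : ℂ)
  rw [← integral_const_mul, ← integral_sub i1 i2]
  refine (norm_integral_le_integral_norm _).trans (integral_mono (i1.sub i2).norm
    (hk.integrable_mul hWs.norm) fun ζ => ?_)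
  have e : c ζ * (((√|2 * Real.pi * (ξ + ζ)| : ℝ) : ℂ) * W (ξ + ζ)) -
      ((√|2 * Real.pi * ξ| : ℝ) : ℂ) * (c ζ * W (ξ + ζ)) =
      c ζ * (((√|2 * Real.pi * (ξ + ζ)| - √|2 * Real.pi * ξ| : ℝ) : ℂ)) * W (ξ + ζ) := by
    push_cast
    ring
  beta_reduce
  rw [e, norm_mul, norm_mul, Complex.norm_real, Real.norm_eq_abs]
  refine mul_le_mul_of_nonneg_right (mul_le_mul_of_nonneg_left ?_ (norm_nonneg _)) (norm_nonneg _)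
  have key : ∀ a b : ℝ, √|a| ≤ √|b| + √|a - b| := by
    intro a b
    have h := abs_add_le b (a - b)
    rw [add_sub_cancel] at h
    rw [Real.sqrt_le_left (by positivity)]
    nlinarith [Real.sq_sqrt (abs_nonneg b), Real.sq_sqrt (abs_nonneg (a - b)),
      mul_nonneg (Real.sqrt_nonneg |b|) (Real.sqrt_nonneg |a - b|)]
  rw [abs_le]
  have k1 := key (2 * Real.pi * (ξ + ζ)) (2 * Real.pi * ξ)
  have k2 := key (2 * Real.pi * ξ) (2 * Real.pi * (ξ + ζ))
  rw [abs_sub_comm] at k2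
  rw [show 2 * Real.pi * (ξ + ζ) - 2 * Real.pi * ξ = 2 * Real.pi * ζ by ring] at k1 k2
  constructor <;> linarith

theorem integrable_norm_sq {f : ℝ → ℂ} (hf : MemLp f 2 volume) : Integrable fun x => ‖f x‖ ^ 2 :=
  (memLp_two_iff_integrable_sq_norm hf.1).1 hf

theorem IsH1.integral_mul_fourier_le {f : ℝ → ℝ} (hf : IsH1 f) :
    Integrable (fun ξ => |2 * Real.pi * ξ| * ‖(𝓕 (toL2 f) : Lp ℂ 2 (volume : Measure ℝ)) ξ‖ ^ 2) ∧
    ∫ ξ, |2 * Real.pi * ξ| * ‖(𝓕 (toL2 f) : Lp ℂ 2 (volume : Measure ℝ)) ξ‖ ^ 2 ≤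
      Real.pi / 4 * gagliardo f := by
  have h := hf.lintegral_mul_fourier_le
  have hF : Measurable (𝓕 (toL2 f) : Lp ℂ 2 (volume : Measure ℝ)) :=
    (Lp.stronglyMeasurable _).measurable
  have hm : Measurable fun ξ : ℝ => |2 * Real.pi * ξ| *
      ‖(𝓕 (toL2 f) : Lp ℂ 2 (volume : Measure ℝ)) ξ‖ ^ 2 :=
    (by fun_prop : Measurable fun ξ : ℝ => |2 * Real.pi * ξ|).mul (hF.norm.pow_const 2)
  have hn : ∀ ξ : ℝ, 0 ≤ |2 * Real.pi * ξ| *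
      ‖(𝓕 (toL2 f) : Lp ℂ 2 (volume : Measure ℝ)) ξ‖ ^ 2 := fun ξ => by positivity
  have hi := (lintegral_ofReal_ne_top_iff_integrable hm.aestronglyMeasurable
    (Eventually.of_forall hn)).1 (ne_top_of_le_ne_top ENNReal.ofReal_ne_top h)
  refine ⟨hi, ?_⟩
  rw [← ofReal_integral_eq_lintegral_ofReal hi (Eventually.of_forall hn)] at h
  exact (ENNReal.ofReal_le_ofReal_iff
    (mul_nonneg (by positivity) (gagliardo_nonneg f))).1 h

/-- Local control of `‖D^{1/2} w‖` by the Gagliardo seminorm of the localised function. -/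
theorem exists_integral_norm_sq_fracDeriv_le {χ : ℝ → ℝ} (hχ : ContDiff ℝ ∞ χ)
    (hχc : HasCompactSupport χ) : ∃ C : ℝ, 0 ≤ C ∧ ∀ w : ℝ → ℝ, MemLp w 2 volume →
      IsH1 (fun x => χ x * w x) →
      Integrable (fun x => ‖(χ x : ℂ) * fracDeriv (1 / 2) w x‖ ^ 2) ∧
      ∫ x, ‖(χ x : ℂ) * fracDeriv (1 / 2) w x‖ ^ 2 ≤
        C * (gagliardo (fun x => χ x * w x) + ∫ x, w x ^ 2) := by
  have hX : ContDiff ℝ ∞ fun x => (χ x : ℂ) := Complex.ofRealCLM.contDiff.comp hχ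
  have hXc : HasCompactSupport fun x => (χ x : ℂ) := hχc.comp_left Complex.ofReal_zero
  set c : SchwartzMap ℝ ℂ := 𝓕⁻ (hXc.toSchwartzMap hX) with hc
  obtain ⟨ρ, hρ, hρ2, hcρ⟩ := exists_isWeight_schwartz c
  have hpi := Real.pi_pos
  -- Both summands carry the factor 2 of `(a + b)² ≤ 2a² + 2b²`: one multiplies the constant `π/4`
  -- of the Gagliardo bound, the other the constant of Young's inequality.
  refine ⟨Real.pi / 2 + 2 * (∫ ζ, ρ ζ) ^ 2, by positivity, fun w hw hf => ?_⟩
  set f : ℝ → ℝ := fun x => χ x * w x with hfd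
  have hg0 := gagliardo_nonneg f
  have hw0 : 0 ≤ ∫ x, w x ^ 2 := integral_nonneg fun x => sq_nonneg _
  set W : Lp ℂ 2 (volume : Measure ℝ) := 𝓕 (toL2 w) with hW
  have hWm : Measurable W := (Lp.stronglyMeasurable W).measurable
  have hWw : ∫ ξ, ‖W ξ‖ ^ 2 = ∫ x, w x ^ 2 := by
    rw [hW, toL2_eq hw, integral_norm_sq_fourier_eq]
    simp only [Complex.norm_real, Real.norm_eq_abs, sq_abs]
  set g := fracDeriv (1 / 2) w with hg
  have hχg : MemLp (fun x => (χ x : ℂ) * g x) 2 volume := by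
    obtain ⟨B, hB⟩ := hXc.exists_bound_of_continuous hX.continuous
    refine MemLp.of_le_mul (c := B) (Lp.memLp g)
      (hX.continuous.aestronglyMeasurable.mul (Lp.memLp g).1) (Eventually.of_forall fun x => ?_)
    rw [norm_mul]
    exact mul_le_mul_of_nonneg_right (hB x) (norm_nonneg _)
  refine ⟨integrable_norm_sq hχg, ?_⟩
  -- If `|ξ|^{1/2} ŵ` is not square integrable, `fracDeriv` is zero by convention and the bound is
  -- trivial.
  by_cases hm : MemLp (fun ξ : ℝ => ((|2 * Real.pi * ξ| ^ (1 / 2 : ℝ) : ℝ) : ℂ) * W ξ) 2 volume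
  swap
  · have : g = 0 := dif_neg hm
    rw [this]
    have e : (fun x => ‖(χ x : ℂ) * (0 : Lp ℂ 2 (volume : Measure ℝ)) x‖ ^ 2) =ᵐ[volume]
        fun _ => (0 : ℝ) := by
      filter_upwards [Lp.coeFn_zero ℂ 2 (volume : Measure ℝ)] with x hx
      rw [hx]
      simp
    rw [integral_congr_ae e, integral_zero]
    positivity
  have hgF : 𝓕 g = hm.toLp _ := by
    rw [hg, fracDeriv, dif_pos hm, FourierTransform.fourier_fourierInv_eq]
  simp only [← Real.sqrt_eq_rpow] at hm hgF
  have hGae := hm.coeFn_toLp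
  set G := hm.toLp _ with hG
  -- the two convolution formulas
  have f1 := fourier_mul hX hXc (Lp.memLp g) hχg
  rw [Lp.toLp_coeFn, hgF, ← hc] at f1
  have hχw : MemLp (fun x => (χ x : ℂ) * (w x : ℂ)) 2 volume := by
    have := memLp_ofReal hf.memLp
    simpa only [hfd, Complex.ofReal_mul] using this
  have f2 := fourier_mul hX hXc (memLp_ofReal hw) hχw
  rw [← hc, ← toL2_eq hw] at f2
  have hfL : toL2 f = hχw.toLp _ := by
    rw [toL2_eq hf.memLp]
    simp only [hfd, Complex.ofReal_mul]
  rw [← hfL] at f2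
  have hk : Measurable fun ζ => ‖c ζ‖ * √|2 * Real.pi * ζ| :=
    (c.continuous.norm.mul (by fun_prop)).measurable
  have hyoung := hρ.memLp_convolution hk (fun ζ => by
    rw [abs_of_nonneg (by positivity)]
    refine le_trans ?_ (hcρ ζ)
    exact mul_le_mul_of_nonneg_left (by linarith) (norm_nonneg _)) (Lp.memLp W).norm hWm.norm
  set I : ℝ → ℝ := fun ξ => ∫ ζ, ‖c ζ‖ * √|2 * Real.pi * ζ| * ‖W (ξ + ζ)‖ with hI
  obtain ⟨j1, j2⟩ := hf.integral_mul_fourier_le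
  have hsq : Integrable fun ξ => I ξ ^ 2 := hyoung.1.integrable_sq
  rw [← integral_norm_sq_fourier_eq hχg]
  have hle : ∀ᵐ ξ, ‖(𝓕 (hχg.toLp _) : Lp ℂ 2 (volume : Measure ℝ)) ξ‖ ^ 2 ≤
      2 * (|2 * Real.pi * ξ| * ‖(𝓕 (toL2 f) : Lp ℂ 2 (volume : Measure ℝ)) ξ‖ ^ 2) +
        2 * I ξ ^ 2 := by
    filter_upwards [f1, f2] with ξ h1 h2
    have q : ∀ᵐ ζ, G (ξ + ζ) = ((√|2 * Real.pi * (ξ + ζ)| : ℝ) : ℂ) * W (ξ + ζ) :=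
      (measurePreserving_add_left volume ξ).quasiMeasurePreserving.ae hGae
    have h1' : (𝓕 (hχg.toLp _) : Lp ℂ 2 (volume : Measure ℝ)) ξ =
        ∫ ζ, c ζ * (((√|2 * Real.pi * (ξ + ζ)| : ℝ) : ℂ) * W (ξ + ζ)) := by
      rw [h1]
      refine integral_congr_ae ?_
      filter_upwards [q] with ζ hζ
      rw [hζ]
    have h3 := norm_convolution_sub_le c (Lp.memLp W) hm ξ
    rw [← h1', ← h2] at h3
    set a := (𝓕 (hχg.toLp _) : Lp ℂ 2 (volume : Measure ℝ)) ξ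
    set b := (𝓕 (toL2 f) : Lp ℂ 2 (volume : Measure ℝ)) ξ
    have h4 : ‖a‖ ≤ √|2 * Real.pi * ξ| * ‖b‖ + I ξ := by
      have := norm_sub_norm_le a (((√|2 * Real.pi * ξ| : ℝ) : ℂ) * b)
      rw [norm_mul, Complex.norm_real, Real.norm_of_nonneg (Real.sqrt_nonneg _)] at this
      linarith
    calc ‖a‖ ^ 2 ≤ (√|2 * Real.pi * ξ| * ‖b‖ + I ξ) ^ 2 :=
          pow_le_pow_left₀ (norm_nonneg _) h4 2
      _ ≤ 2 * (√|2 * Real.pi * ξ| * ‖b‖) ^ 2 + 2 * I ξ ^ 2 := by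
          nlinarith [sq_nonneg (√|2 * Real.pi * ξ| * ‖b‖ - I ξ)]
      _ = _ := by rw [mul_pow, Real.sq_sqrt (abs_nonneg _)]
  refine (integral_mono_ae (integrable_norm_sq (Lp.memLp _))
    ((j1.const_mul 2).add (hsq.const_mul 2)) hle).trans ?_
  simp only [Pi.add_apply]
  rw [integral_add (j1.const_mul 2) (hsq.const_mul 2), integral_const_mul, integral_const_mul]
  have h5 := hyoung.2
  rw [hWw] at h5
  have h6 : 0 ≤ (∫ ζ, ρ ζ) ^ 2 * gagliardo f := by positivity
  have h7 : 0 ≤ Real.pi * ∫ x, w x ^ 2 := by positivity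
  linarith

/-- Apply the localised estimate with `χ = √φ'`, which equals `1` on the open interval `(-R, R)`;
the endpoints are a null set. -/
theorem IsCutoff.exists_setIntegral_fracDeriv_le {R : ℝ} {φ : ℝ → ℝ} (hφ : IsCutoff R φ) :
    ∃ C : ℝ, 0 ≤ C ∧ ∀ w : ℝ → ℝ, IsH2 w →
      ∫ x in Set.Icc (-R) R, ‖fracDeriv (1 / 2) w x‖ ^ 2 ≤
        C * (gagliardo (fun x => √(deriv φ x) * w x) + ∫ x, w x ^ 2) := by
  obtain ⟨C, hC, h⟩ := exists_integral_norm_sq_fracDeriv_le hφ.sqrt_smooth hφ.sqrt_compact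
  refine ⟨C, hC, fun w hw => ?_⟩
  obtain ⟨h1, h2⟩ := h w hw.h1.memLp (hφ.isH1_sqrt_mul hw)
  refine le_trans ?_ h2
  rw [← setIntegral_congr_set Ioo_ae_eq_Icc]
  refine le_trans (le_of_eq (setIntegral_congr_fun measurableSet_Ioo fun x hx => ?_))
    (setIntegral_le_integral h1 (Eventually.of_forall fun x => sq_nonneg _))
  rw [hφ.deriv_eq_one x (abs_lt.2 hx), Real.sqrt_one, Complex.ofReal_one, one_mul]

end fourier

/-! ### Inverse inequalities for polynomials on one interval. -/

section polynomial

open Polynomial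

/-- Equivalence of norms in finite dimension: the quadratic form is continuous and positive on the
compact unit sphere of coefficient vectors, since a nonzero polynomial cannot vanish on an interval.
-/
theorem exists_sq_norm_le_integral (n : ℕ) : ∃ A : ℝ, 0 < A ∧ ∀ a : Fin n → ℝ,
    ‖a‖ ^ 2 ≤ A * ∫ x in (0 : ℝ)..1, (∑ i, a i * x ^ (i : ℕ)) ^ 2 := by
  set Q : (Fin n → ℝ) → ℝ := fun a => ∫ x in (0 : ℝ)..1, (∑ i, a i * x ^ (i : ℕ)) ^ 2 with hQ
  have hQc : Continuous Q :=
    intervalIntegral.continuous_parametric_intervalIntegral_of_continuous' (by fun_prop) 0 1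
  have hpos : ∀ a : Fin n → ℝ, a ≠ 0 → 0 < Q a := by
    intro a ha
    refine intervalIntegral.integral_pos one_pos (by fun_prop) (fun x _ => sq_nonneg _) ?_
    by_contra! hcon
    set p : ℝ[X] := ∑ i : Fin n, C (a i) * X ^ (i : ℕ) with hp
    have he : ∀ x, p.eval x = ∑ i, a i * x ^ (i : ℕ) := fun x => by
      simp [hp, eval_finsetSum]
    have h0 : p = 0 := by
      refine eq_zero_of_infinite_isRoot p ((Set.Icc_infinite (zero_lt_one (α := ℝ))).mono
        fun x hx => ?_)
      have := hcon x hx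
      rw [← he] at this
      exact pow_eq_zero_iff (two_ne_zero) |>.1 (le_antisymm this (sq_nonneg _))
    refine ha (funext fun j => ?_)
    have := congrArg (fun q => coeff q j) h0
    simpa [hp, finsetSum_coeff, coeff_X_pow, Fin.val_inj] using this
  rcases (Metric.sphere (0 : Fin n → ℝ) 1).eq_empty_or_nonempty with he | hne
  · refine ⟨1, one_pos, fun a => ?_⟩
    have ha : a = 0 := by
      by_contra ha
      have : ‖a‖⁻¹ • a ∈ Metric.sphere (0 : Fin n → ℝ) 1 := by
        simp [norm_smul, ha]
      rw [he] at this
      exact this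
    simp [ha]
  · obtain ⟨a₀, ha₀, hmin⟩ := (isCompact_sphere (0 : Fin n → ℝ) 1).exists_isMinOn hne
      hQc.continuousOn
    have hm : 0 < Q a₀ := hpos a₀ (by rintro rfl; simp at ha₀)
    refine ⟨(Q a₀)⁻¹, inv_pos.2 hm, fun a => ?_⟩
    rcases eq_or_ne a 0 with rfl | ha
    · simp
    have hs : ‖a‖⁻¹ • a ∈ Metric.sphere (0 : Fin n → ℝ) 1 := by simp [norm_smul, ha]
    have h1 : Q a₀ ≤ Q (‖a‖⁻¹ • a) := hmin hs
    have h2 : Q (‖a‖⁻¹ • a) = (‖a‖⁻¹) ^ 2 * Q a := by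
      simp only [hQ, Pi.smul_apply, smul_eq_mul, mul_assoc, ← Finset.mul_sum, mul_pow]
      rw [intervalIntegral.integral_const_mul]
    have hn : 0 < ‖a‖ := norm_pos_iff.2 ha
    rw [h2, inv_pow, ← div_eq_inv_mul, le_div_iff₀ (by positivity)] at h1
    rw [← div_eq_inv_mul, le_div_iff₀ hm]
    linarith

theorem abs_eval_le {p : ℝ[X]} {r : ℕ} (hp : p.natDegree ≤ r) {B : ℝ} (hB : ∀ i, |p.coeff i| ≤ B)
    {x : ℝ} (hx : x ∈ Set.Icc (0 : ℝ) 1) : |p.eval x| ≤ (r + 1) * B := by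
  rw [eval_eq_sum_range' (Nat.lt_succ_of_le hp)]
  refine (Finset.abs_sum_le_sum_abs _ _).trans ((Finset.sum_le_card_nsmul _ _ B fun i _ => ?_).trans
    (by simp))
  rw [abs_mul, abs_pow, abs_of_nonneg hx.1]
  exact (mul_le_of_le_one_right (abs_nonneg _) (pow_le_one₀ hx.1 hx.2)).trans (hB i)

theorem exists_eval_sq_le_unit (r : ℕ) : ∃ A : ℝ, 0 < A ∧ ∀ p : ℝ[X], p.natDegree ≤ r →
    ∀ x ∈ Set.Icc (0 : ℝ) 1, p.eval x ^ 2 ≤ A * (∫ t in (0 : ℝ)..1, p.eval t ^ 2) ∧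
      p.derivative.eval x ^ 2 ≤ A * ∫ t in (0 : ℝ)..1, p.eval t ^ 2 := by
  obtain ⟨A, hA, h⟩ := exists_sq_norm_le_integral (r + 1)
  refine ⟨(r + 1) ^ 4 * A, by positivity, fun p hp x hx => ?_⟩
  set I := ∫ t in (0 : ℝ)..1, p.eval t ^ 2 with hI
  have h1 := h fun i => p.coeff i
  have e : ∀ t, ∑ i : Fin (r + 1), p.coeff i * t ^ (i : ℕ) = p.eval t := fun t => by
    rw [eval_eq_sum_range' (Nat.lt_succ_of_le hp), Finset.sum_range]
  simp only [e] at h1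
  have hI0 : 0 ≤ A * I := le_trans (sq_nonneg _) h1
  have hc : ∀ i, |p.coeff i| ≤ √(A * I) := by
    intro i
    by_cases hi : i < r + 1
    · refine Real.abs_le_sqrt (le_trans ?_ h1)
      have := norm_le_pi_norm (fun i : Fin (r + 1) => p.coeff i) ⟨i, hi⟩
      rw [← sq_abs]
      exact pow_le_pow_left₀ (abs_nonneg _) this 2
    · rw [coeff_eq_zero_of_natDegree_lt (by omega), abs_zero]
      exact Real.sqrt_nonneg _
  have hd : ∀ i, |p.derivative.coeff i| ≤ (r + 1) * √(A * I) := by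
    intro i
    rw [coeff_derivative, abs_mul, mul_comm]
    by_cases hi : i < r + 1
    · refine mul_le_mul ?_ (hc _) (abs_nonneg _) (by positivity)
      rw [abs_of_nonneg (by positivity)]
      have : (i : ℝ) ≤ r := by exact_mod_cast Nat.lt_succ_iff.1 hi
      linarith
    · rw [coeff_eq_zero_of_natDegree_lt (by omega), abs_zero, mul_zero]
      positivity
  have b1 := abs_eval_le hp hc hx
  have b2 := abs_eval_le ((natDegree_derivative_le p).trans ((Nat.sub_le _ 1).trans hp)) hd hx
  have hr : (1 : ℝ) ≤ r + 1 := by linarith [(Nat.cast_nonneg r : (0 : ℝ) ≤ r)]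
  constructor
  · calc p.eval x ^ 2 = |p.eval x| ^ 2 := (sq_abs _).symm
      _ ≤ ((r + 1) * √(A * I)) ^ 2 := pow_le_pow_left₀ (abs_nonneg _) b1 2
      _ = (r + 1) ^ 2 * (A * I) := by rw [mul_pow, Real.sq_sqrt hI0]
      _ ≤ (r + 1) ^ 4 * (A * I) :=
          mul_le_mul_of_nonneg_right (pow_le_pow_right₀ hr (by norm_num)) hI0
      _ = _ := by ring
  · calc p.derivative.eval x ^ 2 = |p.derivative.eval x| ^ 2 := (sq_abs _).symm
      _ ≤ ((r + 1) * ((r + 1) * √(A * I))) ^ 2 := pow_le_pow_left₀ (abs_nonneg _) b2 2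
      _ = (r + 1) ^ 4 * (√(A * I)) ^ 2 := by ring
      _ = _ := by rw [Real.sq_sqrt hI0]; ring

/-- Inverse inequalities for polynomials on an interval of length `h`. -/
theorem exists_eval_sq_le (r : ℕ) : ∃ A : ℝ, 0 < A ∧ ∀ p : ℝ[X], p.natDegree ≤ r →
    ∀ a h : ℝ, 0 < h → ∀ x ∈ Set.Icc a (a + h),
      p.eval x ^ 2 ≤ A / h * (∫ t in a..(a + h), p.eval t ^ 2) ∧
      p.derivative.eval x ^ 2 ≤ A / h ^ 3 * ∫ t in a..(a + h), p.eval t ^ 2 := by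
  obtain ⟨A, hA, H⟩ := exists_eval_sq_le_unit r
  refine ⟨A, hA, fun p hp a h hh x hx => ?_⟩
  -- An affine change of variable to `[0, 1]`: the integral picks up `1/h` and the derivative a
  -- factor `h`, whence the powers `1/h` and `1/h³`.
  set q : ℝ[X] := p.comp (C h * X + C a) with hq
  have hqd : q.natDegree ≤ r := by
    refine (natDegree_comp_le).trans ?_
    calc p.natDegree * (C h * X + C a).natDegree ≤ p.natDegree * 1 :=
          Nat.mul_le_mul_left _ natDegree_linear_le
      _ ≤ r := by omega
  have hqe : ∀ t, q.eval t = p.eval (h * t + a) := fun t => by simp [hq]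
  have hqd' : ∀ t, q.derivative.eval t = h * p.derivative.eval (h * t + a) := fun t => by
    simp [hq, derivative_comp]
  have hI : ∫ t in (0 : ℝ)..1, q.eval t ^ 2 = h⁻¹ * ∫ t in a..(a + h), p.eval t ^ 2 := by
    simp only [hqe]
    rw [intervalIntegral.integral_comp_mul_add (fun s => p.eval s ^ 2) hh.ne']
    simp [add_comm]
  have hx' : (x - a) / h ∈ Set.Icc (0 : ℝ) 1 :=
    ⟨div_nonneg (by linarith [hx.1]) hh.le, (div_le_one hh).2 (by linarith [hx.2])⟩
  have hxe : h * ((x - a) / h) + a = x := by field_simp; ring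
  obtain ⟨h1, h2⟩ := H q hqd _ hx'
  rw [hqe, hxe, hI] at h1
  rw [hqd', hxe, hI] at h2
  refine ⟨by rw [div_eq_mul_inv, mul_assoc]; exact h1, ?_⟩
  rw [div_mul_eq_mul_div, le_div_iff₀ (by positivity)]
  rw [mul_pow] at h2
  have h3 := mul_le_mul_of_nonneg_left h2 hh.le
  have e : h * (A * (h⁻¹ * ∫ t in a..(a + h), p.eval t ^ 2)) =
      A * ∫ t in a..(a + h), p.eval t ^ 2 := by field_simp
  rw [e] at h3
  linarith

end polynomial

/-! ### Piecewise polynomials on the mesh. -/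

section piecewise

open Polynomial

/-- Functions which agree on the interior of each element with a polynomial of degree `≤ r`. -/
def IsPiecewisePoly (r : ℕ) (h : ℝ) (f : ℝ → ℝ) : Prop :=
  ∀ j : ℤ, ∃ p : ℝ[X], p.natDegree ≤ r ∧
    ∀ x ∈ Set.Ioo (((j : ℝ) - 1) * h) ((j : ℝ) * h), f x = p.eval x

theorem exists_mem_Ioc {h : ℝ} (hh : 0 < h) (x : ℝ) :
    ∃ j : ℤ, x ∈ Set.Ioc (((j : ℝ) - 1) * h) ((j : ℝ) * h) := by
  refine ⟨⌈x / h⌉, ?_, ?_⟩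
  · have := Int.ceil_lt_add_one (x / h)
    rw [← lt_div_iff₀ hh]
    linarith
  · exact (div_le_iff₀ hh).1 (Int.le_ceil _)

theorem iUnion_element {h : ℝ} (hh : 0 < h) :
    ⋃ j : ℤ, Set.Ioc (((j : ℝ) - 1) * h) ((j : ℝ) * h) = Set.univ :=
  Set.eq_univ_of_forall fun x => Set.mem_iUnion.2 (exists_mem_Ioc hh x)

theorem pairwise_disjoint_element {h : ℝ} (hh : 0 < h) :
    Pairwise (Function.onFun Disjoint fun j : ℤ => Set.Ioc (((j : ℝ) - 1) * h) ((j : ℝ) * h)) := by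
  intro i j hij
  refine Set.disjoint_left.2 fun x hi hj => hij ?_
  have h1 : ((i : ℝ) - 1) < j := lt_of_mul_lt_mul_right (hi.1.trans_le hj.2) hh.le
  have h2 : ((j : ℝ) - 1) < i := lt_of_mul_lt_mul_right (hj.1.trans_le hi.2) hh.le
  have h3 : i - 1 < j := by exact_mod_cast h1
  have h4 : j - 1 < i := by exact_mod_cast h2
  omega

theorem countable_nodes (h : ℝ) : (Set.range fun j : ℤ => (j : ℝ) * h).Countable :=
  Set.countable_range _

theorem exists_mem_Ioo {h : ℝ} (hh : 0 < h) {x : ℝ} (hx : x ∉ Set.range fun j : ℤ => (j : ℝ) * h) :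
    ∃ j : ℤ, x ∈ Set.Ioo (((j : ℝ) - 1) * h) ((j : ℝ) * h) := by
  obtain ⟨j, hj⟩ := exists_mem_Ioc hh x
  exact ⟨j, hj.1, lt_of_le_of_ne hj.2 fun e => hx ⟨j, e.symm⟩⟩

theorem hasDerivAt_of_element {h : ℝ} {f : ℝ → ℝ} {j : ℤ} {p : ℝ[X]}
    (hp : ∀ x ∈ Set.Ioo (((j : ℝ) - 1) * h) ((j : ℝ) * h), f x = p.eval x) {x : ℝ}
    (hx : x ∈ Set.Ioo (((j : ℝ) - 1) * h) ((j : ℝ) * h)) :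
    HasDerivAt f (p.derivative.eval x) x :=
  (p.hasDerivAt x).congr_of_eventuallyEq (eventually_of_mem (Ioo_mem_nhds hx.1 hx.2) hp)

theorem IsPiecewisePoly.deriv {r : ℕ} {h : ℝ} {f : ℝ → ℝ} (hf : IsPiecewisePoly r h f) :
    IsPiecewisePoly r h (deriv f) := by
  intro j
  obtain ⟨p, hpd, hp⟩ := hf j
  exact ⟨p.derivative, (natDegree_derivative_le p).trans ((Nat.sub_le _ 1).trans hpd),
    fun x hx => (hasDerivAt_of_element hp hx).deriv⟩

theorem IsPiecewisePoly.hasDerivAt_deriv {r : ℕ} {h : ℝ} (hh : 0 < h) {f : ℝ → ℝ}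
    (hf : IsPiecewisePoly r h f) {x : ℝ} (hx : x ∉ Set.range fun j : ℤ => (j : ℝ) * h) :
    HasDerivAt f (_root_.deriv f x) x := by
  obtain ⟨j, hj⟩ := exists_mem_Ioo hh hx
  obtain ⟨p, hpd, hp⟩ := hf j
  exact (hasDerivAt_of_element hp hj).differentiableAt.hasDerivAt

theorem lintegral_eq_tsum_element {h : ℝ} (hh : 0 < h) (f : ℝ → ℝ≥0∞) :
    ∫⁻ x, f x = ∑' j : ℤ, ∫⁻ x in Set.Ioo (((j : ℝ) - 1) * h) ((j : ℝ) * h), f x := by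
  rw [← setLIntegral_univ, ← iUnion_element hh,
    lintegral_iUnion (fun j => measurableSet_Ioc) (pairwise_disjoint_element hh)]
  simp only [restrict_Ioo_eq_restrict_Ioc]

theorem memLp_two_iff_lintegral {f : ℝ → ℝ} (hf : AEStronglyMeasurable f volume) :
    MemLp f 2 volume ↔ ∫⁻ x, ENNReal.ofReal (f x ^ 2) ≠ ⊤ := by
  rw [memLp_two_iff_integrable_sq hf]
  exact (lintegral_ofReal_ne_top_iff_integrable (hf.pow 2)
    (Eventually.of_forall fun x => sq_nonneg _)).symm

/-- The inverse inequalities on piecewise polynomials. -/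
theorem exists_inverse_inequality (r : ℕ) : ∃ A : ℝ, 0 < A ∧ ∀ h : ℝ, 0 < h → ∀ f : ℝ → ℝ,
    IsPiecewisePoly r h f → MemLp f 2 volume →
      (∀ x ∉ (Set.range fun j : ℤ => (j : ℝ) * h), f x ^ 2 ≤ A / h * ∫ t, f t ^ 2) ∧
      MemLp (deriv f) 2 volume ∧ ∫ t, deriv f t ^ 2 ≤ A / h ^ 2 * ∫ t, f t ^ 2 := by
  obtain ⟨A, hA, H⟩ := exists_eval_sq_le r
  refine ⟨A, hA, fun h hh f hf hf2 => ?_⟩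
  have hel : ∀ j : ℤ, ∀ p : ℝ[X],
      (∀ x ∈ Set.Ioo (((j : ℝ) - 1) * h) ((j : ℝ) * h), f x = p.eval x) →
      ∫ t in (((j : ℝ) - 1) * h)..(((j : ℝ) - 1) * h + h), p.eval t ^ 2 =
        ∫ t in Set.Ioo (((j : ℝ) - 1) * h) ((j : ℝ) * h), f t ^ 2 := by
    intro j p hp
    rw [show ((j : ℝ) - 1) * h + h = j * h by ring, intervalIntegral.integral_of_le (by nlinarith),
      integral_Ioc_eq_integral_Ioo]
    exact setIntegral_congr_fun measurableSet_Ioo fun x hx => by simp only [hp x hx]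
  have hic : ∀ j : ℤ, Set.Ioo (((j : ℝ) - 1) * h) ((j : ℝ) * h) ⊆
      Set.Icc (((j : ℝ) - 1) * h) (((j : ℝ) - 1) * h + h) := fun j x hx =>
    ⟨hx.1.le, by linarith [hx.2]⟩
  -- The sum over elements is taken with values in `[0, ∞]`, so that square integrability of the
  -- derivative is a conclusion and not an assumption.
  have hlow : ∫⁻ t, ENNReal.ofReal (deriv f t ^ 2) ≤
      ENNReal.ofReal (A / h ^ 2) * ∫⁻ t, ENNReal.ofReal (f t ^ 2) := by
    rw [lintegral_eq_tsum_element hh, lintegral_eq_tsum_element hh, ← ENNReal.tsum_mul_left]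
    refine ENNReal.tsum_le_tsum fun j => ?_
    obtain ⟨p, hpd, hp⟩ := hf j
    have hI0 : 0 ≤ ∫ t in Set.Ioo (((j : ℝ) - 1) * h) ((j : ℝ) * h), f t ^ 2 :=
      integral_nonneg fun x => sq_nonneg _
    calc ∫⁻ x in Set.Ioo (((j : ℝ) - 1) * h) ((j : ℝ) * h), ENNReal.ofReal (deriv f x ^ 2)
        ≤ ∫⁻ _ in Set.Ioo (((j : ℝ) - 1) * h) ((j : ℝ) * h), ENNReal.ofReal
            (A / h ^ 3 * ∫ t in Set.Ioo (((j : ℝ) - 1) * h) ((j : ℝ) * h), f t ^ 2) := by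
          refine setLIntegral_mono' measurableSet_Ioo fun x hx => ENNReal.ofReal_le_ofReal ?_
          rw [(hasDerivAt_of_element hp hx).deriv, ← hel j p hp]
          exact (H p hpd _ h hh x (hic j hx)).2
      _ = ENNReal.ofReal (A / h ^ 2) *
            ENNReal.ofReal (∫ t in Set.Ioo (((j : ℝ) - 1) * h) ((j : ℝ) * h), f t ^ 2) := by
          rw [setLIntegral_const, Real.volume_Ioo, show (j : ℝ) * h - (j - 1) * h = h by ring,
            ← ENNReal.ofReal_mul (by positivity), ← ENNReal.ofReal_mul (by positivity)]
          congr 1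
          field_simp
      _ = _ := by
          rw [ofReal_integral_eq_lintegral_ofReal hf2.integrable_sq.integrableOn
            (Eventually.of_forall fun x => sq_nonneg _)]
  have hd : MemLp (deriv f) 2 volume := by
    rw [memLp_two_iff_lintegral (measurable_deriv f).aestronglyMeasurable]
    exact ne_top_of_le_ne_top (ENNReal.mul_ne_top ENNReal.ofReal_ne_top
      ((memLp_two_iff_lintegral hf2.1).1 hf2)) hlow
  refine ⟨fun x hx => ?_, hd, ?_⟩
  · obtain ⟨j, hj⟩ := exists_mem_Ioo hh hx
    obtain ⟨p, hpd, hp⟩ := hf j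
    rw [hp x hj]
    refine ((H p hpd _ h hh x (hic j hj)).1).trans ?_
    rw [hel j p hp]
    exact mul_le_mul_of_nonneg_left (setIntegral_le_integral hf2.integrable_sq
      (Eventually.of_forall fun x => sq_nonneg _)) (by positivity)
  · rw [← ofReal_integral_eq_lintegral_ofReal hd.integrable_sq
        (Eventually.of_forall fun x => sq_nonneg _),
      ← ofReal_integral_eq_lintegral_ofReal hf2.integrable_sq
        (Eventually.of_forall fun x => sq_nonneg _), ← ENNReal.ofReal_mul (by positivity)] at hlow
    exact (ENNReal.ofReal_le_ofReal_iff (mul_nonneg (by positivity)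
      (integral_nonneg fun x => sq_nonneg _))).1 hlow

/-- A continuous piecewise polynomial is differentiable off the countable set of nodes, which
suffices for the fundamental theorem of calculus; the inverse inequality puts its derivative in
`L²`. -/
theorem IsPiecewisePoly.isH1 {r : ℕ} {h : ℝ} (hh : 0 < h) {f : ℝ → ℝ}
    (hf : IsPiecewisePoly r h f) (hc : Continuous f) (hf2 : MemLp f 2 volume) : IsH1 f := by
  obtain ⟨A, -, H⟩ := exists_inverse_inequality r
  obtain ⟨-, hd, -⟩ := H h hh f hf hf2
  refine ⟨hf2, hd, fun a b => ?_⟩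
  exact MeasureTheory.integral_eq_of_hasDerivAt_off_countable f (_root_.deriv f)
    (countable_nodes h) hc.continuousOn
    (fun x hx => hf.hasDerivAt_deriv hh hx.2) (intervalIntegrable_of_memLp hd a b)

theorem IsPiecewisePoly.isH2 {r : ℕ} {h : ℝ} (hh : 0 < h) {f : ℝ → ℝ}
    (hf : IsPiecewisePoly r h f) (hc : ContDiff ℝ 1 f) (hf2 : MemLp f 2 volume) : IsH2 f :=
  have h1 := hf.isH1 hh hc.continuous hf2
  ⟨hc, h1, hf.deriv.isH1 hh (hc.continuous_deriv le_rfl) h1.memLp_deriv⟩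

end piecewise

/-! ### The Fourier definition of `H²` against the classical one. -/

section sobolev

/-- The Bessel multiplier of order 2 is `1 + ξ²`, in Mathlib's frequency variable without the factor
`2π`, and it acts on the transform as a genuine function. -/
theorem memSobolev_two_iff (F : Lp ℂ 2 (volume : Measure ℝ)) :
    TemperedDistribution.MemSobolev 2 2 (Lp.toTemperedDistribution F) ↔
      MemLp (fun ξ : ℝ => ((1 + ξ ^ 2 : ℝ) : ℂ) * (𝓕 F : Lp ℂ 2 (volume : Measure ℝ)) ξ) 2
        volume := by
  set V : Lp ℂ 2 (volume : Measure ℝ) := 𝓕 F with hV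
  have hg : (fun x : ℝ => (((1 + ‖x‖ ^ 2) ^ ((2 : ℝ) / 2) : ℝ) : ℂ)).HasTemperateGrowth := by
    fun_prop
  have hgv : ∀ x : ℝ, (((1 + ‖x‖ ^ 2) ^ ((2 : ℝ) / 2) : ℝ) : ℂ) = ((1 + x ^ 2 : ℝ) : ℂ) := by
    intro x
    rw [div_self two_ne_zero, Real.rpow_one, Real.norm_eq_abs, sq_abs]
  have hc : Continuous fun ξ : ℝ => ((1 + ξ ^ 2 : ℝ) : ℂ) := by fun_prop
  rw [TemperedDistribution.memSobolev_iff_exists_smulLeftCLM_fourier]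
  have key : ∀ ψ : SchwartzMap ℝ ℂ, (TemperedDistribution.smulLeftCLM ℂ
      (fun x : ℝ => (((1 + ‖x‖ ^ 2) ^ ((2 : ℝ) / 2) : ℝ) : ℂ))
      (𝓕 (Lp.toTemperedDistribution F))) ψ = ∫ ξ, ψ ξ * (((1 + ξ ^ 2 : ℝ) : ℂ) * V ξ) := by
    intro ψ
    rw [TemperedDistribution.smulLeftCLM_apply_apply, Lp.fourier_toTemperedDistribution_eq,
      Lp.toTemperedDistribution_apply]
    refine integral_congr_ae (Eventually.of_forall fun ξ => ?_)
    simp only [smul_eq_mul]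
    rw [SchwartzMap.smulLeftCLM_apply_apply hg, smul_eq_mul, hgv]
    ring
  constructor
  · rintro ⟨H, hH⟩
    have hloc : LocallyIntegrable fun ξ : ℝ => ((1 + ξ ^ 2 : ℝ) : ℂ) * V ξ := by
      have := (locallyIntegrable_of_memLp (Lp.memLp V)).locallyIntegrableOn Set.univ
      exact locallyIntegrableOn_univ.1 (this.continuousOn_mul hc.continuousOn
        isOpen_univ.isLocallyClosed)
    refine (memLp_congr_ae (ae_eq_of_integral_mul hloc
      (locallyIntegrable_of_memLp (Lp.memLp H)) fun ψ hψ hψc => ?_)).2 (Lp.memLp H)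
    have h1 := congrArg (fun T => T (hψc.toSchwartzMap hψ)) hH
    simp only [key, Lp.toTemperedDistribution_apply, smul_eq_mul] at h1
    exact h1
  · intro hm
    refine ⟨hm.toLp _, ?_⟩
    ext ψ
    rw [key, Lp.toTemperedDistribution_apply]
    refine integral_congr_ae ?_
    filter_upwards [hm.coeFn_toLp] with ξ hξ
    rw [hξ, smul_eq_mul]

theorem fourier_toL2_sub {v : ℝ → ℝ} (hv : MemLp v 2 volume) (y : ℝ) :
    (𝓕 (toL2 fun x => v (x + y) - v x) : Lp ℂ 2 (volume : Measure ℝ)) =ᵐ[volume]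
      fun ξ => (char y ξ - 1) * (𝓕 (toL2 v) : Lp ℂ 2 (volume : Measure ℝ)) ξ := by
  have hvy := memLp_shift hv y
  have e : toL2 (fun x => v (x + y) - v x) =
      (memLp_ofReal hvy).toLp (fun x => (v (x + y) : ℂ)) - toL2 v := by
    rw [toL2_eq hv, toL2_eq (f := fun x => v (x + y) - v x) (hvy.sub hv), ← MemLp.toLp_sub]
    congr 1
    funext x
    simp
  have e2 : (𝓕 (toL2 fun x => v (x + y) - v x) : Lp ℂ 2 (volume : Measure ℝ)) =
      𝓕 ((memLp_ofReal hvy).toLp (fun x => (v (x + y) : ℂ))) - 𝓕 (toL2 v) := by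
    rw [e]
    exact map_sub (Lp.fourierTransformₗᵢ ℝ ℂ) _ _
  rw [e2]
  have h1 := fourier_shift (f := fun x => (v x : ℂ)) (memLp_ofReal hv) y (memLp_ofReal hvy)
  rw [← toL2_eq hv] at h1
  filter_upwards [h1, Lp.coeFn_sub
    (𝓕 ((memLp_ofReal hvy).toLp (fun x => (v (x + y) : ℂ))) : Lp ℂ 2 (volume : Measure ℝ))
    (𝓕 (toL2 v))] with ξ h1 h2
  rw [h2, Pi.sub_apply, h1]
  ring

/-- The second difference has symbol `(e^{2πiyξ} - 1)²` up to translation. On `|ξ| ≤ 1/(2y)` its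
squared modulus is at least `256 y⁴ ξ⁴`, while its squared `L²` norm is at most `y⁴ ‖v''‖²`. Letting
`y → 0` exhausts all frequencies without computing the transform of a derivative. -/
theorem IsH2.lintegral_mul_fourier_le {v : ℝ → ℝ} (hv : IsH2 v) :
    ∫⁻ ξ, ENNReal.ofReal (256 * ξ ^ 4 * ‖(𝓕 (toL2 v) : Lp ℂ 2 (volume : Measure ℝ)) ξ‖ ^ 2) ≤
      ENNReal.ofReal (∫ x, deriv (deriv v) x ^ 2) := by
  set V : Lp ℂ 2 (volume : Measure ℝ) := 𝓕 (toL2 v) with hV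
  have hU : (⋃ n : ℕ, Set.Icc (-((n : ℝ) + 1)) (n + 1)) = Set.univ := by
    refine Set.eq_univ_of_forall fun x => ?_
    obtain ⟨n, hn⟩ := exists_nat_ge |x|
    exact Set.mem_iUnion.2 ⟨n, abs_le.1 (by linarith)⟩
  rw [← setLIntegral_univ, ← hU, setLIntegral_iUnion_of_directed _
    (Monotone.directed_le fun m n hmn => Set.Icc_subset_Icc
      (by have : (m : ℝ) ≤ n := by exact_mod_cast hmn
          linarith) (by have : (m : ℝ) ≤ n := by exact_mod_cast hmn
                        linarith))]
  refine iSup_le fun n => ?_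
  -- The largest shift for which `|2yξ| ≤ 1` on the whole interval `|ξ| ≤ n + 1`.
  set y : ℝ := 1 / (2 * (n + 1)) with hy
  have hy0 : 0 < y := by positivity
  set e : ℝ → ℝ := fun x => v (x + y) - v x with he
  have hem : MemLp e 2 volume := (memLp_shift hv.h1.memLp y).sub hv.h1.memLp
  have h1 := integral_norm_sq_char_sub_one_mul_toL2 hem y
  have h2 : ∫ x, (e (x + y) - e x) ^ 2 = ∫ x, secondDiff v y x ^ 2 := by
    rw [← integral_add_right_eq_self (fun x => secondDiff v y x ^ 2) y]
    refine integral_congr_ae (Eventually.of_forall fun x => ?_)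
    simp only [secondDiff, he, add_sub_cancel_right]
    ring
  have h3 := hv.integral_sq_secondDiff_le hy0.le
  have hi := integrable_norm_sq_char_sub_one_mul (𝓕 (toL2 e)) y
  have hF := fourier_toL2_sub hv.h1.memLp y
  calc ∫⁻ ξ in Set.Icc (-((n : ℝ) + 1)) (n + 1), ENNReal.ofReal (256 * ξ ^ 4 * ‖V ξ‖ ^ 2)
      ≤ ∫⁻ ξ in Set.Icc (-((n : ℝ) + 1)) (n + 1), ENNReal.ofReal
          (‖(char y ξ - 1) * (𝓕 (toL2 e) : Lp ℂ 2 (volume : Measure ℝ)) ξ‖ ^ 2 / y ^ 4) := by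
        refine setLIntegral_mono_ae' measurableSet_Icc ?_
        filter_upwards [hF] with ξ hξ hm
        refine ENNReal.ofReal_le_ofReal ?_
        rw [hξ, le_div_iff₀ (by positivity), norm_mul, norm_mul, mul_pow, mul_pow]
        have hb : |2 * y * ξ| ≤ 1 := by
          rw [abs_mul, abs_of_pos (by positivity)]
          have h1 := abs_le.2 hm
          have : 2 * y * (n + 1) = 1 := by rw [hy]; field_simp
          nlinarith
        have h1 := norm_sq_char_sub_one_ge hb
        have h2 := mul_le_mul h1 h1 (by positivity) (by positivity)
        have h3 := mul_le_mul_of_nonneg_right h2 (sq_nonneg ‖V ξ‖)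
        nlinarith
    _ ≤ ∫⁻ ξ, ENNReal.ofReal
          (‖(char y ξ - 1) * (𝓕 (toL2 e) : Lp ℂ 2 (volume : Measure ℝ)) ξ‖ ^ 2 / y ^ 4) :=
        setLIntegral_le_lintegral _ _
    _ = ENNReal.ofReal ((∫ x, secondDiff v y x ^ 2) / y ^ 4) := by
        rw [← ofReal_integral_eq_lintegral_ofReal (hi.div_const _)
          (Eventually.of_forall fun ξ => by positivity), integral_div, h1, h2]
    _ ≤ _ := by
        refine ENNReal.ofReal_le_ofReal ?_
        rw [div_le_iff₀ (by positivity)]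
        linarith

theorem IsH2.memH {v : ℝ → ℝ} (hv : IsH2 v) : MemH 2 v := by
  refine ⟨hv.h1.memLp, (memSobolev_two_iff _).2 ?_⟩
  set V : Lp ℂ 2 (volume : Measure ℝ) := 𝓕 (toL2 v) with hV
  have hc : Continuous fun ξ : ℝ => ((1 + ξ ^ 2 : ℝ) : ℂ) := by fun_prop
  have hVm : Measurable V := (Lp.stronglyMeasurable V).measurable
  have hm : AEStronglyMeasurable (fun ξ : ℝ => ((1 + ξ ^ 2 : ℝ) : ℂ) * V ξ) volume :=
    hc.aestronglyMeasurable.mul (Lp.memLp V).1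
  have h4m : Measurable fun ξ : ℝ => 256 * ξ ^ 4 * ‖V ξ‖ ^ 2 :=
    (by fun_prop : Measurable fun ξ : ℝ => 256 * ξ ^ 4).mul (hVm.norm.pow_const 2)
  have hi := (lintegral_ofReal_ne_top_iff_integrable h4m.aestronglyMeasurable
    (Eventually.of_forall fun ξ => by positivity)).1
    (ne_top_of_le_ne_top ENNReal.ofReal_ne_top hv.lintegral_mul_fourier_le)
  refine (memLp_two_iff_integrable_sq_norm hm).2
    ((((integrable_norm_sq (Lp.memLp V)).const_mul 2).add hi).mono' (hm.norm.pow 2)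
      (Eventually.of_forall fun ξ => ?_))
  rw [Real.norm_of_nonneg (by positivity), norm_mul, Complex.norm_real,
    Real.norm_of_nonneg (by positivity), mul_pow]
  simp only [Pi.add_apply]
  have : (1 + ξ ^ 2) ^ 2 ≤ 2 + 256 * ξ ^ 4 := by nlinarith [sq_nonneg (ξ ^ 2 - 1), sq_nonneg (ξ ^ 2)]
  nlinarith [mul_le_mul_of_nonneg_right this (sq_nonneg ‖V ξ‖)]

/-- Since `(1 + |ξ|)/(1 + ξ²)` is square integrable, both `v̂` and `ξ v̂` are in `L¹`, so the
inverse transform is a `C¹` representative. -/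
theorem MemH.exists_contDiff {v : ℝ → ℝ} (hv : MemH 2 v) :
    ∃ u : ℝ → ℝ, ContDiff ℝ 1 u ∧ v =ᵐ[volume] u := by
  have hm := (memSobolev_two_iff _).1 hv.2
  set V : Lp ℂ 2 (volume : Measure ℝ) := 𝓕 (toL2 v) with hV
  have hVm : Measurable V := (Lp.stronglyMeasurable V).measurable
  have hi : ∀ k : ℝ → ℝ, Measurable k → (∀ ξ, |k ξ| ≤ 1 + |ξ|) → Integrable fun ξ => k ξ * ‖V ξ‖ := by
    intro k hk hkb
    have hk2 : MemLp (fun ξ : ℝ => k ξ * (1 + ξ ^ 2)⁻¹) 2 volume := by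
      have hms : AEStronglyMeasurable (fun ξ : ℝ => k ξ * (1 + ξ ^ 2)⁻¹) volume :=
        (hk.mul (by fun_prop)).aestronglyMeasurable
      refine (memLp_two_iff_integrable_sq hms).2 ((integrable_inv_one_add_sq.const_mul 2).mono'
        (hms.pow 2) (Eventually.of_forall fun ξ => ?_))
      rw [Real.norm_of_nonneg (sq_nonneg _), mul_pow, inv_pow, ← div_eq_mul_inv,
        div_le_iff₀ (by positivity)]
      have h1 : k ξ ^ 2 ≤ 2 * (1 + ξ ^ 2) := by
        rw [← sq_abs, ← sq_abs ξ]
        have := pow_le_pow_left₀ (abs_nonneg _) (hkb ξ) 2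
        nlinarith [sq_nonneg (1 - |ξ|)]
      calc k ξ ^ 2 ≤ 2 * (1 + ξ ^ 2) := h1
        _ = _ := by field_simp
    refine (hk2.integrable_mul hm.norm).congr (Eventually.of_forall fun ξ => ?_)
    simp only [norm_mul, Complex.norm_real, Pi.mul_apply]
    rw [Real.norm_of_nonneg (by positivity : (0 : ℝ) ≤ 1 + ξ ^ 2)]
    field_simp
  have hV1 : Integrable V := by
    have := hi (fun _ => 1) measurable_const fun ξ => by
      rw [abs_one]
      linarith [abs_nonneg ξ]
    simp only [one_mul] at this
    exact (integrable_norm_iff hVm.aestronglyMeasurable).1 this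
  have hCd : ContDiff ℝ 1 (𝓕 (V : ℝ → ℂ)) := by
    refine Real.contDiff_fourier (N := 1) fun n hn => ?_
    have hn1 : n ≤ 1 := by exact_mod_cast hn
    refine hi (fun ξ => ‖ξ‖ ^ n) (by fun_prop) fun ξ => ?_
    rw [abs_of_nonneg (by positivity), Real.norm_eq_abs]
    interval_cases n
    · simp
    · simp
  have hcn : ContDiff ℝ 1 fun x => 𝓕 (V : ℝ → ℂ) (-x) := hCd.comp contDiff_neg
  refine ⟨fun x => (𝓕 (V : ℝ → ℂ) (-x)).re, Complex.reCLM.contDiff.comp hcn, ?_⟩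
  have hvm := memLp_ofReal hv.1
  have hae : (fun x => (v x : ℂ)) =ᵐ[volume] fun x => 𝓕 (V : ℝ → ℂ) (-x) := by
    refine ae_eq_of_integral_mul (locallyIntegrable_of_memLp hvm)
      hcn.continuous.locallyIntegrable fun ψ hψ hψc => ?_
    have hψi : Integrable ψ := hψ.continuous.integrable_of_hasCompactSupport hψc
    have h1 := congrArg (fun T => T (hψc.toSchwartzMap hψ))
      (Lp.fourierInv_toTemperedDistribution_eq V)
    have hinv : 𝓕⁻ V = toL2 v := FourierTransform.fourierInv_fourier_eq _
    rw [hinv] at h1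
    simp only [TemperedDistribution.fourierInv_apply, Lp.toTemperedDistribution_apply,
      smul_eq_mul] at h1
    have h2 : ∫ x, ψ x * (v x : ℂ) = ∫ x, ψ x * toL2 v x := by
      rw [toL2_eq hv.1]
      refine integral_congr_ae ?_
      filter_upwards [hvm.coeFn_toLp] with x hx
      rw [hx]
    have h3 : ∫ x, ψ x * toL2 v x = ∫ ξ, (𝓕⁻ (hψc.toSchwartzMap hψ)) ξ * V ξ := h1.symm
    have h4 : ∀ ξ, (𝓕⁻ (hψc.toSchwartzMap hψ)) ξ = ∫ x, char (-x) ξ * ψ (-x) := by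
      intro ξ
      rw [SchwartzMap.fourierInv_coe, Real.fourierInv_eq_fourier_neg, fourier_eq_char,
        ← integral_neg_eq_self]
      refine integral_congr_ae (Eventually.of_forall fun x => ?_)
      simp only [char, neg_neg]
      congr 2
      push_cast
      ring
    have hi2 := integrable_mul_char_mul hV1 hψi.comp_neg
    rw [h2, h3, ← integral_neg_eq_self (fun x => ψ x * 𝓕 (V : ℝ → ℂ) (-x))]
    simp only [neg_neg, h4]
    calc ∫ ξ, (∫ x, char (-x) ξ * ψ (-x)) * V ξ
        = ∫ ξ, ∫ x, V ξ * char (-x) ξ * ψ (-x) := by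
          refine integral_congr_ae (Eventually.of_forall fun ξ => ?_)
          simp only [mul_assoc]
          rw [integral_const_mul, mul_comm]
      _ = ∫ x, ∫ ξ, V ξ * char (-x) ξ * ψ (-x) :=
          integral_integral_swap (f := fun ξ x => V ξ * char (-x) ξ * ψ (-x)) hi2
      _ = _ := by
          refine integral_congr_ae (Eventually.of_forall fun x => ?_)
          simp only
          rw [integral_mul_const, fourier_eq_char, mul_comm]
          simp only [mul_comm (V _)]
  filter_upwards [hae] with x hx
  rw [← hx, Complex.ofReal_re]

end sobolev

/-! ### The finite element space: description, inverse constants, closedness in `L²`. -/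

section fem

open Polynomial

variable {r : ℕ} {h : ℝ}

/-- From left to right, `v` is continuous on every closed element and agrees almost everywhere with
a `C¹` function, hence agrees everywhere. From right to left, the inverse inequalities supply square
integrability of the derivatives, and continuity extends the polynomial identity from open to closed
elements. -/
theorem mem_femSpace_iff (hh : 0 < h) {v : ℝ → ℝ} :
    v ∈ femSpace r h ↔ ContDiff ℝ 1 v ∧ MemLp v 2 volume ∧ IsPiecewisePoly r h v := by
  have hne : ∀ j : ℤ, ((j : ℝ) - 1) * h ≠ j * h := fun j e => by nlinarith
  constructor
  · rintro ⟨hv, hp⟩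
    refine ⟨?_, hv.1, fun j => ?_⟩
    · obtain ⟨u, hu, hvu⟩ := hv.exists_contDiff
      have : v = u := by
        funext x
        obtain ⟨j, hj⟩ := exists_mem_Ioc hh x
        obtain ⟨p, -, hp⟩ := hp j
        have hc : ContinuousOn v (Set.Icc (((j : ℝ) - 1) * h) ((j : ℝ) * h)) :=
          p.continuous.continuousOn.congr hp
        exact Measure.eqOn_Icc_of_ae_eq volume (hne j) (ae_restrict_of_ae hvu) hc
          hu.continuous.continuousOn (Set.Ioc_subset_Icc_self hj)
      rw [this]
      exact hu
    · obtain ⟨p, hd, hp⟩ := hp j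
      exact ⟨p, hd, fun x hx => hp x (Set.Ioo_subset_Icc_self hx)⟩
  · rintro ⟨hc, hm, hp⟩
    refine ⟨(hp.isH2 hh hc hm).memH, fun j => ?_⟩
    obtain ⟨p, hd, hp⟩ := hp j
    refine ⟨p, hd, ?_⟩
    have : Set.EqOn v (fun x => p.eval x) (Set.Ioo (((j : ℝ) - 1) * h) ((j : ℝ) * h)) := hp
    have := this.closure hc.continuous p.continuous
    rwa [closure_Ioo (hne j)] at this

theorem isH2_of_mem (hh : 0 < h) {v : ℝ → ℝ} (hv : v ∈ femSpace r h) : IsH2 v := by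
  obtain ⟨hc, hm, hp⟩ := (mem_femSpace_iff hh).1 hv
  exact hp.isH2 hh hc hm

theorem IsPiecewisePoly.add {f g : ℝ → ℝ} (hf : IsPiecewisePoly r h f)
    (hg : IsPiecewisePoly r h g) : IsPiecewisePoly r h fun x => f x + g x := by
  intro j
  obtain ⟨p, hpd, hp⟩ := hf j
  obtain ⟨q, hqd, hq⟩ := hg j
  exact ⟨p + q, (natDegree_add_le p q).trans (max_le hpd hqd), fun x hx => by
    simp only [hp x hx, hq x hx, eval_add]⟩

theorem IsPiecewisePoly.const_mul (c : ℝ) {f : ℝ → ℝ} (hf : IsPiecewisePoly r h f) :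
    IsPiecewisePoly r h fun x => c * f x := by
  intro j
  obtain ⟨p, hpd, hp⟩ := hf j
  exact ⟨C c * p, (natDegree_C_mul_le c p).trans hpd, fun x hx => by
    simp only [hp x hx, eval_mul, eval_C]⟩

theorem add_mem_femSpace (hh : 0 < h) {v w : ℝ → ℝ} (hv : v ∈ femSpace r h)
    (hw : w ∈ femSpace r h) : (fun x => v x + w x) ∈ femSpace r h := by
  rw [mem_femSpace_iff hh] at hv hw ⊢
  exact ⟨hv.1.add hw.1, hv.2.1.add hw.2.1, hv.2.2.add hw.2.2⟩

theorem const_mul_mem_femSpace (hh : 0 < h) (c : ℝ) {v : ℝ → ℝ} (hv : v ∈ femSpace r h) :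
    (fun x => c * v x) ∈ femSpace r h := by
  rw [mem_femSpace_iff hh] at hv ⊢
  exact ⟨contDiff_const.mul hv.1, hv.2.1.const_mul c, hv.2.2.const_mul c⟩

theorem sub_mem_femSpace (hh : 0 < h) {v w : ℝ → ℝ} (hv : v ∈ femSpace r h)
    (hw : w ∈ femSpace r h) : (fun x => v x - w x) ∈ femSpace r h := by
  have := add_mem_femSpace hh hv (const_mul_mem_femSpace hh (-1) hw)
  simpa only [neg_one_mul, ← sub_eq_add_neg] using this

theorem zero_mem_femSpace (hh : 0 < h) : (fun _ => (0 : ℝ)) ∈ femSpace r h :=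
  (mem_femSpace_iff hh).2 ⟨contDiff_const, MemLp.zero, fun _ => ⟨0, by simp, by simp⟩⟩

theorem midpoint_mem_femSpace (hh : 0 < h) {v w : ℝ → ℝ} (hv : v ∈ femSpace r h)
    (hw : w ∈ femSpace r h) : midpoint v w ∈ femSpace r h := by
  have := const_mul_mem_femSpace hh (1 / 2) (add_mem_femSpace hh hv hw)
  refine Eq.mp ?_ this
  congr 1
  funext x
  simp only [midpoint]
  ring

theorem eLpNorm_two_eq {f : ℝ → ℝ} (hf : MemLp f 2 volume) :
    eLpNorm f 2 volume = ENNReal.ofReal √(∫ x, f x ^ 2) := by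
  rw [hf.eLpNorm_eq_integral_rpow_norm (by norm_num) (by norm_num), Real.sqrt_eq_rpow]
  simp

theorem eLpNorm_top_le {f : ℝ → ℝ} {B : ℝ} (hf : ∀ᵐ x, f x ^ 2 ≤ B ^ 2) (hB : 0 ≤ B) :
    eLpNorm f ⊤ volume ≤ ENNReal.ofReal B := by
  rw [eLpNorm_exponent_top]
  refine eLpNormEssSup_le_of_ae_bound ?_
  filter_upwards [hf] with x hx
  exact abs_le_of_sq_le_sq hx hB

/-- A continuous function is bounded by its essential supremum. -/
theorem sq_le_of_eLpNorm_top_le {f : ℝ → ℝ} (hf : Continuous f) {B : ℝ} (hB : 0 ≤ B)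
    (h : eLpNorm f ⊤ volume ≤ ENNReal.ofReal B) (x : ℝ) : f x ^ 2 ≤ B ^ 2 := by
  have h1 : ∀ᵐ x, ‖f x‖ ≤ B := by
    filter_upwards [ae_le_eLpNormEssSup (f := f) (μ := volume)] with x hx
    rw [← eLpNorm_exponent_top] at hx
    have := hx.trans h
    rw [← ofReal_norm] at this
    exact (ENNReal.ofReal_le_ofReal_iff hB).1 this
  have h2 : IsOpen {x | B < ‖f x‖} := isOpen_lt continuous_const hf.norm
  have h3 : volume {x | B < ‖f x‖} = 0 := by
    refine measure_mono_null (fun x hx => ?_) h1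
    have hx' : B < ‖f x‖ := hx
    exact not_le.2 hx'
  have h4 := (h2.measure_eq_zero_iff volume).1 h3
  have h5 : ‖f x‖ ≤ B := not_lt.1 fun hx => by
    have : x ∈ {x | B < ‖f x‖} := hx
    rw [h4] at this
    exact this
  rw [← sq_abs]
  exact pow_le_pow_left₀ (abs_nonneg _) h5 2

theorem sqrt_coeff (C : ℝ) {x : ℝ} (hx : 0 < x) (n : ℕ) :
    C ^ (1 / 2 : ℝ) / x ^ ((n : ℝ) / 2) = √(C / x ^ n) := by
  rw [Real.sqrt_div' _ (by positivity), ← Real.sqrt_eq_rpow, Real.sqrt_eq_rpow (x ^ n),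
    ← Real.rpow_natCast x n, ← Real.rpow_mul hx.le]
  congr 2
  ring

theorem sqrt_coeff_one (C : ℝ) {x : ℝ} (hx : 0 < x) :
    C ^ (1 / 2 : ℝ) / x ^ (1 / 2 : ℝ) = √(C / x) := by
  have := sqrt_coeff C hx 1
  simpa using this

theorem sqrt_coeff_three (C : ℝ) {x : ℝ} (hx : 0 < x) :
    C ^ (1 / 2 : ℝ) / x ^ (3 / 2 : ℝ) = √(C / x ^ 3) := by
  have := sqrt_coeff C hx 3
  simpa using this

theorem ae_not_mem_nodes (h : ℝ) : ∀ᵐ x : ℝ, x ∉ Set.range fun j : ℤ => (j : ℝ) * h :=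
  (countable_nodes h).ae_notMem volume

/-- With `A` the one-element constant, take `C₁ = A` and `C₂ = A²`, the second combining the sup
bound for the derivative with the `L²` bound of the derivative. -/
theorem exists_isInverseConstants (r : ℕ) : ∃ C₁ C₂ : ℝ, IsInverseConstants r C₁ C₂ := by
  obtain ⟨A, hA, H⟩ := exists_inverse_inequality r
  have key : ∀ h : ℝ, 0 < h → ∀ f : ℝ → ℝ, IsPiecewisePoly r h f → MemLp f 2 volume →
      eLpNorm f ⊤ volume ≤ ENNReal.ofReal √(A / h) * eLpNorm f 2 volume := by
    intro h hh f hf hf2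
    have h0 : 0 ≤ ∫ t, f t ^ 2 := integral_nonneg fun x => sq_nonneg _
    rw [eLpNorm_two_eq hf2, ← ENNReal.ofReal_mul (by positivity)]
    refine eLpNorm_top_le ?_ (by positivity)
    filter_upwards [ae_not_mem_nodes h] with x hx
    rw [mul_pow, Real.sq_sqrt (by positivity), Real.sq_sqrt h0]
    exact (H h hh f hf hf2).1 x hx
  refine ⟨A, A * A, hA, by positivity, fun h hh z hz => ?_, fun h hh z hz => ?_,
    fun h hh z hz => ?_⟩
  · rw [sqrt_coeff_one A hh]
    obtain ⟨hc, hm, hp⟩ := (mem_femSpace_iff hh).1 hz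
    exact key h hh z hp hm
  · rw [sqrt_coeff_one A hh]
    obtain ⟨hc, hm, hp⟩ := (mem_femSpace_iff hh).1 hz
    exact key h hh _ hp.deriv (H h hh z hp hm).2.1
  · rw [sqrt_coeff_one A hh, sqrt_coeff_three _ hh]
    obtain ⟨hc, hm, hp⟩ := (mem_femSpace_iff hh).1 hz
    obtain ⟨-, h1, h2⟩ := H h hh z hp hm
    rw [eLpNorm_two_eq hm, eLpNorm_two_eq h1, ← ENNReal.ofReal_mul (by positivity),
      ← ENNReal.ofReal_mul (by positivity), ← Real.sqrt_mul (by positivity),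
      ← Real.sqrt_mul (by positivity)]
    refine ENNReal.ofReal_le_ofReal (Real.sqrt_le_sqrt ?_)
    calc A / h * ∫ x, deriv z x ^ 2 ≤ A / h * (A / h ^ 2 * ∫ x, z x ^ 2) := by gcongr
      _ = _ := by field_simp

variable {C₁ C₂ : ℝ}

theorem IsInverseConstants.sq_le (hC : IsInverseConstants r C₁ C₂) (hh : 0 < h) {z : ℝ → ℝ}
    (hz : z ∈ femSpace r h) (x : ℝ) : z x ^ 2 ≤ C₁ / h * ∫ t, z t ^ 2 := by
  have h1 := hC.sup_le h hh z hz
  have hz' := isH2_of_mem hh hz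
  have h0 : 0 ≤ ∫ t, z t ^ 2 := integral_nonneg fun x => sq_nonneg _
  have hC1 := hC.pos₁
  rw [sqrt_coeff_one _ hh, eLpNorm_two_eq hz'.h1.memLp, ← ENNReal.ofReal_mul (by positivity)] at h1
  have := sq_le_of_eLpNorm_top_le hz'.contDiff.continuous (by positivity) h1 x
  rwa [mul_pow, Real.sq_sqrt (by positivity), Real.sq_sqrt h0] at this

theorem IsInverseConstants.deriv_sq_le (hC : IsInverseConstants r C₁ C₂) (hh : 0 < h) {z : ℝ → ℝ}
    (hz : z ∈ femSpace r h) (x : ℝ) : deriv z x ^ 2 ≤ C₂ / h ^ 3 * ∫ t, z t ^ 2 := by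
  have h1 := (hC.sup_deriv_le h hh z hz).trans (hC.deriv_le h hh z hz)
  have hz' := isH2_of_mem hh hz
  have h0 : 0 ≤ ∫ t, z t ^ 2 := integral_nonneg fun x => sq_nonneg _
  have hC2 := hC.pos₂
  rw [sqrt_coeff_three _ hh, eLpNorm_two_eq hz'.h1.memLp,
    ← ENNReal.ofReal_mul (by positivity)] at h1
  have := sq_le_of_eLpNorm_top_le (hz'.contDiff.continuous_deriv le_rfl) (by positivity) h1 x
  rwa [mul_pow, Real.sq_sqrt (by positivity), Real.sq_sqrt h0] at this

theorem exists_integral_deriv_sq_le (r : ℕ) {h : ℝ} (hh : 0 < h) : ∃ B : ℝ, 0 ≤ B ∧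
    ∀ z ∈ femSpace r h, ∫ x, deriv z x ^ 2 ≤ B * ∫ x, z x ^ 2 ∧
      ∫ x, deriv (deriv z) x ^ 2 ≤ B * ∫ x, z x ^ 2 := by
  obtain ⟨A, hA, H⟩ := exists_inverse_inequality r
  refine ⟨A / h ^ 2 + (A / h ^ 2) * (A / h ^ 2), by positivity, fun z hz => ?_⟩
  obtain ⟨hc, hm, hp⟩ := (mem_femSpace_iff hh).1 hz
  obtain ⟨-, h1, h2⟩ := H h hh z hp hm
  obtain ⟨-, h3, h4⟩ := H h hh _ hp.deriv h1
  have h0 : 0 ≤ ∫ t, z t ^ 2 := integral_nonneg fun x => sq_nonneg _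
  have h5 := mul_le_mul_of_nonneg_left h2 (by positivity : 0 ≤ A / h ^ 2)
  have h6 : 0 ≤ A / h ^ 2 * ∫ t, z t ^ 2 := by positivity
  have h7 : 0 ≤ A / h ^ 2 * (A / h ^ 2 * ∫ t, z t ^ 2) := by positivity
  constructor <;> nlinarith

/-- Lagrange interpolation at `r + 1` fixed nodes of an element reproduces every `u n` there, and
this identity passes to the pointwise limit. -/
theorem isPiecewisePoly_of_tendsto (hh : 0 < h) {u : ℕ → ℝ → ℝ} {v : ℝ → ℝ}
    (hu : ∀ n, IsPiecewisePoly r h (u n)) (hv : ∀ x, Tendsto (fun n => u n x) atTop (𝓝 (v x))) :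
    IsPiecewisePoly r h v := by
  intro j
  choose p hpd hp using fun n => hu n j
  obtain ⟨s, hs, hcard⟩ := (Set.Ioo_infinite (by nlinarith :
    ((j : ℝ) - 1) * h < j * h)).exists_subset_card_eq (r + 1)
  have hdeg : ∀ q : ℝ[X], q.natDegree ≤ r → q.degree < s.card := fun q hq => by
    rw [hcard]
    exact (degree_le_natDegree).trans_lt (by exact_mod_cast Nat.lt_succ_of_le hq)
  have hinj : Set.InjOn (id : ℝ → ℝ) s := Set.injOn_id _
  refine ⟨Lagrange.interpolate s id v, ?_, fun x hx => ?_⟩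
  · have := Lagrange.degree_interpolate_lt (r := v) hinj
    rw [hcard] at this
    rcases eq_or_ne (Lagrange.interpolate s id v) 0 with h0 | h0
    · rw [h0, natDegree_zero]
      exact Nat.zero_le r
    · exact Nat.lt_succ_iff.1 ((natDegree_lt_iff_degree_lt h0).2 this)
  · have e : ∀ n, (p n).eval x = ∑ i ∈ s, u n i * (Lagrange.basis s id i).eval x := by
      intro n
      have h1 := Lagrange.eq_interpolate (f := p n) hinj (hdeg _ (hpd n))
      conv_lhs => rw [h1]
      rw [Lagrange.interpolate_apply, eval_finsetSum]
      refine Finset.sum_congr rfl fun i hi => ?_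
      rw [eval_mul, eval_C, hp n i (hs hi)]
      rfl
    have h2 : Tendsto (fun n => u n x) atTop
        (𝓝 (∑ i ∈ s, v i * (Lagrange.basis s id i).eval x)) := by
      have : (fun n => u n x) = fun n => ∑ i ∈ s, u n i * (Lagrange.basis s id i).eval x := by
        funext n
        rw [hp n x hx, e]
      rw [this]
      exact tendsto_finsetSum _ fun i _ => (hv i).mul_const _
    rw [tendsto_nhds_unique (hv x) h2, Lagrange.interpolate_apply, eval_finsetSum]
    refine Finset.sum_congr rfl fun i hi => ?_
    rw [eval_mul, eval_C]

/-- `S_{Δx}` as a subspace of `L²(ℝ)`. -/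
def femSubmodule (r : ℕ) (hh : 0 < h) : Submodule ℝ (Lp ℝ 2 (volume : Measure ℝ)) where
  carrier := {F | ∃ v ∈ femSpace r h, F =ᵐ[volume] v}
  add_mem' := by
    rintro F G ⟨v, hv, hFv⟩ ⟨w, hw, hGw⟩
    refine ⟨_, add_mem_femSpace hh hv hw, ?_⟩
    filter_upwards [hFv, hGw, Lp.coeFn_add F G] with x h1 h2 h3
    rw [h3, Pi.add_apply, h1, h2]
  zero_mem' := ⟨_, zero_mem_femSpace hh, Lp.coeFn_zero ℝ 2 volume⟩
  smul_mem' := by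
    rintro c F ⟨v, hv, hFv⟩
    refine ⟨_, const_mul_mem_femSpace hh c hv, ?_⟩
    filter_upwards [hFv, Lp.coeFn_smul c F] with x h1 h3
    rw [h3, Pi.smul_apply, h1, smul_eq_mul]

theorem norm_sq_eq_integral {F : Lp ℝ 2 (volume : Measure ℝ)} {v : ℝ → ℝ} (hF : F =ᵐ[volume] v) :
    ‖F‖ ^ 2 = ∫ x, v x ^ 2 := by
  rw [← real_inner_self_eq_norm_sq, L2.inner_def]
  refine integral_congr_ae ?_
  filter_upwards [hF] with x hx
  rw [hx, real_inner_self_eq_norm_sq, Real.norm_eq_abs, sq_abs]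

theorem uniformCauchySeqOn_of_norm_le {E : Type*} [NormedAddCommGroup E] {F : ℕ → E}
    (hF : CauchySeq F) {g : ℕ → ℝ → ℝ} {K : ℝ} (hK : 0 ≤ K)
    (hg : ∀ m n x, |g m x - g n x| ≤ K * ‖F m - F n‖) : UniformCauchySeqOn g atTop Set.univ := by
  rw [Metric.uniformCauchySeqOn_iff]
  intro ε hε
  obtain ⟨N, hN⟩ := Metric.cauchySeq_iff.1 hF (ε / (K + 1)) (by positivity)
  refine ⟨N, fun m hm n hn x _ => ?_⟩
  have h1 := hN m hm n hn
  rw [dist_eq_norm, lt_div_iff₀ (by positivity)] at h1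
  rw [Real.dist_eq]
  have := hg m n x
  nlinarith [norm_nonneg (F m - F n)]

/-- By the inverse inequalities an `L²` Cauchy sequence in the space is uniformly Cauchy together
with its derivatives. The limit is therefore `C¹` and piecewise polynomial, and it agrees with the
`L²` limit along an almost everywhere convergent subsequence. -/
theorem isClosed_femSubmodule (r : ℕ) (hh : 0 < h) :
    IsClosed (femSubmodule r hh : Set (Lp ℝ 2 (volume : Measure ℝ))) := by
  obtain ⟨C₁, C₂, hC⟩ := exists_isInverseConstants r
  have hC1 := hC.pos₁
  have hC2 := hC.pos₂
  refine IsSeqClosed.isClosed fun F G hF hG => ?_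
  choose v hv hFv using hF
  have hCau := hG.cauchySeq
  have hnorm : ∀ m n, ‖F m - F n‖ ^ 2 = ∫ x, (v m x - v n x) ^ 2 := fun m n =>
    norm_sq_eq_integral (by
      filter_upwards [Lp.coeFn_sub (F m) (F n), hFv m, hFv n] with x h1 h2 h3
      rw [h1, Pi.sub_apply, h2, h3])
  have hc1 : ∀ m n x, |v m x - v n x| ≤ √(C₁ / h) * ‖F m - F n‖ := by
    intro m n x
    refine abs_le_of_sq_le_sq ?_ (by positivity)
    rw [mul_pow, Real.sq_sqrt (by positivity), hnorm]
    exact hC.sq_le hh (sub_mem_femSpace hh (hv m) (hv n)) x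
  have hdv : ∀ n x, HasDerivAt (v n) (deriv (v n) x) x := fun n x =>
    (isH2_of_mem hh (hv n)).hasDerivAt x
  have hc2 : ∀ m n x, |deriv (v m) x - deriv (v n) x| ≤ √(C₂ / h ^ 3) * ‖F m - F n‖ := by
    intro m n x
    refine abs_le_of_sq_le_sq ?_ (by positivity)
    rw [mul_pow, Real.sq_sqrt (by positivity), hnorm, ← ((hdv m x).sub (hdv n x)).deriv]
    exact hC.deriv_sq_le hh (sub_mem_femSpace hh (hv m) (hv n)) x
  have hu1 := uniformCauchySeqOn_of_norm_le hCau (by positivity) hc1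
  have hu2 := uniformCauchySeqOn_of_norm_le hCau (by positivity) hc2
  choose w hw using fun x => cauchySeq_tendsto_of_complete (hu1.cauchy_map (Set.mem_univ x))
  choose g hg using fun x => cauchySeq_tendsto_of_complete (hu2.cauchy_map (Set.mem_univ x))
  have ht2 : TendstoUniformly (fun n => deriv (v n)) g atTop :=
    tendstoUniformlyOn_univ.1 (hu2.tendstoUniformlyOn_of_tendsto fun x _ => hg x)
  have hgc : Continuous g := ht2.continuous (Frequently.of_forall fun n =>
    (isH2_of_mem hh (hv n)).contDiff.continuous_deriv le_rfl)
  have hder : ∀ x, HasDerivAt w (g x) x := fun x =>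
    hasDerivAt_of_tendstoUniformly ht2 (Eventually.of_forall fun n x => hdv n x) hw x
  have hwc : ContDiff ℝ 1 w := contDiff_one_iff_deriv.2
    ⟨fun x => (hder x).differentiableAt, by
      rw [funext fun x => (hder x).deriv]
      exact hgc⟩
  have hGw : G =ᵐ[volume] w := by
    have h1 : TendstoInMeasure volume (fun n => (F n : ℝ → ℝ)) atTop G :=
      tendstoInMeasure_of_tendsto_Lp hG
    obtain ⟨ns, hns, h2⟩ := h1.exists_seq_tendsto_ae
    have h3 : ∀ᵐ x, ∀ n, F n x = v n x := ae_all_iff.2 hFv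
    filter_upwards [h2, h3] with x h2 h3
    simp only [h3] at h2
    exact tendsto_nhds_unique h2 ((hw x).comp hns.tendsto_atTop)
  exact ⟨w, (mem_femSpace_iff hh).2 ⟨hwc, (memLp_congr_ae hGw).1 (Lp.memLp G),
    isPiecewisePoly_of_tendsto hh (fun n => ((mem_femSpace_iff hh).1 (hv n)).2.2) hw⟩, hGw⟩

end fem

/-! ### The weighted norm and bilinearity of the dispersive form. -/

section weighted

variable {R : ℝ} {φ : ℝ → ℝ}

/-- The `L²` norm with weight `φ`. -/
noncomputable def wnorm (φ v : ℝ → ℝ) : ℝ := √(∫ x, φ x * v x ^ 2)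

theorem wnorm_nonneg (φ v : ℝ → ℝ) : 0 ≤ wnorm φ v := Real.sqrt_nonneg _

theorem IsCutoff.pos (hφ : IsCutoff R φ) (x : ℝ) : 0 < φ x := one_pos.trans_le (hφ.one_le x)

theorem IsCutoff.two_add_nonneg (hφ : IsCutoff R φ) : 0 ≤ 2 + 2 * R :=
  (hφ.pos 0).le.trans (hφ.le 0)

theorem IsCutoff.memLp_mul (hφ : IsCutoff R φ) {v : ℝ → ℝ} (hv : MemLp v 2 volume) :
    MemLp (fun x => φ x * v x) 2 volume :=
  memLp_bdd_mul hv hφ.smooth.continuous.aestronglyMeasurable hφ.abs_apply_le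

theorem IsCutoff.memLp_sqrt_mul (hφ : IsCutoff R φ) {v : ℝ → ℝ} (hv : MemLp v 2 volume) :
    MemLp (fun x => √(φ x) * v x) 2 volume :=
  memLp_bdd_mul (C := √(2 + 2 * R)) hv hφ.smooth.continuous.sqrt.aestronglyMeasurable fun x => by
    rw [abs_of_nonneg (Real.sqrt_nonneg _)]
    exact Real.sqrt_le_sqrt (hφ.le x)

theorem IsCutoff.integrable_mul_mul (hφ : IsCutoff R φ) {f g : ℝ → ℝ} (hf : MemLp f 2 volume)
    (hg : MemLp g 2 volume) : Integrable fun x => f x * (φ x * g x) :=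
  hf.integrable_mul (hφ.memLp_mul hg)

theorem IsCutoff.integrable_mul_sq (hφ : IsCutoff R φ) {f : ℝ → ℝ} (hf : MemLp f 2 volume) :
    Integrable fun x => φ x * f x ^ 2 :=
  (hφ.integrable_mul_mul hf hf).congr (Eventually.of_forall fun x => by simp only; ring)

theorem IsCutoff.integral_mul_sq_nonneg (hφ : IsCutoff R φ) (v : ℝ → ℝ) : 0 ≤ ∫ x, φ x * v x ^ 2 :=
  integral_nonneg fun x => mul_nonneg (hφ.pos x).le (sq_nonneg _)

theorem IsCutoff.wnorm_sq (hφ : IsCutoff R φ) (v : ℝ → ℝ) :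
    wnorm φ v ^ 2 = ∫ x, φ x * v x ^ 2 := Real.sq_sqrt (hφ.integral_mul_sq_nonneg v)

theorem IsCutoff.integral_mul_self (hφ : IsCutoff R φ) (v : ℝ → ℝ) :
    ∫ x, v x * (φ x * v x) = wnorm φ v ^ 2 := by
  rw [hφ.wnorm_sq]
  refine integral_congr_ae (Eventually.of_forall fun x => ?_)
  simp only
  ring

theorem IsCutoff.abs_integral_mul_le (hφ : IsCutoff R φ) {f g : ℝ → ℝ} (hf : MemLp f 2 volume)
    (hg : MemLp g 2 volume) : |∫ x, f x * (φ x * g x)| ≤ wnorm φ f * wnorm φ g := by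
  have h := BenjaminOno.abs_integral_mul_le (hφ.memLp_sqrt_mul hf) (hφ.memLp_sqrt_mul hg)
  simp only [mul_pow, Real.sq_sqrt (hφ.pos _).le] at h
  refine le_trans (le_of_eq ?_) h
  congr 1
  refine integral_congr_ae (Eventually.of_forall fun x => ?_)
  simp only
  rw [show √(φ x) * f x * (√(φ x) * g x) = √(φ x) ^ 2 * (f x * g x) by ring,
    Real.sq_sqrt (hφ.pos x).le]
  ring

theorem wnorm_abs (φ v : ℝ → ℝ) : wnorm φ (fun x => |v x|) = wnorm φ v := by
  simp only [wnorm, sq_abs]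

theorem IsCutoff.integral_abs_mul_le (hφ : IsCutoff R φ) {f g : ℝ → ℝ} (hf : MemLp f 2 volume)
    (hg : MemLp g 2 volume) : ∫ x, |f x| * (φ x * |g x|) ≤ wnorm φ f * wnorm φ g := by
  have := hφ.abs_integral_mul_le (f := fun x => |f x|) (g := fun x => |g x|) hf.abs hg.abs
  rw [wnorm_abs, wnorm_abs] at this
  exact (le_abs_self _).trans this

theorem IsCutoff.wnorm_add_le (hφ : IsCutoff R φ) {f g : ℝ → ℝ} (hf : MemLp f 2 volume)
    (hg : MemLp g 2 volume) : wnorm φ (fun x => f x + g x) ≤ wnorm φ f + wnorm φ g := by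
  refine abs_le_of_sq_le_sq' ?_ (add_nonneg (wnorm_nonneg _ _) (wnorm_nonneg _ _)) |>.2
  have h := (abs_le.1 (hφ.abs_integral_mul_le hf hg)).2
  have e : ∫ x, φ x * (f x + g x) ^ 2 =
      (∫ x, φ x * f x ^ 2) + (∫ x, φ x * g x ^ 2) + 2 * ∫ x, f x * (φ x * g x) := by
    have i1 := hφ.integrable_mul_sq hf
    have i2 := hφ.integrable_mul_sq hg
    have i3 := (hφ.integrable_mul_mul hf hg).const_mul 2
    have i12 : Integrable fun x => φ x * f x ^ 2 + φ x * g x ^ 2 := i1.add i2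
    rw [← integral_const_mul, ← integral_add i1 i2, ← integral_add i12 i3]
    refine integral_congr_ae (Eventually.of_forall fun x => ?_)
    simp only
    ring
  rw [hφ.wnorm_sq, e, ← hφ.wnorm_sq, ← hφ.wnorm_sq]
  nlinarith

theorem wnorm_const_mul (φ : ℝ → ℝ) (c : ℝ) (f : ℝ → ℝ) :
    wnorm φ (fun x => c * f x) = |c| * wnorm φ f := by
  rw [wnorm, wnorm, ← Real.sqrt_sq_eq_abs, ← Real.sqrt_mul (sq_nonneg c), ← integral_const_mul]
  congr 2
  funext x
  ring

theorem IsCutoff.wnorm_sub_le (hφ : IsCutoff R φ) {f g : ℝ → ℝ} (hf : MemLp f 2 volume)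
    (hg : MemLp g 2 volume) : wnorm φ (fun x => f x - g x) ≤ wnorm φ f + wnorm φ g := by
  have := hφ.wnorm_add_le hf (hg.const_mul (-1))
  rw [wnorm_const_mul, abs_neg, abs_one, one_mul] at this
  simpa only [neg_one_mul, ← sub_eq_add_neg] using this

theorem IsCutoff.integral_sq_le (hφ : IsCutoff R φ) {v : ℝ → ℝ} (hv : MemLp v 2 volume) :
    ∫ x, v x ^ 2 ≤ wnorm φ v ^ 2 := by
  rw [hφ.wnorm_sq]
  exact integral_mono hv.integrable_sq (hφ.integrable_mul_sq hv) fun x =>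
    le_mul_of_one_le_left (sq_nonneg _) (hφ.one_le x)

theorem IsCutoff.wnorm_sq_le (hφ : IsCutoff R φ) {v : ℝ → ℝ} (hv : MemLp v 2 volume) :
    wnorm φ v ^ 2 ≤ (2 + 2 * R) * ∫ x, v x ^ 2 := by
  rw [hφ.wnorm_sq, ← integral_const_mul]
  exact integral_mono (hφ.integrable_mul_sq hv) (hv.integrable_sq.const_mul _) fun x =>
    mul_le_mul_of_nonneg_right (hφ.le x) (sq_nonneg _)

theorem IsCutoff.deriv_mul (hφ : IsCutoff R φ) {v : ℝ → ℝ} (hv : IsH2 v) (x : ℝ) :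
    deriv (fun s => φ s * v s) x = deriv φ x * v x + φ x * deriv v x :=
  ((hφ.hasDerivAt x).mul (hv.hasDerivAt x)).deriv

theorem IsCutoff.differentiableAt_mul (hφ : IsCutoff R φ) {v : ℝ → ℝ} (hv : IsH2 v) (x : ℝ) :
    DifferentiableAt ℝ (fun s => φ s * v s) x :=
  ((hφ.hasDerivAt x).mul (hv.hasDerivAt x)).differentiableAt

theorem IsCutoff.memLp_deriv_mul (hφ : IsCutoff R φ) {v : ℝ → ℝ} (hv : IsH2 v) :
    MemLp (deriv fun s => φ s * v s) 2 volume := (hφ.isH1_mul hv).memLp_deriv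

/-- The dispersive term of the scheme. -/
noncomputable def dispersion (φ w v : ℝ → ℝ) : ℝ :=
  ∫ x, lam w x * deriv (fun s => φ s * v s) x

theorem lam_add {f g : ℝ → ℝ} (hf : IsH2 f) (hg : IsH2 g) (x : ℝ) :
    lam (fun x => f x + g x) x = lam f x + lam g x := by
  rw [lam, lam, lam, ← mul_add,
    ← integral_add (integrableOn_secondDiff_div hf x) (integrableOn_secondDiff_div hg x)]
  congr 1
  refine integral_congr_ae (Eventually.of_forall fun y => ?_)
  simp only [secondDiff]
  ring

theorem lam_const_mul (c : ℝ) (f : ℝ → ℝ) (x : ℝ) : lam (fun x => c * f x) x = c * lam f x := by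
  have e : ∀ y, secondDiff (fun x => c * f x) y x / y ^ 2 = c * (secondDiff f y x / y ^ 2) :=
    fun y => by
      simp only [secondDiff]
      ring
  simp only [lam, e]
  rw [integral_const_mul]
  ring

theorem IsCutoff.integrable_lam_mul (hφ : IsCutoff R φ) {f v : ℝ → ℝ} (hf : IsH2 f)
    (hv : IsH2 v) : Integrable fun x => lam f x * deriv (fun s => φ s * v s) x :=
  (memLp_lam hf).integrable_mul (hφ.memLp_deriv_mul hv)

theorem IsCutoff.dispersion_add_left (hφ : IsCutoff R φ) {f g v : ℝ → ℝ} (hf : IsH2 f)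
    (hg : IsH2 g) (hv : IsH2 v) :
    dispersion φ (fun x => f x + g x) v = dispersion φ f v + dispersion φ g v := by
  rw [dispersion, dispersion, dispersion,
    ← integral_add (hφ.integrable_lam_mul hf hv) (hφ.integrable_lam_mul hg hv)]
  refine integral_congr_ae (Eventually.of_forall fun x => ?_)
  simp only [lam_add hf hg]
  ring

theorem dispersion_const_mul_left (φ : ℝ → ℝ) (c : ℝ) (f v : ℝ → ℝ) :
    dispersion φ (fun x => c * f x) v = c * dispersion φ f v := by
  rw [dispersion, dispersion, ← integral_const_mul]
  refine integral_congr_ae (Eventually.of_forall fun x => ?_)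
  simp only [lam_const_mul]
  ring

theorem IsCutoff.dispersion_add_right (hφ : IsCutoff R φ) {f v w : ℝ → ℝ} (hf : IsH2 f)
    (hv : IsH2 v) (hw : IsH2 w) :
    dispersion φ f (fun x => v x + w x) = dispersion φ f v + dispersion φ f w := by
  rw [dispersion, dispersion, dispersion,
    ← integral_add (hφ.integrable_lam_mul hf hv) (hφ.integrable_lam_mul hf hw)]
  refine integral_congr_ae (Eventually.of_forall fun x => ?_)
  have : deriv (fun s => φ s * (v s + w s)) x =
      deriv (fun s => φ s * v s) x + deriv (fun s => φ s * w s) x := by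
    rw [← deriv_fun_add (hφ.differentiableAt_mul hv x) (hφ.differentiableAt_mul hw x)]
    simp only [mul_add]
  simp only [this]
  ring

theorem IsCutoff.dispersion_const_mul_right (hφ : IsCutoff R φ) (c : ℝ) (f : ℝ → ℝ) {v : ℝ → ℝ}
    (hv : IsH2 v) : dispersion φ f (fun x => c * v x) = c * dispersion φ f v := by
  rw [dispersion, dispersion, ← integral_const_mul]
  refine integral_congr_ae (Eventually.of_forall fun x => ?_)
  have : deriv (fun s => φ s * (c * v s)) x = c * deriv (fun s => φ s * v s) x := by
    rw [← deriv_const_mul c (hφ.differentiableAt_mul hv x)]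
    simp only [mul_left_comm]
  simp only [this]
  ring

end weighted

/-! ### Boundedness of the dispersive and quadratic terms on the finite element space. -/

section bounds

variable {R : ℝ} {φ : ℝ → ℝ} {r : ℕ} {h C₁ C₂ : ℝ}

/-- The constant may depend on the mesh size. It is used only for continuity, in Lax–Milgram and in
passing to the limit of the iterates, never in the stability estimate. -/
theorem IsCutoff.exists_dispersion_le (hφ : IsCutoff R φ) (r : ℕ) (hh : 0 < h) :
    ∃ B : ℝ, 0 ≤ B ∧ ∀ w ∈ femSpace r h, ∀ v ∈ femSpace r h,
      |dispersion φ w v| ≤ B * (√(∫ x, w x ^ 2) * √(∫ x, v x ^ 2)) := by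
  obtain ⟨A, hA, hAle⟩ := exists_integral_deriv_sq_le r hh
  obtain ⟨D, hD, hDle⟩ := exists_integral_sq_lam_le
  set Q := 2 * 1 + 2 * (2 + 2 * R) ^ 2 * A with hQ
  have hQ0 : 0 ≤ Q := by positivity
  refine ⟨√(D * (1 + A)) * √Q, by positivity, fun w hw v hv => ?_⟩
  have hw2 := isH2_of_mem hh hw
  have hv2 := isH2_of_mem hh hv
  have hw0 : 0 ≤ ∫ x, w x ^ 2 := integral_nonneg fun x => sq_nonneg _
  have hv0 : 0 ≤ ∫ x, v x ^ 2 := integral_nonneg fun x => sq_nonneg _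
  have h1 : ∫ x, lam w x ^ 2 ≤ D * (1 + A) * ∫ x, w x ^ 2 := by
    refine (hDle w hw2).trans ?_
    rw [mul_assoc]
    refine mul_le_mul_of_nonneg_left ?_ hD
    linarith [(hAle w hw).2]
  have h2 : ∫ x, deriv (fun s => φ s * v s) x ^ 2 ≤ Q * ∫ x, v x ^ 2 := by
    calc ∫ x, deriv (fun s => φ s * v s) x ^ 2
        ≤ ∫ x, (2 * v x ^ 2 + 2 * (2 + 2 * R) ^ 2 * deriv v x ^ 2) := by
          refine integral_mono (hφ.memLp_deriv_mul hv2).integrable_sq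
            ((hv2.h1.memLp.integrable_sq.const_mul _).add
              (hv2.h1.memLp_deriv.integrable_sq.const_mul _)) fun x => ?_
          simp only
          rw [hφ.deriv_mul hv2]
          have a1 : (deriv φ x * v x) ^ 2 ≤ v x ^ 2 := by
            rw [mul_pow]
            exact mul_le_of_le_one_left (sq_nonneg _)
              (pow_le_one₀ (hφ.deriv_nonneg x) (hφ.deriv_le_one x))
          have a2 : (φ x * deriv v x) ^ 2 ≤ (2 + 2 * R) ^ 2 * deriv v x ^ 2 := by
            rw [mul_pow]
            exact mul_le_mul_of_nonneg_right (pow_le_pow_left₀ (hφ.pos x).le (hφ.le x) 2)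
              (sq_nonneg _)
          nlinarith [sq_nonneg (deriv φ x * v x - φ x * deriv v x)]
      _ = 2 * (∫ x, v x ^ 2) + 2 * (2 + 2 * R) ^ 2 * ∫ x, deriv v x ^ 2 := by
          rw [integral_add (hv2.h1.memLp.integrable_sq.const_mul _)
            (hv2.h1.memLp_deriv.integrable_sq.const_mul _), integral_const_mul, integral_const_mul]
      _ ≤ 2 * (∫ x, v x ^ 2) + 2 * (2 + 2 * R) ^ 2 * (A * ∫ x, v x ^ 2) := by
          have := (hAle v hv).1
          gcongr
      _ = _ := by rw [hQ]; ring
  calc |dispersion φ w v| ≤ √(∫ x, lam w x ^ 2) * √(∫ x, deriv (fun s => φ s * v s) x ^ 2) :=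
        BenjaminOno.abs_integral_mul_le (memLp_lam hw2) (hφ.memLp_deriv_mul hv2)
    _ ≤ √(D * (1 + A) * ∫ x, w x ^ 2) * √(Q * ∫ x, v x ^ 2) := by gcongr
    _ = _ := by
        rw [Real.sqrt_mul (by positivity), Real.sqrt_mul hQ0]
        ring

/-- Since `φ' ≤ 1 ≤ φ`, one factor `φ` can be pulled out of both terms of `(φ v)'`. A product of two
functions integrated against `(φ v)'` is then controlled by weighted norms with no power of `R`
lost. -/
theorem IsCutoff.abs_deriv_mul_le (hφ : IsCutoff R φ) (hC : IsInverseConstants r C₁ C₂)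
    (hh : 0 < h) {v : ℝ → ℝ} (hv : v ∈ femSpace r h) (x : ℝ) :
    |deriv (fun s => φ s * v s) x| ≤ φ x * ((√(C₁ / h) + √(C₂ / h ^ 3)) * wnorm φ v) := by
  have hv2 := isH2_of_mem hh hv
  have hC1 := hC.pos₁
  have hC2 := hC.pos₂
  have h0 := hφ.integral_sq_le hv2.h1.memLp
  have hw := wnorm_nonneg φ v
  have h1 : |v x| ≤ √(C₁ / h) * wnorm φ v := by
    refine abs_le_of_sq_le_sq ((hC.sq_le hh hv x).trans ?_) (by positivity)
    rw [mul_pow, Real.sq_sqrt (by positivity)]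
    gcongr
  have h2 : |deriv v x| ≤ √(C₂ / h ^ 3) * wnorm φ v := by
    refine abs_le_of_sq_le_sq ((hC.deriv_sq_le hh hv x).trans ?_) (by positivity)
    rw [mul_pow, Real.sq_sqrt (by positivity)]
    gcongr
  rw [hφ.deriv_mul hv2]
  calc |deriv φ x * v x + φ x * deriv v x| ≤ |deriv φ x * v x| + |φ x * deriv v x| := abs_add_le _ _
    _ = deriv φ x * |v x| + φ x * |deriv v x| := by
        rw [abs_mul, abs_mul, abs_of_nonneg (hφ.deriv_nonneg x), abs_of_pos (hφ.pos x)]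
    _ ≤ φ x * (√(C₁ / h) * wnorm φ v) + φ x * (√(C₂ / h ^ 3) * wnorm φ v) := by
        have h3 : deriv φ x ≤ φ x := (hφ.deriv_le_one x).trans (hφ.one_le x)
        have h4 := (hφ.pos x).le
        gcongr
    _ = _ := by ring

theorem IsCutoff.integrable_mul_deriv_mul (hφ : IsCutoff R φ) (hC : IsInverseConstants r C₁ C₂)
    (hh : 0 < h) {v : ℝ → ℝ} (hv : v ∈ femSpace r h) {f g : ℝ → ℝ} (hf : MemLp f 2 volume)
    (hg : MemLp g 2 volume) : Integrable fun x => f x * g x * deriv (fun s => φ s * v s) x := by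
  refine ((hφ.integrable_mul_mul hf.abs hg.abs).const_mul
    ((√(C₁ / h) + √(C₂ / h ^ 3)) * wnorm φ v)).mono'
    ((hf.1.mul hg.1).mul (hφ.memLp_deriv_mul (isH2_of_mem hh hv)).1)
    (Eventually.of_forall fun x => ?_)
  rw [norm_mul, norm_mul, Real.norm_eq_abs, Real.norm_eq_abs, Real.norm_eq_abs]
  have := mul_le_mul_of_nonneg_left (hφ.abs_deriv_mul_le hC hh hv x)
    (mul_nonneg (abs_nonneg (f x)) (abs_nonneg (g x)))
  simp only [Pi.abs_apply]
  linarith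

theorem IsCutoff.abs_integral_mul_deriv_mul_le (hφ : IsCutoff R φ)
    (hC : IsInverseConstants r C₁ C₂) (hh : 0 < h) {v : ℝ → ℝ} (hv : v ∈ femSpace r h)
    {f g : ℝ → ℝ} (hf : MemLp f 2 volume) (hg : MemLp g 2 volume) :
    |∫ x, f x * g x * deriv (fun s => φ s * v s) x| ≤
      (√(C₁ / h) + √(C₂ / h ^ 3)) * wnorm φ v * (wnorm φ f * wnorm φ g) := by
  refine (abs_integral_le_integral_abs).trans ?_
  calc ∫ x, |f x * g x * deriv (fun s => φ s * v s) x|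
      ≤ ∫ x, (√(C₁ / h) + √(C₂ / h ^ 3)) * wnorm φ v * (|f x| * (φ x * |g x|)) := by
        refine integral_mono (hφ.integrable_mul_deriv_mul hC hh hv hf hg).abs
          ((hφ.integrable_mul_mul hf.abs hg.abs).const_mul _) fun x => ?_
        have := mul_le_mul_of_nonneg_left (hφ.abs_deriv_mul_le hC hh hv x)
          (mul_nonneg (abs_nonneg (f x)) (abs_nonneg (g x)))
        simp only [abs_mul]
        linarith
    _ ≤ _ := by
        rw [integral_const_mul]
        exact mul_le_mul_of_nonneg_left (hφ.integral_abs_mul_le hf hg)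
          (mul_nonneg (by positivity) (wnorm_nonneg _ _))

end bounds

/-! ### The fixed-point iteration: contraction and uniform bounds. -/

section iteration

variable {R : ℝ} {φ : ℝ → ℝ} {r : ℕ} {h C₁ C₂ D Δt : ℝ} {u w w' w'' : ℝ → ℝ}

theorem memLp_of_mem (hh : 0 < h) (hw : w ∈ femSpace r h) : MemLp w 2 volume :=
  (isH2_of_mem hh hw).h1.memLp

theorem dispersion_midpoint (hφ : IsCutoff R φ) (hh : 0 < h) (hw : w ∈ femSpace r h)
    (hu : u ∈ femSpace r h) {v : ℝ → ℝ} (hv : v ∈ femSpace r h) :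
    dispersion φ (midpoint w u) v = (dispersion φ w v + dispersion φ u v) / 2 := by
  have e : midpoint w u = fun x => 1 / 2 * (w x + u x) := by
    funext x
    simp only [midpoint]
    ring
  rw [e, dispersion_const_mul_left, hφ.dispersion_add_left (isH2_of_mem hh hw)
    (isH2_of_mem hh hu) (isH2_of_mem hh hv)]
  ring

theorem dispersion_sub_left (hφ : IsCutoff R φ) (hh : 0 < h) (hw : w ∈ femSpace r h)
    (hu : u ∈ femSpace r h) {v : ℝ → ℝ} (hv : v ∈ femSpace r h) :
    dispersion φ (fun x => w x - u x) v = dispersion φ w v - dispersion φ u v := by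
  have := hφ.dispersion_add_left (isH2_of_mem hh (sub_mem_femSpace hh hw hu))
    (isH2_of_mem hh hu) (isH2_of_mem hh hv)
  simp only [sub_add_cancel] at this
  linarith

theorem iterationEquation_iff (hφ : IsCutoff R φ) (hh : 0 < h) (hw' : w' ∈ femSpace r h)
    (hu : u ∈ femSpace r h) : IterationEquation r φ h Δt u w w' ↔ ∀ v ∈ femSpace r h,
      (∫ x, w' x * (φ x * v x)) + Δt / 2 * dispersion φ w' v =
        (∫ x, u x * (φ x * v x)) - Δt / 2 * dispersion φ u v +
          Δt / 2 * ∫ x, midpoint w u x ^ 2 * deriv (fun s => φ s * v s) x := by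
  rw [IterationEquation, hilbert_deriv (isH2_of_mem hh (midpoint_mem_femSpace hh hw' hu))]
  refine forall₂_congr fun v hv => ?_
  have := dispersion_midpoint hφ hh hw' hu hv
  rw [dispersion] at this
  rw [this]
  constructor <;> intro h <;> linarith

theorem cnEquation_iff (hh : 0 < h) (hw' : w' ∈ femSpace r h)
    (hu : u ∈ femSpace r h) : CNEquation r φ h Δt u w' ↔ ∀ v ∈ femSpace r h,
      (∫ x, w' x * (φ x * v x)) + Δt * dispersion φ (midpoint u w') v =
        (∫ x, u x * (φ x * v x)) +
          Δt * ∫ x, midpoint u w' x ^ 2 / 2 * deriv (fun s => φ s * v s) x := by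
  rw [CNEquation, hilbert_deriv (isH2_of_mem hh (midpoint_mem_femSpace hh hu hw'))]
  refine forall₂_congr fun v hv => ?_
  rw [dispersion]
  constructor <;> intro h <;> linarith

theorem IsCutoff.integral_sub_mul (hφ : IsCutoff R φ) {f g v : ℝ → ℝ} (hf : MemLp f 2 volume)
    (hg : MemLp g 2 volume) (hv : MemLp v 2 volume) :
    ∫ x, (f x - g x) * (φ x * v x) = (∫ x, f x * (φ x * v x)) - ∫ x, g x * (φ x * v x) := by
  rw [← integral_sub (hφ.integrable_mul_mul hf hv) (hφ.integrable_mul_mul hg hv)]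
  simp only [sub_mul]

theorem midpoint_sq_eq (w u : ℝ → ℝ) (x : ℝ) :
    midpoint w u x ^ 2 = midpoint w u x * midpoint w u x := sq _

/-- The equation satisfied by the difference of two consecutive iterates. -/
theorem iteration_difference (hφ : IsCutoff R φ) (hC : IsInverseConstants r C₁ C₂) (hh : 0 < h)
    (hu : u ∈ femSpace r h) (hw : w ∈ femSpace r h) (hw' : w' ∈ femSpace r h)
    (hw'' : w'' ∈ femSpace r h) (h1 : IterationEquation r φ h Δt u w w')
    (h2 : IterationEquation r φ h Δt u w' w'') {v : ℝ → ℝ} (hv : v ∈ femSpace r h) :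
    (∫ x, (w'' x - w' x) * (φ x * v x)) + Δt / 2 * dispersion φ (fun x => w'' x - w' x) v =
      Δt / 8 * ∫ x, (w' x - w x) * (w' x + w x + 2 * u x) * deriv (fun s => φ s * v s) x := by
  have e1 := (iterationEquation_iff hφ hh hw' hu).1 h1 v hv
  have e2 := (iterationEquation_iff hφ hh hw'' hu).1 h2 v hv
  have m1 := memLp_of_mem hh (midpoint_mem_femSpace hh hw hu)
  have m2 := memLp_of_mem hh (midpoint_mem_femSpace hh hw' hu)
  have e3 : ∫ x, (w' x - w x) * (w' x + w x + 2 * u x) * deriv (fun s => φ s * v s) x =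
      4 * ((∫ x, midpoint w' u x ^ 2 * deriv (fun s => φ s * v s) x) -
        ∫ x, midpoint w u x ^ 2 * deriv (fun s => φ s * v s) x) := by
    simp only [midpoint_sq_eq]
    rw [← integral_sub (hφ.integrable_mul_deriv_mul hC hh hv m2 m2)
      (hφ.integrable_mul_deriv_mul hC hh hv m1 m1), ← integral_const_mul]
    refine integral_congr_ae (Eventually.of_forall fun x => ?_)
    simp only [midpoint]
    ring
  rw [hφ.integral_sub_mul (memLp_of_mem hh hw'') (memLp_of_mem hh hw') (memLp_of_mem hh hv),
    dispersion_sub_left hφ hh hw'' hw' hv, e3]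
  linarith

theorem le_of_sq_mul_le {x a b : ℝ} (hx : 0 ≤ x) (hb : 0 ≤ b) (h : x ^ 2 * a ≤ b * x) :
    x * a ≤ b := by
  rcases hx.eq_or_lt with rfl | hx
  · simpa using hb
  · refine le_of_mul_le_mul_left ?_ hx
    linarith

theorem dispersion_ge (hφ : IsCutoff R φ) (hD0 : 0 ≤ D)
    (hD : ∀ w, IsH2 w → -(D * ∫ x, w x ^ 2) ≤ dispersion φ w w) (hw : IsH2 w) :
    -(D * wnorm φ w ^ 2) ≤ dispersion φ w w :=
  (neg_le_neg (mul_le_mul_of_nonneg_left (hφ.integral_sq_le hw.h1.memLp) hD0)).trans (hD w hw)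

/-- Test the difference equation with the new difference `w'' - w'`. The dispersive form is
nonnegative up to `D`, and the difference of squares factors as `(w' - w)(w' + w + 2u)/4`. -/
theorem iteration_contraction (hφ : IsCutoff R φ) (hC : IsInverseConstants r C₁ C₂) (hh : 0 < h)
    (hD0 : 0 ≤ D) (hD : ∀ w, IsH2 w → -(D * ∫ x, w x ^ 2) ≤ dispersion φ w w) (hΔt : 0 ≤ Δt)
    (hu : u ∈ femSpace r h) (hw : w ∈ femSpace r h) (hw' : w' ∈ femSpace r h)
    (hw'' : w'' ∈ femSpace r h) (h1 : IterationEquation r φ h Δt u w w')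
    (h2 : IterationEquation r φ h Δt u w' w'') :
    wnorm φ (fun x => w'' x - w' x) * (1 - D * Δt / 2) ≤
      Δt / 8 * (√(C₁ / h) + √(C₂ / h ^ 3)) * wnorm φ (fun x => w' x - w x) *
        (wnorm φ w' + wnorm φ w + 2 * wnorm φ u) := by
  have hd := sub_mem_femSpace hh hw'' hw'
  have he := sub_mem_femSpace hh hw' hw
  have mu := memLp_of_mem hh hu
  have mw := memLp_of_mem hh hw
  have mw' := memLp_of_mem hh hw'
  have eq := iteration_difference hφ hC hh hu hw hw' hw'' h1 h2 hd
  rw [hφ.integral_mul_self fun x => w'' x - w' x] at eq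
  have c1 := dispersion_ge hφ hD0 hD (isH2_of_mem hh hd)
  have hs : MemLp (fun x => w' x + w x + 2 * u x) 2 volume := (mw'.add mw).add (mu.const_mul 2)
  have c2 := (abs_le.1 (hφ.abs_integral_mul_deriv_mul_le hC hh hd (memLp_of_mem hh he) hs)).2
  have c3 : wnorm φ (fun x => w' x + w x + 2 * u x) ≤ wnorm φ w' + wnorm φ w + 2 * wnorm φ u := by
    have a1 := hφ.wnorm_add_le (f := fun x => w' x + w x) (mw'.add mw) (mu.const_mul 2)
    have a2 := hφ.wnorm_add_le mw' mw
    rw [wnorm_const_mul, abs_two] at a1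
    linarith
  set N := wnorm φ fun x => w'' x - w' x
  set E := wnorm φ fun x => w' x - w x
  set S := wnorm φ fun x => w' x + w x + 2 * u x
  have hN : 0 ≤ N := wnorm_nonneg _ _
  have hE : 0 ≤ E := wnorm_nonneg _ _
  have hS : 0 ≤ S := wnorm_nonneg _ _
  have hb : 0 ≤ √(C₁ / h) + √(C₂ / h ^ 3) := by positivity
  refine (le_of_sq_mul_le (b := Δt / 8 * (√(C₁ / h) + √(C₂ / h ^ 3)) * E * S) hN
    (by positivity) ?_).trans (by gcongr)
  have c4 := mul_le_mul_of_nonneg_left c2 (by positivity : 0 ≤ Δt / 8)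
  have c5 := mul_le_mul_of_nonneg_left c1 (by positivity : 0 ≤ Δt / 2)
  linarith

/-- The first iterate. -/
theorem iteration_first (hφ : IsCutoff R φ) (hC : IsInverseConstants r C₁ C₂) (hh : 0 < h)
    (hD0 : 0 ≤ D) (hD : ∀ w, IsH2 w → -(D * ∫ x, w x ^ 2) ≤ dispersion φ w w) (hΔt : 0 ≤ Δt)
    (hu : u ∈ femSpace r h) (hw' : w' ∈ femSpace r h) (h1 : IterationEquation r φ h Δt u u w') :
    wnorm φ w' * (1 - D * Δt / 2) ≤
      (1 + D * Δt / 2 + Δt / 2 * (√(C₁ / h) + √(C₂ / h ^ 3)) * wnorm φ u) * wnorm φ u := by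
  -- The test function `w' + u` makes the time difference a difference of squared norms and turns
  -- the dispersive term into the form evaluated at `w' + u`.
  have hs := add_mem_femSpace hh hw' hu
  have mu := memLp_of_mem hh hu
  have mw' := memLp_of_mem hh hw'
  have eq := (iterationEquation_iff hφ hh hw' hu).1 h1 _ hs
  have hmid : midpoint u u = u := by
    funext x
    simp [midpoint]
  rw [hmid] at eq
  simp only [sq (u _)] at eq
  have d1 := hφ.dispersion_add_left (isH2_of_mem hh hw') (isH2_of_mem hh hu) (isH2_of_mem hh hs)
  have c1 := dispersion_ge hφ hD0 hD (isH2_of_mem hh hs)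
  have c2 := (abs_le.1 (hφ.abs_integral_mul_deriv_mul_le hC hh hs mu mu)).2
  have c3 := hφ.wnorm_add_le mw' mu
  have ex : (∫ x, w' x * (φ x * (w' x + u x))) - ∫ x, u x * (φ x * (w' x + u x)) =
      wnorm φ w' ^ 2 - wnorm φ u ^ 2 := by
    rw [← hφ.integral_sub_mul (v := fun x => w' x + u x) mw' mu (mw'.add mu), hφ.wnorm_sq, hφ.wnorm_sq,
      ← integral_sub (hφ.integrable_mul_sq mw') (hφ.integrable_mul_sq mu)]
    refine integral_congr_ae (Eventually.of_forall fun x => ?_)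
    ring
  set X := wnorm φ w'
  set U := wnorm φ u
  set S := wnorm φ fun x => w' x + u x
  set β := √(C₁ / h) + √(C₂ / h ^ 3)
  have hX : 0 ≤ X := wnorm_nonneg _ _
  have hU : 0 ≤ U := wnorm_nonneg _ _
  have hS : 0 ≤ S := wnorm_nonneg _ _
  have hb : 0 ≤ β := by positivity
  have c4 := mul_le_mul_of_nonneg_left c2 (by positivity : 0 ≤ Δt / 2)
  have c5 := mul_le_mul_of_nonneg_left c1 (by positivity : 0 ≤ Δt / 2)
  have c6 : S ^ 2 ≤ (X + U) ^ 2 := pow_le_pow_left₀ hS c3 2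
  have c7 : Δt / 2 * (D * S ^ 2) ≤ Δt / 2 * (D * (X + U) ^ 2) := by gcongr
  have c8 : Δt / 2 * (β * S * (U * U)) ≤ Δt / 2 * (β * (X + U) * (U * U)) := by gcongr
  have main : (X + U) * (X - U) ≤ (X + U) * (D * Δt / 2 * (X + U) + Δt / 2 * β * U * U) := by
    nlinarith
  rcases (add_nonneg hX hU).eq_or_lt with h0 | h0
  · have : X = 0 := by linarith
    have h2 : U = 0 := by linarith
    rw [this, h2]
    simp
  · have := le_of_mul_le_mul_left main h0
    nlinarith

/-- The increments decay like `3U L^l`, so the iterates stay below `U + 3U/(1-L) = (4-L)/(1-L) · U ≤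
K U`. The size bound and the contraction factor depend on each other and are proved in one
induction. -/
theorem wnorm_iterate_le (hφ : IsCutoff R φ) (hC : IsInverseConstants r C₁ C₂) (hh : 0 < h)
    (hD0 : 0 ≤ D) (hD : ∀ w, IsH2 w → -(D * ∫ x, w x ^ 2) ≤ dispersion φ w w) (hΔt : 0 ≤ Δt)
    {L K : ℝ} (hL0 : 0 < L) (hL1 : L < 1) (hK : K = (7 - L) / (1 - L)) (hδ : D * Δt / 2 ≤ 1 / 10)
    (hu : u ∈ femSpace r h)
    (hκ : Δt * (√(C₁ / h) + √(C₂ / h ^ 3)) * wnorm φ u ≤ L / K) {w : ℕ → ℝ → ℝ}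
    (h0 : w 0 = u) (hw : ∀ l, w l ∈ femSpace r h)
    (heq : ∀ l, IterationEquation r φ h Δt u (w l) (w (l + 1))) (l : ℕ) :
    wnorm φ (w l) ≤ K * wnorm φ u ∧
      wnorm φ (fun x => w (l + 1) x - w l x) ≤ 3 * wnorm φ u * L ^ l := by
  set U := wnorm φ u with hUdef
  set β := √(C₁ / h) + √(C₂ / h ^ 3) with hβ
  have hU : 0 ≤ U := wnorm_nonneg _ _
  have hL' : 0 < 1 - L := by linarith
  have hK7 : 7 ≤ K := by
    rw [hK, le_div_iff₀ hL']
    linarith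
  have hKL : K * (1 - L) = 7 - L := by rw [hK]; field_simp
  have hLK : L / K ≤ 1 / 7 := by
    rw [div_le_div_iff₀ (by linarith) (by norm_num)]
    linarith
  have hKκ : Δt * β * U * K ≤ L := by
    have := (le_div_iff₀ (by linarith)).1 hκ
    linarith
  have hb : 0 ≤ Δt * β := by positivity
  have mem := fun l => memLp_of_mem hh (hw l)
  have hnext : ∀ l, wnorm φ (w (l + 1)) ≤
      wnorm φ (w l) + wnorm φ (fun x => w (l + 1) x - w l x) := fun l => by
    have := hφ.wnorm_add_le (g := fun x => w (l + 1) x - w l x) (mem l)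
      ((mem (l + 1)).sub (mem l))
    simp only [add_sub_cancel] at this
    exact this
  have hKof : ∀ l, wnorm φ (w l) * (1 - L) ≤ (4 - L) * U - 3 * U * L ^ l →
      wnorm φ (w l) ≤ K * U := by
    intro l hl
    have : 0 ≤ 3 * U * L ^ l := by positivity
    refine le_of_mul_le_mul_right ?_ hL'
    nlinarith
  -- The first inequality is `‖w l‖ ≤ U + 3U (1 + L + ⋯ + L^{l-1})`, multiplied by `1 - L`.
  have main : ∀ l, wnorm φ (w l) * (1 - L) ≤ (4 - L) * U - 3 * U * L ^ l ∧
      wnorm φ (fun x => w (l + 1) x - w l x) ≤ 3 * U * L ^ l := by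
    intro l
    induction l with
    | zero =>
      rw [pow_zero, h0]
      refine ⟨by rw [← hUdef]; linarith, ?_⟩
      have h1 := heq 0
      rw [h0] at h1
      have h2 := iteration_first hφ hC hh hD0 hD hΔt hu (hw 1) h1
      have h3 := hφ.wnorm_sub_le (mem 1) (memLp_of_mem hh hu)
      rw [← hUdef, ← hβ] at h2
      rw [← hUdef] at h3
      have hX : 0 ≤ wnorm φ (w 1) := wnorm_nonneg _ _
      have h5 : Δt / 2 * β * U ≤ 1 / 14 := by linarith
      have h6 : wnorm φ (w 1) * (9 / 10) ≤ wnorm φ (w 1) * (1 - D * Δt / 2) :=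
        mul_le_mul_of_nonneg_left (by linarith) hX
      have h7 : (1 + D * Δt / 2 + Δt / 2 * β * U) * U ≤ (1 + 1 / 10 + 1 / 14) * U :=
        mul_le_mul_of_nonneg_right (by linarith) hU
      have h8 : wnorm φ (w 1) ≤ 2 * U := by linarith
      simp only [zero_add]
      linarith
    | succ l ih =>
      obtain ⟨ih1, ih2⟩ := ih
      have hstep : wnorm φ (w (l + 1)) * (1 - L) ≤ (4 - L) * U - 3 * U * L ^ (l + 1) := by
        have := mul_le_mul_of_nonneg_right ((hnext l).trans (add_le_add_right ih2 _)) hL'.le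
        rw [pow_succ]
        nlinarith
      refine ⟨hstep, ?_⟩
      have h2 := iteration_contraction hφ hC hh hD0 hD hΔt hu (hw l) (hw (l + 1)) (hw (l + 2))
        (heq l) (heq (l + 1))
      rw [← hUdef, ← hβ] at h2
      set d := wnorm φ fun x => w (l + 2) x - w (l + 1) x
      set e := wnorm φ fun x => w (l + 1) x - w l x
      have hd0 : 0 ≤ d := wnorm_nonneg _ _
      have he0 : 0 ≤ e := wnorm_nonneg _ _
      have k1 := hKof l ih1
      have k2 := hKof (l + 1) hstep
      have h3 : d * (9 / 10) ≤ d * (1 - D * Δt / 2) := mul_le_mul_of_nonneg_left (by linarith) hd0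
      have h4 : Δt / 8 * β * e * (wnorm φ (w (l + 1)) + wnorm φ (w l) + 2 * U) ≤
          Δt / 8 * β * e * (K * U + K * U + 2 * U) := by gcongr
      -- As `Δt β K U ≤ L` and `Δt β U ≤ L`, the left side is at most `e L / 2`. The room up to
      -- `9/10` pays for the lower bound `1 - D Δt / 2 ≥ 9/10` on the other side.
      have h5 : Δt / 8 * β * e * (K * U + K * U + 2 * U) ≤ e * (L * (9 / 10)) := by
        have : Δt * β * U ≤ L := by
          have : 0 ≤ Δt * β * U := by positivity
          nlinarith
        have h6 : Δt / 8 * β * (K * U + K * U + 2 * U) ≤ L * (9 / 10) := by linarith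
        have := mul_le_mul_of_nonneg_left h6 he0
        linarith
      have h6 : d ≤ e * L := by linarith
      calc d ≤ e * L := h6
        _ ≤ 3 * U * L ^ l * L := mul_le_mul_of_nonneg_right ih2 hL0.le
        _ = _ := by ring
  exact ⟨hKof l (main l).1, (main l).2⟩

end iteration

/-! ### Solvability of one linear iteration by Lax–Milgram. -/

section existence

variable {R : ℝ} {φ : ℝ → ℝ} {r : ℕ} {h C₁ C₂ D Δt : ℝ} {u w : ℝ → ℝ}

theorem eq_of_ae_eq_of_mem (hh : 0 < h) {v : ℝ → ℝ} (hv : v ∈ femSpace r h)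
    (hw : w ∈ femSpace r h) (he : v =ᵐ[volume] w) : v = w :=
  (Continuous.ae_eq_iff_eq volume (isH2_of_mem hh hv).contDiff.continuous
    (isH2_of_mem hh hw).contDiff.continuous).1 he

theorem exists_rep (hh : 0 < h) (F : femSubmodule r hh) :
    ∃ v ∈ femSpace r h, (F : Lp ℝ 2 (volume : Measure ℝ)) =ᵐ[volume] v := F.2

/-- The continuous representative of an element of `S_{Δx} ⊂ L²(ℝ)`. -/
noncomputable def rep (hh : 0 < h) (F : femSubmodule r hh) : ℝ → ℝ := (exists_rep hh F).choose

theorem rep_mem (hh : 0 < h) (F : femSubmodule r hh) : rep hh F ∈ femSpace r h :=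
  (exists_rep hh F).choose_spec.1

theorem coe_ae_eq_rep (hh : 0 < h) (F : femSubmodule r hh) :
    (F : Lp ℝ 2 (volume : Measure ℝ)) =ᵐ[volume] rep hh F := (exists_rep hh F).choose_spec.2

theorem rep_add (hh : 0 < h) (F G : femSubmodule r hh) :
    rep hh (F + G) = fun x => rep hh F x + rep hh G x := by
  refine eq_of_ae_eq_of_mem hh (rep_mem hh _)
    (add_mem_femSpace hh (rep_mem hh F) (rep_mem hh G)) ?_
  filter_upwards [coe_ae_eq_rep hh F, coe_ae_eq_rep hh G, coe_ae_eq_rep hh (F + G),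
    Lp.coeFn_add (F : Lp ℝ 2 (volume : Measure ℝ)) G] with x h1 h2 h3 h4
  rw [← h3, Submodule.coe_add, h4, Pi.add_apply, h1, h2]

theorem rep_smul (hh : 0 < h) (c : ℝ) (F : femSubmodule r hh) :
    rep hh (c • F) = fun x => c * rep hh F x := by
  refine eq_of_ae_eq_of_mem hh (rep_mem hh _) (const_mul_mem_femSpace hh c (rep_mem hh F)) ?_
  filter_upwards [coe_ae_eq_rep hh F, coe_ae_eq_rep hh (c • F),
    Lp.coeFn_smul c (F : Lp ℝ 2 (volume : Measure ℝ))] with x h1 h2 h3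
  rw [← h2, Submodule.coe_smul, h3, Pi.smul_apply, h1, smul_eq_mul]

theorem norm_eq_sqrt_rep (hh : 0 < h) (F : femSubmodule r hh) :
    ‖F‖ = √(∫ x, rep hh F x ^ 2) := by
  rw [← norm_sq_eq_integral (coe_ae_eq_rep hh F), Submodule.coe_norm, Real.sqrt_sq (norm_nonneg _)]

theorem exists_rep_eq (hh : 0 < h) {v : ℝ → ℝ} (hv : v ∈ femSpace r h) :
    ∃ F : femSubmodule r hh, rep hh F = v := by
  have hm := memLp_of_mem hh hv
  refine ⟨⟨hm.toLp v, v, hv, hm.coeFn_toLp⟩, ?_⟩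
  exact eq_of_ae_eq_of_mem hh (rep_mem hh _) hv
    ((coe_ae_eq_rep hh _).symm.trans hm.coeFn_toLp)

theorem completeSpace_femSubmodule (r : ℕ) (hh : 0 < h) : CompleteSpace (femSubmodule r hh) :=
  (isClosed_femSubmodule r hh).isComplete.completeSpace_coe

theorem IsCutoff.wnorm_le (hφ : IsCutoff R φ) {v : ℝ → ℝ} (hv : MemLp v 2 volume) :
    wnorm φ v ≤ √(2 + 2 * R) * √(∫ x, v x ^ 2) := by
  rw [← Real.sqrt_mul hφ.two_add_nonneg]
  exact Real.le_sqrt_of_sq_le (hφ.wnorm_sq_le hv)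

/-- The bilinear form of the linear iteration. -/
noncomputable def stepForm (φ : ℝ → ℝ) (Δt : ℝ) (w v : ℝ → ℝ) : ℝ :=
  (∫ x, w x * (φ x * v x)) + Δt / 2 * dispersion φ w v

theorem stepForm_add_left (hφ : IsCutoff R φ) (hh : 0 < h) {f g v : ℝ → ℝ} (hf : f ∈ femSpace r h)
    (hg : g ∈ femSpace r h) (hv : v ∈ femSpace r h) :
    stepForm φ Δt (fun x => f x + g x) v = stepForm φ Δt f v + stepForm φ Δt g v := by
  have hvm := memLp_of_mem hh hv
  rw [stepForm, stepForm, stepForm, hφ.dispersion_add_left (isH2_of_mem hh hf)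
    (isH2_of_mem hh hg) (isH2_of_mem hh hv)]
  simp only [add_mul]
  rw [integral_add (hφ.integrable_mul_mul (memLp_of_mem hh hf) hvm)
    (hφ.integrable_mul_mul (memLp_of_mem hh hg) hvm)]
  ring

theorem stepForm_add_right (hφ : IsCutoff R φ) (hh : 0 < h) {f g v : ℝ → ℝ}
    (hf : f ∈ femSpace r h) (hg : g ∈ femSpace r h) (hv : v ∈ femSpace r h) :
    stepForm φ Δt v (fun x => f x + g x) = stepForm φ Δt v f + stepForm φ Δt v g := by
  have hvm := memLp_of_mem hh hv
  rw [stepForm, stepForm, stepForm, hφ.dispersion_add_right (isH2_of_mem hh hv)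
    (isH2_of_mem hh hf) (isH2_of_mem hh hg)]
  simp only [mul_add]
  rw [integral_add (hφ.integrable_mul_mul hvm (memLp_of_mem hh hf))
    (hφ.integrable_mul_mul hvm (memLp_of_mem hh hg))]
  ring

theorem stepForm_const_mul_left (φ : ℝ → ℝ) (Δt c : ℝ) (f v : ℝ → ℝ) :
    stepForm φ Δt (fun x => c * f x) v = c * stepForm φ Δt f v := by
  rw [stepForm, stepForm, dispersion_const_mul_left]
  simp only [mul_assoc]
  rw [integral_const_mul]
  ring

theorem stepForm_const_mul_right (hφ : IsCutoff R φ) (hh : 0 < h) (c : ℝ) (v : ℝ → ℝ) {f : ℝ → ℝ}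
    (hf : f ∈ femSpace r h) : stepForm φ Δt v (fun x => c * f x) = c * stepForm φ Δt v f := by
  rw [stepForm, stepForm, hφ.dispersion_const_mul_right c v (isH2_of_mem hh hf), mul_add,
    ← integral_const_mul]
  congr 1
  · refine integral_congr_ae (Eventually.of_forall fun x => ?_)
    simp only
    ring
  · ring

/-- Lax–Milgram on the closed subspace `femSubmodule` of `L²`: the form is bounded with a
mesh-dependent constant, and it is coercive because the possible negativity `D` of the dispersion is
beaten by the mass term for small `Δt`. -/
theorem exists_stepForm_eq (hφ : IsCutoff R φ) (hh : 0 < h) (hD0 : 0 ≤ D)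
    (hD : ∀ w, IsH2 w → -(D * ∫ x, w x ^ 2) ≤ dispersion φ w w) (hΔt : 0 ≤ Δt)
    (hδ : D * Δt / 2 ≤ 1 / 10) {l : (ℝ → ℝ) → ℝ} {A : ℝ}
    (hladd : ∀ v ∈ femSpace r h, ∀ w ∈ femSpace r h, l (fun x => v x + w x) = l v + l w)
    (hlmul : ∀ c : ℝ, ∀ v ∈ femSpace r h, l (fun x => c * v x) = c * l v)
    (hlle : ∀ v ∈ femSpace r h, |l v| ≤ A * √(∫ x, v x ^ 2)) :
    ∃ w ∈ femSpace r h, ∀ v ∈ femSpace r h, stepForm φ Δt w v = l v := by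
  have := completeSpace_femSubmodule r hh
  obtain ⟨B, hB0, hB⟩ := hφ.exists_dispersion_le r hh
  let b : femSubmodule r hh →ₗ[ℝ] femSubmodule r hh →ₗ[ℝ] ℝ := LinearMap.mk₂ ℝ
    (fun F G => stepForm φ Δt (rep hh F) (rep hh G))
    (fun F F' G => by
      rw [rep_add]
      exact stepForm_add_left hφ hh (rep_mem hh _) (rep_mem hh _) (rep_mem hh _))
    (fun c F G => by rw [rep_smul, stepForm_const_mul_left, smul_eq_mul])
    (fun F G G' => by
      rw [rep_add]
      exact stepForm_add_right hφ hh (rep_mem hh _) (rep_mem hh _) (rep_mem hh _))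
    (fun c F G => by
      rw [rep_smul, stepForm_const_mul_right hφ hh c _ (rep_mem hh _), smul_eq_mul])
  have hbb : ∀ F G, b F G = stepForm φ Δt (rep hh F) (rep hh G) := fun F G => rfl
  let b' := b.mkContinuous₂ ((2 + 2 * R) + Δt / 2 * B) (fun F G => by
    rw [hbb, norm_eq_sqrt_rep, norm_eq_sqrt_rep, Real.norm_eq_abs, stepForm]
    have mF := memLp_of_mem hh (rep_mem hh F)
    have mG := memLp_of_mem hh (rep_mem hh G)
    have h1 := (hφ.abs_integral_mul_le mF mG).trans (mul_le_mul (hφ.wnorm_le mF) (hφ.wnorm_le mG)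
      (wnorm_nonneg _ _) (by positivity))
    have h2 := hB _ (rep_mem hh F) _ (rep_mem hh G)
    refine (abs_add_le _ _).trans ?_
    rw [abs_mul, abs_of_nonneg (by positivity : 0 ≤ Δt / 2)]
    have h3 := mul_le_mul_of_nonneg_left h2 (by positivity : 0 ≤ Δt / 2)
    have h4 := Real.mul_self_sqrt hφ.two_add_nonneg
    have h5 : √(2 + 2 * R) * √(∫ x, rep hh F x ^ 2) * (√(2 + 2 * R) * √(∫ x, rep hh G x ^ 2)) =
        (2 + 2 * R) * (√(∫ x, rep hh F x ^ 2) * √(∫ x, rep hh G x ^ 2)) := by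
      rw [mul_mul_mul_comm, h4]
    rw [h5] at h1
    linarith)
  have hbb' : ∀ F G, b' F G = stepForm φ Δt (rep hh F) (rep hh G) := fun F G => rfl
  have hco : IsCoercive b' := by
    -- The coercivity constant is a lower bound for `1 - D Δt / 2`, combined with `φ ≥ 1`.
    refine ⟨9 / 10, by norm_num, fun F => ?_⟩
    have hF := rep_mem hh F
    have h1 := dispersion_ge hφ hD0 hD (isH2_of_mem hh hF)
    have h2 := hφ.integral_sq_le (memLp_of_mem hh hF)
    rw [hbb', stepForm, hφ.integral_mul_self, norm_eq_sqrt_rep, mul_assoc,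
      Real.mul_self_sqrt (integral_nonneg fun x => sq_nonneg _)]
    have h3 := mul_le_mul_of_nonneg_left h1 (by positivity : 0 ≤ Δt / 2)
    nlinarith [sq_nonneg (wnorm φ (rep hh F))]
  let l' : femSubmodule r hh →ₗ[ℝ] ℝ :=
    { toFun := fun F => l (rep hh F)
      map_add' := fun F G => by rw [rep_add, hladd _ (rep_mem hh F) _ (rep_mem hh G)]
      map_smul' := fun c F => by
        rw [rep_smul, hlmul _ _ (rep_mem hh F), RingHom.id_apply, smul_eq_mul] }
  let lc : StrongDual ℝ (femSubmodule r hh) := l'.mkContinuous A (fun F => by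
    rw [norm_eq_sqrt_rep]
    exact hlle _ (rep_mem hh F))
  set F := hco.continuousLinearEquivOfBilin.symm
    ((InnerProductSpace.toDual ℝ (femSubmodule r hh)).symm lc) with hF
  refine ⟨rep hh F, rep_mem hh F, fun v hv => ?_⟩
  obtain ⟨G, rfl⟩ := exists_rep_eq hh hv
  rw [← hbb', ← hco.continuousLinearEquivOfBilin_apply, hF, ContinuousLinearEquiv.apply_symm_apply,
    InnerProductSpace.toDual_symm_apply]
  rfl

/-- Existence of the next iterate. -/
theorem exists_iterationEquation (hφ : IsCutoff R φ) (hC : IsInverseConstants r C₁ C₂)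
    (hh : 0 < h) (hD0 : 0 ≤ D)
    (hD : ∀ w, IsH2 w → -(D * ∫ x, w x ^ 2) ≤ dispersion φ w w) (hΔt : 0 ≤ Δt)
    (hδ : D * Δt / 2 ≤ 1 / 10) (hu : u ∈ femSpace r h) (hw : w ∈ femSpace r h) :
    ∃ w' ∈ femSpace r h, IterationEquation r φ h Δt u w w' := by
  obtain ⟨B, hB0, hB⟩ := hφ.exists_dispersion_le r hh
  have hm := midpoint_mem_femSpace hh hw hu
  have mm := memLp_of_mem hh hm
  have mu := memLp_of_mem hh hu
  set m := midpoint w u with hmd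
  have hβ : 0 ≤ √(C₁ / h) + √(C₂ / h ^ 3) := by positivity
  -- The explicit half of the dispersion enters with the opposite sign, so the known data are the
  -- step form at `u` with time step `-Δt`.
  set l : (ℝ → ℝ) → ℝ := fun v => stepForm φ (-Δt) u v +
    Δt / 2 * ∫ x, m x * m x * deriv (fun s => φ s * v s) x with hl
  obtain ⟨w', hw', heq⟩ := exists_stepForm_eq (l := l) (A := wnorm φ u * √(2 + 2 * R) +
    Δt / 2 * (B * √(∫ x, u x ^ 2)) + Δt / 2 * ((√(C₁ / h) + √(C₂ / h ^ 3)) *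
      (wnorm φ m * wnorm φ m) * √(2 + 2 * R))) hφ hh hD0 hD hΔt hδ
    (fun v hv v' hv' => by
      have e : ∀ x, deriv (fun s => φ s * (v s + v' s)) x =
          deriv (fun s => φ s * v s) x + deriv (fun s => φ s * v' s) x := fun x => by
        rw [← deriv_fun_add (hφ.differentiableAt_mul (isH2_of_mem hh hv) x)
          (hφ.differentiableAt_mul (isH2_of_mem hh hv') x)]
        simp only [mul_add]
      simp only [hl, stepForm_add_right hφ hh hv hv' hu, e]
      simp only [mul_add]
      rw [integral_add (hφ.integrable_mul_deriv_mul hC hh hv mm mm)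
        (hφ.integrable_mul_deriv_mul hC hh hv' mm mm)]
      ring)
    (fun c v hv => by
      have e : ∀ x, deriv (fun s => φ s * (c * v s)) x = c * deriv (fun s => φ s * v s) x :=
        fun x => by
          rw [← deriv_const_mul c (hφ.differentiableAt_mul (isH2_of_mem hh hv) x)]
          simp only [mul_left_comm]
      simp only [hl, stepForm_const_mul_right hφ hh c u hv, e]
      simp only [mul_left_comm _ c]
      rw [integral_const_mul]
      ring)
    (fun v hv => by
      have mv := memLp_of_mem hh hv
      have h1 := hφ.abs_integral_mul_le mu mv
      have h2 := hB u hu v hv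
      have h3 := hφ.abs_integral_mul_deriv_mul_le hC hh hv mm mm
      have h4 := hφ.wnorm_le mv
      have h5 := mul_le_mul_of_nonneg_left h4 (wnorm_nonneg φ u)
      have h6 := mul_le_mul_of_nonneg_left h2 (by positivity : 0 ≤ Δt / 2)
      have h7 := mul_le_mul_of_nonneg_left h3 (by positivity : 0 ≤ Δt / 2)
      have h8 := mul_le_mul_of_nonneg_left h4
        (by have := mul_nonneg (wnorm_nonneg φ m) (wnorm_nonneg φ m)
            positivity : 0 ≤ Δt / 2 * ((√(C₁ / h) + √(C₂ / h ^ 3)) * (wnorm φ m * wnorm φ m)))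
      simp only [hl, stepForm]
      refine (abs_add_three _ _ _).trans ?_
      rw [abs_mul, abs_mul, neg_div, abs_neg, abs_of_nonneg (by positivity : 0 ≤ Δt / 2)]
      linarith)
  refine ⟨w', hw', (iterationEquation_iff hφ hh hw' hu).2 fun v hv => ?_⟩
  have := heq v hv
  simp only [hl, stepForm] at this
  rw [this, ← hmd]
  simp only [sq (m _)]
  ring

end existence

/-! ### Limits of the iterates, existence of a step, and the initial projection. -/

section step

variable {R : ℝ} {φ : ℝ → ℝ} {r : ℕ} {h C₁ C₂ D Δt L K : ℝ} {u u' : ℝ → ℝ} {w : ℕ → ℝ → ℝ}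

theorem tendsto_eLpNorm_sub_iff (hw : ∀ l, MemLp (w l) 2 volume) (hu' : MemLp u' 2 volume) :
    Tendsto (fun l => eLpNorm (fun x => w l x - u' x) 2 volume) atTop (𝓝 0) ↔
      Tendsto (fun l => √(∫ x, (w l x - u' x) ^ 2)) atTop (𝓝 0) := by
  have e : ∀ l, eLpNorm (fun x => w l x - u' x) 2 volume =
      ENNReal.ofReal √(∫ x, (w l x - u' x) ^ 2) := fun l => eLpNorm_two_eq ((hw l).sub hu')
  simp only [e]
  constructor
  · intro h
    have := (ENNReal.tendsto_toReal ENNReal.zero_ne_top).comp h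
    simpa only [Function.comp_def, ENNReal.toReal_ofReal (Real.sqrt_nonneg _),
      ENNReal.toReal_zero] using this
  · intro h
    have := ENNReal.tendsto_ofReal h
    rwa [ENNReal.ofReal_zero] at this

theorem tendsto_wnorm_sub (hφ : IsCutoff R φ) (hw : ∀ l, MemLp (w l) 2 volume)
    (hu' : MemLp u' 2 volume)
    (h : Tendsto (fun l => √(∫ x, (w l x - u' x) ^ 2)) atTop (𝓝 0)) :
    Tendsto (fun l => wnorm φ (fun x => w l x - u' x)) atTop (𝓝 0) := by
  have := h.const_mul √(2 + 2 * R)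
  rw [mul_zero] at this
  exact squeeze_zero (fun l => wnorm_nonneg _ _) (fun l => hφ.wnorm_le ((hw l).sub hu')) this

theorem wnorm_le_of_tendsto (hφ : IsCutoff R φ) (hw : ∀ l, MemLp (w l) 2 volume)
    (hu' : MemLp u' 2 volume)
    (h : Tendsto (fun l => wnorm φ (fun x => w l x - u' x)) atTop (𝓝 0)) {B : ℝ}
    (hB : ∀ l, wnorm φ (w l) ≤ B) : wnorm φ u' ≤ B := by
  have h1 := h.const_add B
  rw [add_zero] at h1
  refine ge_of_tendsto' h1 fun l => ?_
  have h2 := hφ.wnorm_sub_le (g := fun x => w l x - u' x) (hw l) ((hw l).sub hu')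
  simp only [sub_sub_cancel] at h2
  linarith [hB l]

theorem midpoint_comm (u w : ℝ → ℝ) : midpoint u w = midpoint w u := by
  funext x
  simp only [midpoint, add_comm]

/-- On a fixed mesh every term of the iteration equation is continuous in the `L²` norm when paired
with a fixed test function; for the quadratic term this uses the uniform bound on the iterates. -/
theorem cnEquation_of_tendsto (hφ : IsCutoff R φ) (hC : IsInverseConstants r C₁ C₂) (hh : 0 < h)
    (hu : u ∈ femSpace r h) (hu' : u' ∈ femSpace r h) (hw : ∀ l, w l ∈ femSpace r h)
    (heq : ∀ l, IterationEquation r φ h Δt u (w l) (w (l + 1)))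
    (hlim : Tendsto (fun l => √(∫ x, (w l x - u' x) ^ 2)) atTop (𝓝 0)) {B : ℝ}
    (hB : ∀ l, wnorm φ (w l) ≤ B) : CNEquation r φ h Δt u u' := by
  obtain ⟨A, hA0, hA⟩ := hφ.exists_dispersion_le r hh
  have mu := memLp_of_mem hh hu
  have mu' := memLp_of_mem hh hu'
  have mw := fun l => memLp_of_mem hh (hw l)
  have hlimw := tendsto_wnorm_sub hφ mw mu' hlim
  refine (cnEquation_iff hh hu' hu).2 fun v hv => ?_
  have mv := memLp_of_mem hh hv
  have t1 : Tendsto (fun l => ∫ x, w l x * (φ x * v x)) atTop (𝓝 (∫ x, u' x * (φ x * v x))) := by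
    rw [tendsto_iff_norm_sub_tendsto_zero]
    have := hlimw.mul_const (wnorm φ v)
    rw [zero_mul] at this
    refine squeeze_zero (fun l => norm_nonneg _) (fun l => ?_) this
    rw [← hφ.integral_sub_mul (mw l) mu' mv]
    exact hφ.abs_integral_mul_le ((mw l).sub mu') mv
  have t2 : Tendsto (fun l => dispersion φ (w l) v) atTop (𝓝 (dispersion φ u' v)) := by
    rw [tendsto_iff_norm_sub_tendsto_zero]
    have := (hlim.mul_const √(∫ x, v x ^ 2)).const_mul A
    rw [zero_mul, mul_zero] at this
    refine squeeze_zero (fun l => norm_nonneg _) (fun l => ?_) this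
    rw [← dispersion_sub_left hφ hh (hw l) hu' hv]
    exact hA _ (sub_mem_femSpace hh (hw l) hu') v hv
  have t3 : Tendsto (fun l => ∫ x, midpoint (w l) u x ^ 2 * deriv (fun s => φ s * v s) x) atTop
      (𝓝 (∫ x, midpoint u' u x ^ 2 * deriv (fun s => φ s * v s) x)) := by
    rw [tendsto_iff_norm_sub_tendsto_zero]
    set β := √(C₁ / h) + √(C₂ / h ^ 3) with hβ
    have := (hlimw.mul_const (B + wnorm φ u' + 2 * wnorm φ u)).const_mul
      (1 / 4 * (β * wnorm φ v))
    rw [zero_mul, mul_zero] at this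
    refine squeeze_zero (fun l => norm_nonneg _) (fun l => ?_) this
    have m1 := memLp_of_mem hh (midpoint_mem_femSpace hh (hw l) hu)
    have m2 := memLp_of_mem hh (midpoint_mem_femSpace hh hu' hu)
    have ms : MemLp (fun x => w l x + u' x + 2 * u x) 2 volume :=
      ((mw l).add mu').add (mu.const_mul 2)
    simp only [midpoint_sq_eq]
    rw [← integral_sub (hφ.integrable_mul_deriv_mul hC hh hv m1 m1)
      (hφ.integrable_mul_deriv_mul hC hh hv m2 m2)]
    have e : ∫ x, (midpoint (w l) u x * midpoint (w l) u x * deriv (fun s => φ s * v s) x -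
        midpoint u' u x * midpoint u' u x * deriv (fun s => φ s * v s) x) =
        1 / 4 * ∫ x, (w l x - u' x) * (w l x + u' x + 2 * u x) *
          deriv (fun s => φ s * v s) x := by
      rw [← integral_const_mul]
      refine integral_congr_ae (Eventually.of_forall fun x => ?_)
      simp only [midpoint]
      ring
    rw [e, Real.norm_eq_abs, abs_mul, abs_of_pos (by norm_num : (0 : ℝ) < 1 / 4), mul_assoc]
    refine mul_le_mul_of_nonneg_left ?_ (by norm_num)
    refine (hφ.abs_integral_mul_deriv_mul_le hC hh hv ((mw l).sub mu') ms).trans ?_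
    have a1 := hφ.wnorm_add_le (f := fun x => w l x + u' x) ((mw l).add mu') (mu.const_mul 2)
    have a2 := hφ.wnorm_add_le (mw l) mu'
    rw [wnorm_const_mul, abs_two] at a1
    have a3 := hB l
    refine mul_le_mul_of_nonneg_left ?_ (mul_nonneg (by positivity) (wnorm_nonneg _ _))
    exact mul_le_mul_of_nonneg_left (by linarith) (wnorm_nonneg _ _)
  -- The implicit terms involve the iterate with index `l + 1`, the quadratic term the one with
  -- index `l`; both have the same limit.
  have lhs := ((tendsto_add_atTop_iff_nat 1).2 t1).add
    (((tendsto_add_atTop_iff_nat 1).2 t2).const_mul (Δt / 2))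
  have rhs := (t3.const_mul (Δt / 2)).const_add
    ((∫ x, u x * (φ x * v x)) - Δt / 2 * dispersion φ u v)
  have hl := fun l => (iterationEquation_iff hφ hh (hw (l + 1)) hu).1 (heq l) v hv
  simp only [hl] at lhs
  have key := tendsto_nhds_unique lhs rhs
  rw [midpoint_comm u u', dispersion_midpoint hφ hh hu' hu hv]
  have e2 : ∫ x, midpoint u' u x ^ 2 / 2 * deriv (fun s => φ s * v s) x =
      1 / 2 * ∫ x, midpoint u' u x ^ 2 * deriv (fun s => φ s * v s) x := by
    rw [← integral_const_mul]
    refine integral_congr_ae (Eventually.of_forall fun x => ?_)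
    simp only
    ring
  rw [e2]
  linarith

/-- The geometric decay of the increments makes the iterates Cauchy in `L²`, and closedness of the
space keeps the limit inside it. -/
theorem exists_isStep (hφ : IsCutoff R φ) (hC : IsInverseConstants r C₁ C₂) (hh : 0 < h)
    (hD0 : 0 ≤ D) (hD : ∀ w, IsH2 w → -(D * ∫ x, w x ^ 2) ≤ dispersion φ w w) (hΔt : 0 ≤ Δt)
    (hL0 : 0 < L) (hL1 : L < 1) (hK : K = (7 - L) / (1 - L)) (hδ : D * Δt / 2 ≤ 1 / 10)
    (hu : u ∈ femSpace r h)
    (hκ : Δt * (√(C₁ / h) + √(C₂ / h ^ 3)) * wnorm φ u ≤ L / K) :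
    ∃ u', IsStep r φ h Δt u u' := by
  have hstep : ∀ w : {v // v ∈ femSpace r h}, ∃ w' : {v // v ∈ femSpace r h},
      IterationEquation r φ h Δt u w w' := fun w => by
    obtain ⟨w', h1, h2⟩ := exists_iterationEquation hφ hC hh hD0 hD hΔt hδ hu w.2
    exact ⟨⟨w', h1⟩, h2⟩
  choose next hnext using hstep
  let W : ℕ → {v // v ∈ femSpace r h} := fun l => next^[l] ⟨u, hu⟩
  set w : ℕ → ℝ → ℝ := fun l => (W l : ℝ → ℝ) with hwdef
  have h0 : w 0 = u := rfl
  have hw : ∀ l, w l ∈ femSpace r h := fun l => (W l).2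
  have heq : ∀ l, IterationEquation r φ h Δt u (w l) (w (l + 1)) := fun l => by
    have : W (l + 1) = next (W l) := Function.iterate_succ_apply' next l _
    simp only [hwdef, this]
    exact hnext (W l)
  have hb := wnorm_iterate_le hφ hC hh hD0 hD hΔt hL0 hL1 hK hδ hu hκ h0 hw heq
  have := completeSpace_femSubmodule r hh
  choose F hF using fun l => exists_rep_eq hh (hw l)
  have hdist : ∀ G H : femSubmodule r hh, dist G H = √(∫ x, (rep hh G x - rep hh H x) ^ 2) := by
    intro G H
    have e : rep hh (G - H) = fun x => rep hh G x - rep hh H x := by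
      rw [sub_eq_add_neg, ← neg_one_smul ℝ H, rep_add, rep_smul]
      funext x
      ring
    rw [dist_eq_norm, norm_eq_sqrt_rep, e]
  have hcau : CauchySeq F := by
    refine cauchySeq_of_le_geometric L (3 * wnorm φ u) hL1 fun l => ?_
    rw [dist_comm, hdist, hF, hF]
    refine le_trans ?_ (hb l).2
    refine Real.sqrt_le_iff.2 ⟨wnorm_nonneg _ _, ?_⟩
    exact hφ.integral_sq_le ((memLp_of_mem hh (hw _)).sub (memLp_of_mem hh (hw _)))
  obtain ⟨G, hG⟩ := cauchySeq_tendsto_of_complete hcau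
  have hlim := tendsto_iff_dist_tendsto_zero.1 hG
  simp only [hdist, hF] at hlim
  refine ⟨rep hh G, rep_mem hh G, cnEquation_of_tendsto hφ hC hh hu (rep_mem hh G) hw heq hlim
    fun l => (hb l).1, w, h0, hw, heq, ?_⟩
  exact (tendsto_eLpNorm_sub_iff (fun l => memLp_of_mem hh (hw l))
    (memLp_of_mem hh (rep_mem hh G))).2 hlim

/-- The bound comes from the iterates that `IsStep` carries along, so uniqueness for the nonlinear
equation is not needed. -/
theorem IsStep.wnorm_le (hφ : IsCutoff R φ) (hC : IsInverseConstants r C₁ C₂) (hh : 0 < h)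
    (hD0 : 0 ≤ D) (hD : ∀ w, IsH2 w → -(D * ∫ x, w x ^ 2) ≤ dispersion φ w w) (hΔt : 0 ≤ Δt)
    (hL0 : 0 < L) (hL1 : L < 1) (hK : K = (7 - L) / (1 - L)) (hδ : D * Δt / 2 ≤ 1 / 10)
    (hu : u ∈ femSpace r h)
    (hκ : Δt * (√(C₁ / h) + √(C₂ / h ^ 3)) * wnorm φ u ≤ L / K)
    (hs : IsStep r φ h Δt u u') : wnorm φ u' ≤ K * wnorm φ u := by
  obtain ⟨hu', -, w, h0, hw, heq, hlim⟩ := hs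
  have mw := fun l => memLp_of_mem hh (hw l)
  have mu' := memLp_of_mem hh hu'
  exact wnorm_le_of_tendsto hφ mw mu'
    (tendsto_wnorm_sub hφ mw mu' ((tendsto_eLpNorm_sub_iff mw mu').1 hlim))
    fun l => (wnorm_iterate_le hφ hC hh hD0 hD hΔt hL0 hL1 hK hδ hu hκ h0 hw heq l).1

theorem exists_projection (hh : 0 < h) (r : ℕ) (u₀ : Lp ℝ 2 (volume : Measure ℝ)) :
    ∃ v ∈ femSpace r h, ∀ z ∈ femSpace r h, ∫ x, (v x - u₀ x) * z x = 0 := by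
  have := completeSpace_femSubmodule r hh
  set P : femSubmodule r hh := ⟨(femSubmodule r hh).starProjection u₀,
    Submodule.starProjection_apply_mem _ _⟩ with hP
  refine ⟨rep hh P, rep_mem hh P, fun z hz => ?_⟩
  obtain ⟨G, rfl⟩ := exists_rep_eq hh hz
  have h1 := (femSubmodule r hh).starProjection_inner_eq_zero u₀ G G.2
  rw [L2.inner_def] at h1
  rw [← neg_eq_zero, ← integral_neg, ← h1]
  refine integral_congr_ae ?_
  filter_upwards [coe_ae_eq_rep hh P, coe_ae_eq_rep hh G,
    Lp.coeFn_sub u₀ (P : Lp ℝ 2 (volume : Measure ℝ))] with x h1 h2 h3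
  rw [h3, Pi.sub_apply, h1, h2, RCLike.inner_apply, conj_trivial]
  ring

theorem integral_sq_projection_le (hh : 0 < h) {u₀ : Lp ℝ 2 (volume : Measure ℝ)} {v : ℝ → ℝ}
    (hv : v ∈ femSpace r h) (hproj : ∫ x, (v x - u₀ x) * v x = 0) :
    ∫ x, v x ^ 2 ≤ ‖u₀‖ ^ 2 := by
  have mv := memLp_of_mem hh hv
  have mu := Lp.memLp u₀
  have e : ∫ x, (v x - u₀ x) * v x = (∫ x, v x ^ 2) - ∫ x, u₀ x * v x := by
    have i1 : Integrable fun x => u₀ x * v x := mu.integrable_mul mv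
    rw [← integral_sub mv.integrable_sq i1]
    refine integral_congr_ae (Eventually.of_forall fun x => ?_)
    simp only
    ring
  have h1 := (abs_le.1 (abs_integral_mul_le mu mv)).2
  rw [← norm_sq_eq_integral (F := u₀) (v := u₀) EventuallyEq.rfl,
    Real.sqrt_sq (norm_nonneg _)] at h1
  have h0 : 0 ≤ ∫ x, v x ^ 2 := integral_nonneg fun x => sq_nonneg _
  have h2 := Real.sq_sqrt h0
  have h3 := Real.sqrt_nonneg (∫ x, v x ^ 2)
  set s := √(∫ x, v x ^ 2)
  have h4 : s ^ 2 ≤ ‖u₀‖ * s := by linarith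
  have h5 : s ≤ ‖u₀‖ := by
    rcases h3.eq_or_lt with h6 | h6
    · rw [← h6]
      exact norm_nonneg _
    · exact le_of_mul_le_mul_right (by linarith) h6
  rw [← h2]
  exact pow_le_pow_left₀ h3 h5 2

end step

/-! ### The energy estimate for one step. -/

section energy

variable {R : ℝ} {φ : ℝ → ℝ} {r : ℕ} {h D Δt : ℝ} {u u' : ℝ → ℝ}

theorem IsCutoff.wnorm_midpoint_sq_le (hφ : IsCutoff R φ) (hu : MemLp u 2 volume)
    (hu' : MemLp u' 2 volume) (hm : MemLp (midpoint u u') 2 volume) :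
    wnorm φ (midpoint u u') ^ 2 ≤ (wnorm φ u ^ 2 + wnorm φ u' ^ 2) / 2 := by
  rw [hφ.wnorm_sq, hφ.wnorm_sq, hφ.wnorm_sq,
    ← integral_add (hφ.integrable_mul_sq hu) (hφ.integrable_mul_sq hu'), ← integral_div]
  refine integral_mono (hφ.integrable_mul_sq hm)
    (((hφ.integrable_mul_sq hu).add (hφ.integrable_mul_sq hu')).div_const 2) fun x => ?_
  simp only [midpoint]
  have := hφ.pos x
  nlinarith [mul_nonneg this.le (sq_nonneg (u x - u' x))]

/-- The energy estimate for one step of the scheme. -/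
theorem energy_step (hφ : IsCutoff R φ) (hh : 0 < h)
    (hD : ∀ w, IsH2 w → (1 / Real.pi) * gagliardo (fun x => √(deriv φ x) * w x) -
      D * ∫ x, w x ^ 2 ≤ dispersion φ w w)
    (hΔt : 0 ≤ Δt) (hu : u ∈ femSpace r h) (hu' : u' ∈ femSpace r h)
    (hs : CNEquation r φ h Δt u u') :
    wnorm φ u' ^ 2 + Δt / Real.pi * gagliardo (fun x => √(deriv φ x) * midpoint u u' x) ≤
      wnorm φ u ^ 2 + 2 * Δt * (D * (∫ x, midpoint u u' x ^ 2) +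
        Real.pi * (∫ x, midpoint u u' x ^ 2) ^ 2) := by
  have hm := midpoint_mem_femSpace hh hu hu'
  have hm2 := isH2_of_mem hh hm
  have mu := memLp_of_mem hh hu
  have mu' := memLp_of_mem hh hu'
  have mm := memLp_of_mem hh hm
  -- Testing with the midpoint is what makes the time difference exact and all other terms depend on
  -- the midpoint alone.
  have eq := (cnEquation_iff hh hu' hu).1 hs _ hm
  rw [hφ.integral_sq_mul_deriv hm2] at eq
  have ex : (∫ x, u' x * (φ x * midpoint u u' x)) - ∫ x, u x * (φ x * midpoint u u' x) =
      (wnorm φ u' ^ 2 - wnorm φ u ^ 2) / 2 := by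
    rw [← hφ.integral_sub_mul mu' mu mm, hφ.wnorm_sq, hφ.wnorm_sq,
      ← integral_sub (hφ.integrable_mul_sq mu') (hφ.integrable_mul_sq mu), ← integral_div]
    refine integral_congr_ae (Eventually.of_forall fun x => ?_)
    simp only [midpoint]
    ring
  have hcube := hφ.sq_integral_cube_le hm2
  have hd := hD _ hm2
  have hG := gagliardo_nonneg fun x => √(deriv φ x) * midpoint u u' x
  have hμ : 0 ≤ ∫ x, midpoint u u' x ^ 2 := integral_nonneg fun x => sq_nonneg _
  have hpi := Real.pi_pos
  set G := gagliardo fun x => √(deriv φ x) * midpoint u u' x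
  set μ := ∫ x, midpoint u u' x ^ 2
  set I := ∫ x, deriv φ x * midpoint u u' x ^ 3
  -- Young's inequality for `|I| ≤ 4 μ √G`. The constants spend exactly half of the dissipation
  -- `G/π`, and the square completes because `16 ≤ 18`.
  have hI : 1 / 3 * I ≤ G / (2 * Real.pi) + Real.pi * μ ^ 2 := by
    have h1 : I ≤ G * (3 / (2 * Real.pi)) + 3 * Real.pi * μ ^ 2 := by
      refine le_of_abs_le (abs_le_of_sq_le_sq (hcube.trans ?_) (by positivity))
      have e : (G * (3 / (2 * Real.pi)) + 3 * Real.pi * μ ^ 2) ^ 2 =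
          (G * (3 / (2 * Real.pi)) - 3 * Real.pi * μ ^ 2) ^ 2 + 18 * μ ^ 2 * G := by
        field_simp
        ring
      rw [e]
      nlinarith [sq_nonneg (G * (3 / (2 * Real.pi)) - 3 * Real.pi * μ ^ 2),
        mul_nonneg (sq_nonneg μ) hG]
    have e : 1 / 3 * (G * (3 / (2 * Real.pi)) + 3 * Real.pi * μ ^ 2) =
        G / (2 * Real.pi) + Real.pi * μ ^ 2 := by
      field_simp
    linarith
  have k1 := mul_le_mul_of_nonneg_left hd hΔt
  have k2 := mul_le_mul_of_nonneg_left hI hΔt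
  have e1 : Δt * (G / (2 * Real.pi)) = Δt / Real.pi * G / 2 := by field_simp
  have e2 : Δt * (1 / Real.pi * G - D * μ) = Δt / Real.pi * G - Δt * (D * μ) := by
    field_simp
  rw [e2] at k1
  rw [mul_add, e1] at k2
  linarith

end energy

/-! ### The majorant differential equation and its comparison with Euler's method. -/

section majorant

/-- The explicit solution of the majorant equation. -/
theorem exists_majorant {c α y₀ τ : ℝ} (hc : 0 < c) (hα : 0 < α) (hy₀ : 0 ≤ y₀) (hτ : 0 < τ) :
    ∃ T, 0 < T ∧ T ≤ τ ∧ ∃ y : ℝ → ℝ, y 0 = y₀ ∧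
      (∀ t ∈ Set.Icc 0 T, HasDerivAt y (c * (α * y t + (α * y t) ^ 2)) t) ∧
      (∀ t ∈ Set.Icc 0 T, 0 ≤ y t) ∧ y T ≤ 4 * y₀ := by
  -- While `e^{cαt} ≤ 1 + ε` the denominator of the explicit solution is at least `1/2`. This bounds
  -- the solution by `2(1 + ε) y₀ ≤ 3 y₀`, within the claimed `4 y₀`.
  set ε := 1 / (2 * (α * y₀ + 1)) with hε
  have hε0 : 0 < ε := by positivity
  have hε1 : ε ≤ 1 / 2 := by
    rw [hε, div_le_div_iff₀ (by positivity) (by norm_num)]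
    nlinarith [mul_nonneg hα.le hy₀]
  have hlog : 0 < Real.log (1 + ε) := Real.log_pos (by linarith)
  have hca : 0 < c * α := by positivity
  refine ⟨min τ (Real.log (1 + ε) / (c * α)), lt_min hτ (by positivity), min_le_left _ _, ?_⟩
  set T := min τ (Real.log (1 + ε) / (c * α)) with hT
  have hT0 : 0 < T := lt_min hτ (by positivity)
  have hexp : ∀ t ∈ Set.Icc 0 T, Real.exp (c * α * t) ≤ 1 + ε := by
    intro t ht
    have h1 : c * α * t ≤ Real.log (1 + ε) := by
      have := (le_div_iff₀ hca).1 (ht.2.trans (min_le_right _ _))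
      linarith
    exact (Real.exp_le_exp.2 h1).trans_eq (Real.exp_log (by linarith))
  have hden : ∀ t ∈ Set.Icc 0 T, 1 / 2 ≤ 1 - α * y₀ * (Real.exp (c * α * t) - 1) := by
    intro t ht
    have h1 := hexp t ht
    have h2 : α * y₀ * (Real.exp (c * α * t) - 1) ≤ α * y₀ * ε :=
      mul_le_mul_of_nonneg_left (by linarith) (by positivity)
    have h3 : α * y₀ * ε ≤ 1 / 2 := by
      rw [hε, mul_one_div, div_le_div_iff₀ (by positivity) (by norm_num)]
      linarith
    linarith
  -- A Bernoulli equation: it becomes linear in `1/y`, which gives this formula also for `y₀ = 0`.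
  refine ⟨fun t => y₀ * Real.exp (c * α * t) / (1 - α * y₀ * (Real.exp (c * α * t) - 1)),
    by simp, fun t ht => ?_, fun t ht => ?_, ?_⟩
  · have hd := hden t ht
    have hd0 : 1 - α * y₀ * (Real.exp (c * α * t) - 1) ≠ 0 := by linarith
    have he : HasDerivAt (fun t => Real.exp (c * α * t)) (Real.exp (c * α * t) * (c * α)) t := by
      have := ((hasDerivAt_id t).const_mul (c * α)).exp
      simpa using this
    have h1 := (he.const_mul y₀).div (((he.sub_const 1).const_mul (α * y₀)).const_sub 1) hd0
    refine h1.congr_deriv ?_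
    field_simp
    ring
  · have := hden t ht
    have := Real.exp_pos (c * α * t)
    positivity
  · have h1 := hden T ⟨hT0.le, le_rfl⟩
    have h2 := hexp T ⟨hT0.le, le_rfl⟩
    simp only
    rw [div_le_iff₀ (by linarith)]
    nlinarith

/-- The solution of the majorant equation dominates the explicit Euler method. -/
theorem euler_le {c α T : ℝ} (hc : 0 ≤ c) (hα : 0 ≤ α) {y : ℝ → ℝ}
    (hy : ∀ t ∈ Set.Icc 0 T, HasDerivAt y (c * (α * y t + (α * y t) ^ 2)) t)
    (hy0 : ∀ t ∈ Set.Icc 0 T, 0 ≤ y t) : MonotoneOn y (Set.Icc 0 T) ∧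
      ∀ s ∈ Set.Icc 0 T, ∀ t ∈ Set.Icc 0 T, s ≤ t →
        y s + (t - s) * (c * (α * y s + (α * y s) ^ 2)) ≤ y t := by
  have hcont : ContinuousOn y (Set.Icc 0 T) := fun t ht =>
    (hy t ht).continuousAt.continuousWithinAt
  have hmono : MonotoneOn y (Set.Icc 0 T) := by
    refine monotoneOn_of_deriv_nonneg (convex_Icc 0 T) hcont (fun t ht => ?_) fun t ht => ?_
    · exact (hy t (interior_subset ht)).differentiableAt.differentiableWithinAt
    · rw [(hy t (interior_subset ht)).deriv]
      have := hy0 t (interior_subset ht)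
      positivity
  refine ⟨hmono, fun s hs t ht hst => ?_⟩
  have hsub : Set.Icc s t ⊆ Set.Icc 0 T := Set.Icc_subset_Icc hs.1 ht.2
  -- Because `y` is nondecreasing and `f` increases on nonnegative arguments, the slope on `[s, t]`
  -- is at least its value at `s`.
  have := (convex_Icc s t).mul_sub_le_image_sub_of_le_deriv (f := y)
    (C := c * (α * y s + (α * y s) ^ 2)) (hcont.mono hsub)
    (fun x hx => (hy x (hsub (interior_subset hx))).differentiableAt.differentiableWithinAt)
    (fun x hx => by
      have hx' := interior_subset hx
      rw [(hy x (hsub hx')).deriv]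
      have h1 := hmono hs (hsub hx') hx'.1
      have h2 := hy0 s hs
      gcongr) s ⟨le_rfl, hst⟩ t ⟨hst, le_rfl⟩ hst
  linarith

end majorant

/-! ### From the CFL condition to smallness of the contraction factor. -/

section cfl

theorem cfl_eq {h Δt : ℝ} (hh : 0 < h) (hΔt : 0 ≤ Δt) (C : ℝ) :
    Δt * √(C / h ^ 3) = cfl h Δt * √C := by
  rw [cfl, Real.sqrt_div' _ (by positivity), Real.sqrt_div' _ (by positivity), Real.sqrt_sq hΔt]
  ring

/-- The term with `C₂` scales like `λ` and is half the allowed size by the CFL condition, with the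
factor `√2` to spare. The term with `C₁` scales like `Δt/√Δx` and interpolates between `λ` and `Δt`:
it is bounded by a power of `λ` times a power of `Δt² Y`, and the latter is small by assumption. -/
theorem cfl_smallness {C₁ C₂ L K Y h Δt η : ℝ} (hC₁ : 0 < C₁) (hC₂ : 0 < C₂) (hL : 0 < L)
    (hK : 0 < K) (hY : 0 ≤ Y) (hh : 0 < h) (hΔt : 0 ≤ Δt)
    (hcfl : cfl h Δt * (2 * √2 * √C₂ * K * √Y) ≤ L) (hη : Δt ^ 2 * Y ≤ η)
    (hη2 : C₁ ^ 3 * η ^ 2 ≤ C₂ * (L / (2 * K)) ^ 4) :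
    Δt * (√(C₁ / h) + √(C₂ / h ^ 3)) * √Y ≤ L / K := by
  have hl : 0 ≤ cfl h Δt := Real.sqrt_nonneg _
  have hlsq : cfl h Δt ^ 2 = Δt ^ 2 / h ^ 3 := Real.sq_sqrt (by positivity)
  have h2 : 1 ≤ √2 := Real.one_le_sqrt.2 (by norm_num)
  have hp : cfl h Δt * √C₂ * √Y ≤ L / (2 * K) := by
    rw [le_div_iff₀ (by positivity)]
    have h3 : 0 ≤ cfl h Δt * √C₂ * √Y * (2 * K) := by positivity
    calc cfl h Δt * √C₂ * √Y * (2 * K) ≤ cfl h Δt * √C₂ * √Y * (2 * K) * √2 :=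
          le_mul_of_one_le_right h3 h2
      _ = cfl h Δt * (2 * √2 * √C₂ * K * √Y) := by ring
      _ ≤ L := hcfl
  have hq : Δt * √(C₁ / h) * √Y ≤ L / (2 * K) := by
    refine le_of_pow_le_pow_left₀ (n := 6) (by norm_num) (by positivity) ?_
    -- The sixth power clears all roots: `Δt⁶/Δx³` is `λ²` times `Δt⁴`.
    have e6 : (Δt * √(C₁ / h) * √Y) ^ 6 = C₁ ^ 3 * (cfl h Δt ^ 2 * Y) * (Δt ^ 2 * Y) ^ 2 := by
      rw [hlsq, mul_pow, mul_pow, show √(C₁ / h) ^ 6 = (√(C₁ / h) ^ 2) ^ 3 by ring,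
        show √Y ^ 6 = (√Y ^ 2) ^ 3 by ring, Real.sq_sqrt (by positivity), Real.sq_sqrt hY]
      field_simp
    have hp2 : C₂ * (cfl h Δt ^ 2 * Y) ≤ (L / (2 * K)) ^ 2 := by
      have := pow_le_pow_left₀ (by positivity) hp 2
      rw [mul_pow, mul_pow, Real.sq_sqrt hC₂.le, Real.sq_sqrt hY] at this
      linarith
    have hη' : (Δt ^ 2 * Y) ^ 2 ≤ η ^ 2 := pow_le_pow_left₀ (by positivity) hη 2
    have h0 : 0 ≤ cfl h Δt ^ 2 * Y := by positivity
    rw [e6]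
    calc C₁ ^ 3 * (cfl h Δt ^ 2 * Y) * (Δt ^ 2 * Y) ^ 2
        ≤ C₁ ^ 3 * (cfl h Δt ^ 2 * Y) * η ^ 2 := by gcongr
      _ = (cfl h Δt ^ 2 * Y) * (C₁ ^ 3 * η ^ 2) := by ring
      _ ≤ (cfl h Δt ^ 2 * Y) * (C₂ * (L / (2 * K)) ^ 4) := by gcongr
      _ = (C₂ * (cfl h Δt ^ 2 * Y)) * (L / (2 * K)) ^ 4 := by ring
      _ ≤ (L / (2 * K)) ^ 2 * (L / (2 * K)) ^ 4 := by gcongr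
      _ = _ := by ring
  have e : L / K = L / (2 * K) + L / (2 * K) := by
    field_simp
    ring
  have := cfl_eq hh hΔt C₂
  calc Δt * (√(C₁ / h) + √(C₂ / h ^ 3)) * √Y
      = Δt * √(C₁ / h) * √Y + Δt * √(C₂ / h ^ 3) * √Y := by ring
    _ ≤ _ := by rw [this, e]; linarith

end cfl

/-! ### Stability along the whole scheme, existence, and summation. -/

section scheme

variable {R : ℝ} {φ : ℝ → ℝ} {r : ℕ} {h C₁ C₂ D Δt L K c α Y T : ℝ}

/-- The energy dissipated in one step of the scheme. -/
noncomputable def dissipation (φ u u' : ℝ → ℝ) : ℝ :=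
  gagliardo fun x => √(deriv φ x) * midpoint u u' x

/-- A time step from `u` is possible, and every time step from `u` satisfies the energy
estimate. -/
def IsStable (r : ℕ) (φ : ℝ → ℝ) (h Δt c α : ℝ) (u : ℝ → ℝ) : Prop :=
  (∃ u', IsStep r φ h Δt u u') ∧ ∀ u', IsStep r φ h Δt u u' →
    wnorm φ u' ^ 2 + Δt / Real.pi * dissipation φ u u' ≤
      wnorm φ u ^ 2 + Δt * (c * (α * wnorm φ u ^ 2 + (α * wnorm φ u ^ 2) ^ 2)) ∧
    ∫ x, midpoint u u' x ^ 2 ≤ α * wnorm φ u ^ 2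

/-- The contraction gives `‖u'‖ ≤ K ‖u‖` in the weighted norm, and convexity of the square then
bounds the midpoint by `(K² + 1)/2` times the old energy. Substituting this into the energy estimate
leaves a right side that involves only `u`. -/
theorem isStable_of_le (hφ : IsCutoff R φ) (hC : IsInverseConstants r C₁ C₂) (hh : 0 < h)
    (hD0 : 0 ≤ D) (hD : ∀ w, IsH2 w → (1 / Real.pi) * gagliardo (fun x => √(deriv φ x) * w x) -
      D * ∫ x, w x ^ 2 ≤ dispersion φ w w) (hΔt : 0 ≤ Δt)
    (hL0 : 0 < L) (hL1 : L < 1) (hK : K = (7 - L) / (1 - L)) (hδ : D * Δt / 2 ≤ 1 / 10)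
    (hκ : Δt * (√(C₁ / h) + √(C₂ / h ^ 3)) * √Y ≤ L / K) {u : ℝ → ℝ} (hu : u ∈ femSpace r h)
    (hN : wnorm φ u ^ 2 ≤ Y) :
    IsStable r φ h Δt (2 * D + 2 * Real.pi) ((K ^ 2 + 1) / 2) u := by
  have hD' : ∀ w, IsH2 w → -(D * ∫ x, w x ^ 2) ≤ dispersion φ w w := fun w hw => by
    have h1 := hD w hw
    have h2 : 0 ≤ (1 / Real.pi) * gagliardo (fun x => √(deriv φ x) * w x) :=
      mul_nonneg (by positivity) (gagliardo_nonneg _)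
    linarith
  have hκ' : Δt * (√(C₁ / h) + √(C₂ / h ^ 3)) * wnorm φ u ≤ L / K :=
    (mul_le_mul_of_nonneg_left (Real.le_sqrt_of_sq_le hN) (by positivity)).trans hκ
  refine ⟨exists_isStep hφ hC hh hD0 hD' hΔt hL0 hL1 hK hδ hu hκ', fun u' hs => ?_⟩
  have hm := midpoint_mem_femSpace hh hu hs.1
  have h1 := energy_step hφ hh hD hΔt hu hs.1 hs.2.1
  have h2 := hφ.wnorm_midpoint_sq_le (memLp_of_mem hh hu) (memLp_of_mem hh hs.1)
    (memLp_of_mem hh hm)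
  have h3 := hs.wnorm_le hφ hC hh hD0 hD' hΔt hL0 hL1 hK hδ hu hκ'
  have h4 := pow_le_pow_left₀ (wnorm_nonneg _ _) h3 2
  have h5 := hφ.integral_sq_le (memLp_of_mem hh hm)
  have hμ : 0 ≤ ∫ x, midpoint u u' x ^ 2 := integral_nonneg fun x => sq_nonneg _
  have hμle : ∫ x, midpoint u u' x ^ 2 ≤ (K ^ 2 + 1) / 2 * wnorm φ u ^ 2 := by
    rw [mul_pow] at h4
    linarith
  refine ⟨h1.trans ?_, hμle⟩
  have hpi := Real.pi_pos
  set μ := ∫ x, midpoint u u' x ^ 2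
  set a := (K ^ 2 + 1) / 2 * wnorm φ u ^ 2
  -- This fixes the constant `c = 2D + 2π` of the majorant, which does not depend on the data.
  have h6 : 2 * (D * μ + Real.pi * μ ^ 2) ≤ (2 * D + 2 * Real.pi) * (a + a ^ 2) := by
    have h7 : μ ^ 2 ≤ a ^ 2 := pow_le_pow_left₀ hμ hμle 2
    have h8 : 0 ≤ μ ^ 2 := sq_nonneg _
    have k1 := mul_le_mul_of_nonneg_left hμle hD0
    have k2 := mul_le_mul_of_nonneg_left h7 hpi.le
    have k3 : 0 ≤ D * a ^ 2 := by positivity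
    have k4 : 0 ≤ Real.pi * a := mul_nonneg hpi.le (hμ.trans hμle)
    linarith
  have := mul_le_mul_of_nonneg_left h6 hΔt
  linarith

/-- One step raises the energy by at most one Euler increment of the majorant, and the Euler polygon
stays below the solution. Monotonicity keeps the energy below `y T`, so the stability hypothesis
applies at the next step. -/
theorem wnorm_sq_le_majorant (hΔt : 0 ≤ Δt) (hc : 0 ≤ c) (hα : 0 ≤ α) {y : ℝ → ℝ}
    (hstab : ∀ v ∈ femSpace r h, wnorm φ v ^ 2 ≤ y T → IsStable r φ h Δt c α v)
    (hmono : MonotoneOn y (Set.Icc 0 T))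
    (heuler : ∀ s ∈ Set.Icc 0 T, ∀ t ∈ Set.Icc 0 T, s ≤ t →
      y s + (t - s) * (c * (α * y s + (α * y s) ^ 2)) ≤ y t) {u : ℕ → ℝ → ℝ}
    (hu0 : u 0 ∈ femSpace r h) (hN0 : wnorm φ (u 0) ^ 2 ≤ y 0) (n : ℕ)
    (hsteps : ∀ k < n, IsStep r φ h Δt (u k) (u (k + 1))) (hn : n * Δt ≤ T) :
    u n ∈ femSpace r h ∧ wnorm φ (u n) ^ 2 ≤ y (n * Δt) := by
  induction n with
  | zero => simpa using ⟨hu0, hN0⟩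
  | succ n ih =>
    push_cast at hn ⊢
    have hn0 : (n : ℝ) * Δt ≤ T := by linarith
    have hnn : 0 ≤ (n : ℝ) * Δt := by positivity
    have hmem : (n : ℝ) * Δt ∈ Set.Icc 0 T := ⟨hnn, hn0⟩
    have hmem' : ((n : ℝ) + 1) * Δt ∈ Set.Icc 0 T := ⟨by positivity, hn⟩
    obtain ⟨h1, h2⟩ := ih (fun k hk => hsteps k (by omega)) hn0
    have hT : y (n * Δt) ≤ y T := hmono hmem ⟨hnn.trans hn0, le_rfl⟩ hn0
    have hst := hsteps n (Nat.lt_succ_self n)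
    have h3 := ((hstab _ h1 (h2.trans hT)).2 _ hst).1
    have h4 := heuler _ hmem _ hmem' (by linarith)
    have h5 : 0 ≤ Δt / Real.pi * dissipation φ (u n) (u (n + 1)) :=
      mul_nonneg (div_nonneg hΔt Real.pi_pos.le) (gagliardo_nonneg _)
    refine ⟨hst.1, ?_⟩
    set N := wnorm φ (u n) ^ 2
    have hN : 0 ≤ N := sq_nonneg _
    have h6 : Δt * (c * (α * N + (α * N) ^ 2)) ≤
        Δt * (c * (α * y (n * Δt) + (α * y (n * Δt)) ^ 2)) := by gcongr
    linarith

/-- Existence of step `n` needs the energy bound at `n`, which needs the previous steps to be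
genuine ones; a strong induction resolves this. -/
theorem exists_isSchemeSolution (hh : 0 < h) (hΔt : 0 ≤ Δt) (hc : 0 ≤ c) (hα : 0 ≤ α)
    {y : ℝ → ℝ}
    (hstab : ∀ v ∈ femSpace r h, wnorm φ v ^ 2 ≤ y T → IsStable r φ h Δt c α v)
    (hmono : MonotoneOn y (Set.Icc 0 T))
    (heuler : ∀ s ∈ Set.Icc 0 T, ∀ t ∈ Set.Icc 0 T, s ≤ t →
      y s + (t - s) * (c * (α * y s + (α * y s) ^ 2)) ≤ y t)
    (u₀ : Lp ℝ 2 (volume : Measure ℝ))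
    (hproj : ∀ v ∈ femSpace r h, (∀ z ∈ femSpace r h, ∫ x, (v x - u₀ x) * z x = 0) →
      wnorm φ v ^ 2 ≤ y 0) :
    ∃ u : ℕ → ℝ → ℝ, IsSchemeSolution r φ h Δt T u₀ u := by
  classical
  obtain ⟨v, hv, hvp⟩ := exists_projection hh r u₀
  -- The default value `0` is irrelevant at the times considered, since there a step always exists.
  let next : (ℝ → ℝ) → ℝ → ℝ := fun u =>
    if hex : ∃ u', IsStep r φ h Δt u u' then hex.choose else 0
  set u : ℕ → ℝ → ℝ := fun n => next^[n] v with hu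
  have hsucc : ∀ n, u (n + 1) = next (u n) := fun n => Function.iterate_succ_apply' next n v
  have hstep : ∀ n : ℕ, ((n : ℝ) + 1 / 2) * Δt ≤ T → IsStep r φ h Δt (u n) (u (n + 1)) := by
    intro n
    induction n using Nat.strong_induction_on with
    | _ n ih =>
      intro hn
      have hn0 : (n : ℝ) * Δt ≤ T := by linarith
      have hprev : ∀ k < n, IsStep r φ h Δt (u k) (u (k + 1)) := fun k hk => by
        refine ih k hk (le_trans (mul_le_mul_of_nonneg_right ?_ hΔt) hn)
        have : (k : ℝ) ≤ n := by exact_mod_cast hk.le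
        linarith
      obtain ⟨h1, h2⟩ := wnorm_sq_le_majorant hΔt hc hα hstab hmono heuler hv (hproj v hv hvp) n
        hprev hn0
      have hnn : 0 ≤ (n : ℝ) * Δt := by positivity
      have hT : y (n * Δt) ≤ y T := hmono ⟨hnn, hn0⟩ ⟨hnn.trans hn0, le_rfl⟩ hn0
      have hex := (hstab _ h1 (h2.trans hT)).1
      rw [hsucc]
      simp only [next, dif_pos hex]
      exact hex.choose_spec
  exact ⟨u, hv, hvp, hstep⟩

/-- The admissible `n` form an initial segment, which allows the telescoping sum. Rounding shows
that `k` steps satisfy `k Δt ≤ T + Δt/2`, slightly beyond `T`. -/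
theorem filter_steps_eq (hΔt : 0 < Δt) (hT : 0 ≤ T) :
    (Finset.range (⌊T / Δt⌋₊ + 1)).filter (fun n : ℕ => ((n : ℝ) + 1 / 2) * Δt ≤ T) =
      Finset.range ⌊T / Δt + 1 / 2⌋₊ := by
  have hq : 0 ≤ T / Δt := by positivity
  ext n
  have e : ((n : ℝ) + 1 / 2) * Δt ≤ T ↔ n < ⌊T / Δt + 1 / 2⌋₊ := by
    rw [← le_div_iff₀ hΔt, ← Nat.succ_le_iff, Nat.le_floor_iff (by positivity)]
    push_cast
    constructor <;> intro h <;> linarith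
  rw [Finset.mem_filter, Finset.mem_range, Finset.mem_range, e]
  refine ⟨fun h => h.2, fun h => ⟨?_, h⟩⟩
  refine Nat.lt_succ_of_le (Nat.le_floor ?_)
  have := (le_div_iff₀ hΔt).2 (e.2 h)
  linarith

theorem sum_le_of_telescope {N g : ℕ → ℝ} {F : ℝ} (k : ℕ)
    (h : ∀ n < k, N (n + 1) + g n ≤ N n + F) : N k + ∑ n ∈ Finset.range k, g n ≤ N 0 + k * F := by
  induction k with
  | zero => simp
  | succ k ih =>
    have h1 := ih fun n hn => h n (by omega)
    have h2 := h k (Nat.lt_succ_self k)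
    rw [Finset.sum_range_succ]
    push_cast
    linarith

/-- Telescoping the energy estimates bounds the total dissipation. The final value `u k` may lie
beyond time `T`, so only nonnegativity of its energy is used. -/
theorem sum_fracDeriv_le (hh : 0 < h) (hΔt : 0 < Δt) (hc : 0 ≤ c) (hα : 0 ≤ α) {A : ℝ}
    (hA0 : 0 ≤ A) (hA : ∀ w : ℝ → ℝ, IsH2 w →
      ∫ x in Set.Icc (-R) R, ‖fracDeriv (1 / 2) w x‖ ^ 2 ≤
        A * (gagliardo (fun x => √(deriv φ x) * w x) + ∫ x, w x ^ 2))
    {u : ℕ → ℝ → ℝ} (k : ℕ) (hk : k * Δt ≤ 2 * T)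
    (hu : ∀ n < k, u n ∈ femSpace r h ∧ wnorm φ (u n) ^ 2 ≤ Y ∧ IsStable r φ h Δt c α (u n) ∧
      IsStep r φ h Δt (u n) (u (n + 1))) (hY0 : wnorm φ (u 0) ^ 2 ≤ Y) :
    Δt * ∑ n ∈ Finset.range k, ∫ x in Set.Icc (-R) R,
      ‖fracDeriv (1 / 2) (midpoint (u n) (u (n + 1))) x‖ ^ 2 ≤
        A * (Real.pi * (Y + 2 * T * (c * (α * Y + (α * Y) ^ 2))) + 2 * T * (α * Y)) := by
  have hpi := Real.pi_pos
  have hY : 0 ≤ Y := (sq_nonneg _).trans hY0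
  set F := c * (α * Y + (α * Y) ^ 2) with hF
  have hF0 : 0 ≤ F := by positivity
  have htel := sum_le_of_telescope (N := fun n => wnorm φ (u n) ^ 2)
    (g := fun n => Δt / Real.pi * dissipation φ (u n) (u (n + 1))) (F := Δt * F) k fun n hn => by
      obtain ⟨-, h1, h2, h3⟩ := hu n hn
      have h4 := (h2.2 _ h3).1
      have h0 : 0 ≤ wnorm φ (u n) ^ 2 := sq_nonneg _
      have h5 : Δt * (c * (α * wnorm φ (u n) ^ 2 + (α * wnorm φ (u n) ^ 2) ^ 2)) ≤ Δt * F := by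
        rw [hF]
        gcongr
      linarith
  rw [← Finset.mul_sum] at htel
  have hNk : 0 ≤ wnorm φ (u k) ^ 2 := sq_nonneg _
  have hkF : k * (Δt * F) ≤ 2 * T * F := by
    rw [← mul_assoc]
    exact mul_le_mul_of_nonneg_right hk hF0
  set G := ∑ n ∈ Finset.range k, dissipation φ (u n) (u (n + 1)) with hG
  have hGle : Δt * G ≤ Real.pi * (Y + 2 * T * F) := by
    have h1 : Δt / Real.pi * G ≤ Y + 2 * T * F := by linarith
    rw [div_mul_eq_mul_div, div_le_iff₀ hpi] at h1
    linarith
  have hM : ∑ n ∈ Finset.range k, ∫ x, midpoint (u n) (u (n + 1)) x ^ 2 ≤ k * (α * Y) := by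
    refine (Finset.sum_le_card_nsmul _ _ (α * Y) fun n hn => ?_).trans_eq (by simp)
    obtain ⟨-, h1, h2, h3⟩ := hu n (Finset.mem_range.1 hn)
    exact ((h2.2 _ h3).2).trans (mul_le_mul_of_nonneg_left h1 hα)
  have hM2 : Δt * ∑ n ∈ Finset.range k, ∫ x, midpoint (u n) (u (n + 1)) x ^ 2 ≤
      2 * T * (α * Y) := by
    refine (mul_le_mul_of_nonneg_left hM hΔt.le).trans ?_
    rw [← mul_assoc, mul_comm Δt]
    exact mul_le_mul_of_nonneg_right hk (by positivity)
  calc Δt * ∑ n ∈ Finset.range k, ∫ x in Set.Icc (-R) R,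
      ‖fracDeriv (1 / 2) (midpoint (u n) (u (n + 1))) x‖ ^ 2
      ≤ Δt * ∑ n ∈ Finset.range k, A * (dissipation φ (u n) (u (n + 1)) +
          ∫ x, midpoint (u n) (u (n + 1)) x ^ 2) := by
        refine mul_le_mul_of_nonneg_left (Finset.sum_le_sum fun n hn => ?_) hΔt.le
        obtain ⟨h1, -, -, h3⟩ := hu n (Finset.mem_range.1 hn)
        exact hA _ (isH2_of_mem hh (midpoint_mem_femSpace hh h1 h3.1))
    _ = A * (Δt * G + Δt * ∑ n ∈ Finset.range k, ∫ x, midpoint (u n) (u (n + 1)) x ^ 2) := by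
        rw [← Finset.mul_sum, Finset.sum_add_distrib]
        ring
    _ ≤ _ := mul_le_mul_of_nonneg_left (by linarith) hA0

end scheme

/-! ### The two regimes of the time step and the final choice of constants. -/

section conclusion

variable {R : ℝ} {φ : ℝ → ℝ} {r : ℕ} {h Δt c α A B T : ℝ} {y : ℝ → ℝ}

theorem IsSchemeSolution.bounds {u₀ : Lp ℝ 2 (volume : Measure ℝ)} (hφ : IsCutoff R φ)
    (hh : 0 < h) (hΔt : 0 < Δt) (hT : 0 ≤ T) (hc : 0 ≤ c) (hα : 0 ≤ α) (hΔtT : Δt ≤ 2 * T)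
    (hA0 : 0 ≤ A) (hA : ∀ w : ℝ → ℝ, IsH2 w →
      ∫ x in Set.Icc (-R) R, ‖fracDeriv (1 / 2) w x‖ ^ 2 ≤
        A * (gagliardo (fun x => √(deriv φ x) * w x) + ∫ x, w x ^ 2))
    (hstab : ∀ v ∈ femSpace r h, wnorm φ v ^ 2 ≤ y T → IsStable r φ h Δt c α v)
    (hmono : MonotoneOn y (Set.Icc 0 T))
    (heuler : ∀ s ∈ Set.Icc 0 T, ∀ t ∈ Set.Icc 0 T, s ≤ t →
      y s + (t - s) * (c * (α * y s + (α * y s) ^ 2)) ≤ y t)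
    (hproj : ∀ v ∈ femSpace r h, (∀ z ∈ femSpace r h, ∫ x, (v x - u₀ x) * z x = 0) →
      wnorm φ v ^ 2 ≤ y 0)
    {u : ℕ → ℝ → ℝ} (hu : IsSchemeSolution r φ h Δt T u₀ u) :
    (∀ n : ℕ, (n : ℝ) * Δt ≤ T → eLpNorm (u n) 2 volume ≤ ENNReal.ofReal √(y T)) ∧
    Δt * ∑ n ∈ (Finset.range (⌊T / Δt⌋₊ + 1)).filter (fun n : ℕ => ((n : ℝ) + 1 / 2) * Δt ≤ T),
      ∫ x in Set.Icc (-R) R, ‖fracDeriv (1 / 2) (midpoint (u n) (u (n + 1))) x‖ ^ 2 ≤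
        A * (Real.pi * (y T + 2 * T * (c * (α * y T + (α * y T) ^ 2))) + 2 * T * (α * y T)) := by
  have hN0 := hproj _ hu.init_mem hu.init_proj
  have hbd : ∀ n : ℕ, (n : ℝ) * Δt ≤ T → u n ∈ femSpace r h ∧ wnorm φ (u n) ^ 2 ≤ y T := by
    intro n hn
    obtain ⟨h1, h2⟩ := wnorm_sq_le_majorant hΔt.le hc hα hstab hmono heuler hu.init_mem hN0 n
      (fun k hk => hu.step k (le_trans (mul_le_mul_of_nonneg_right (by
        have : (k : ℝ) + 1 ≤ n := by exact_mod_cast hk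
        linarith) hΔt.le) hn)) hn
    exact ⟨h1, h2.trans (hmono ⟨by positivity, hn⟩ ⟨hT, le_rfl⟩ hn)⟩
  refine ⟨fun n hn => ?_, ?_⟩
  · obtain ⟨h1, h2⟩ := hbd n hn
    have m := memLp_of_mem hh h1
    rw [eLpNorm_two_eq m]
    exact ENNReal.ofReal_le_ofReal (Real.sqrt_le_sqrt ((hφ.integral_sq_le m).trans h2))
  · rw [filter_steps_eq hΔt hT]
    refine sum_fracDeriv_le (r := r) (T := T) hh hΔt hc hα hA0 hA _ ?_ (fun n hn => ?_)
      (hN0.trans (hmono ⟨le_rfl, hT⟩ ⟨hT, le_rfl⟩ hT))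
    -- `k Δt ≤ T + Δt/2 ≤ 2T`, since `Δt ≤ 2T`.
    · have h1 : (⌊T / Δt + 1 / 2⌋₊ : ℝ) ≤ T / Δt + 1 / 2 := Nat.floor_le (by positivity)
      have h2 := mul_le_mul_of_nonneg_right h1 hΔt.le
      rw [add_mul, div_mul_cancel₀ _ hΔt.ne'] at h2
      linarith
    · rw [← Finset.mem_range, ← filter_steps_eq hΔt hT, Finset.mem_filter] at hn
      obtain ⟨h1, h2⟩ := hbd n (by linarith [hn.2])
      exact ⟨h1, h2, hstab _ h1 h2, hu.step n hn.2⟩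

/-- If the time step is so large that no step is taken, the solution of the scheme is the
projection of the initial data. -/
theorem schemeSolution_of_lt {u₀ : Lp ℝ 2 (volume : Measure ℝ)} (hφ : IsCutoff R φ)
    (hh : 0 < h) (hΔt : 0 < Δt) (hΔtT : 2 * T < Δt)
    (hproj : ∀ v ∈ femSpace r h, (∀ z ∈ femSpace r h, ∫ x, (v x - u₀ x) * z x = 0) →
      wnorm φ v ^ 2 ≤ B) :
    (∃ u : ℕ → ℝ → ℝ, IsSchemeSolution r φ h Δt T u₀ u) ∧
    ∀ u : ℕ → ℝ → ℝ, IsSchemeSolution r φ h Δt T u₀ u →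
      (∀ n : ℕ, (n : ℝ) * Δt ≤ T → eLpNorm (u n) 2 volume ≤ ENNReal.ofReal √B) ∧
      Δt * ∑ n ∈ (Finset.range (⌊T / Δt⌋₊ + 1)).filter (fun n : ℕ => ((n : ℝ) + 1 / 2) * Δt ≤ T),
        ∫ x in Set.Icc (-R) R, ‖fracDeriv (1 / 2) (midpoint (u n) (u (n + 1))) x‖ ^ 2 ≤ 0 := by
  have hno : ∀ n : ℕ, ¬ ((n : ℝ) + 1 / 2) * Δt ≤ T := fun n hn => by
    have : 0 ≤ (n : ℝ) * Δt := by positivity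
    linarith
  constructor
  · obtain ⟨v, hv, hvp⟩ := exists_projection hh r u₀
    exact ⟨fun _ => v, hv, hvp, fun n hn => (hno n hn).elim⟩
  · refine fun u hu => ⟨fun n hn => ?_, ?_⟩
    · have hn0 : n = 0 := by
        by_contra hne
        have h1 : (1 : ℝ) ≤ n := by exact_mod_cast Nat.one_le_iff_ne_zero.2 hne
        have := mul_le_mul_of_nonneg_right h1 hΔt.le
        linarith
      subst hn0
      have m := memLp_of_mem hh hu.init_mem
      rw [eLpNorm_two_eq m]
      exact ENNReal.ofReal_le_ofReal (Real.sqrt_le_sqrt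
        ((hφ.integral_sq_le m).trans (hproj _ hu.init_mem hu.init_proj)))
    · rw [Finset.filter_false_of_mem fun n _ => hno n]
      simp

end conclusion

end BenjaminOno

open BenjaminOno

theorem mainTheorem3 (r : ℕ) (hr : 2 ≤ r) :
    (∃ C₁ C₂ : ℝ, BenjaminOno.IsInverseConstants r C₁ C₂) ∧
    ∀ C₁ C₂ : ℝ, BenjaminOno.IsInverseConstants r C₁ C₂ →
    ∀ (R : ℝ) (φ : ℝ → ℝ), 0 < R → BenjaminOno.IsCutoff R φ →
    ∀ L K : ℝ, 0 < L → L < 1 → K = (7 - L) / (1 - L) →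
    ∃ Δt₀ > (0 : ℝ), ∃ c > (0 : ℝ),
      ∀ M : ℝ, 0 ≤ M →
        ∃ T > (0 : ℝ), ∃ C : ℝ, ∃ y : ℝ → ℝ,
          BenjaminOno.IsMajorant c K ((2 + 2 * R) * M ^ 2) T y ∧
          ∀ u₀ : Lp ℝ 2 (volume : Measure ℝ), ‖u₀‖ = M →
          ∀ Δx Δt : ℝ, 0 < Δx → 0 < Δt → Δt ≤ Δt₀ →
            BenjaminOno.cfl Δx Δt * (2 * √2 * √C₂ * K * √(y T)) ≤ L →
            (∃ u : ℕ → ℝ → ℝ, BenjaminOno.IsSchemeSolution r φ Δx Δt T u₀ u) ∧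
            ∀ u : ℕ → ℝ → ℝ, BenjaminOno.IsSchemeSolution r φ Δx Δt T u₀ u →
              (∀ n : ℕ, (n : ℝ) * Δt ≤ T →
                eLpNorm (u n) 2 volume ≤ ENNReal.ofReal C) ∧
              Δt * ∑ n ∈ (Finset.range (⌊T / Δt⌋₊ + 1)).filter (fun n : ℕ => ((n : ℝ) + 1 / 2) * Δt ≤ T),
                ∫ x in Set.Icc (-R) R,
                  ‖BenjaminOno.fracDeriv (1 / 2)
                    (BenjaminOno.midpoint (u n) (u (n + 1))) x‖ ^ 2 ≤ C := by
  refine ⟨exists_isInverseConstants r, ?_⟩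
  intro C₁ C₂ hC R φ hR hφ L K hL0 hL1 hK
  obtain ⟨D, hD0, hD⟩ := hφ.exists_coercive
  obtain ⟨A, hA0, hA⟩ := hφ.exists_setIntegral_fracDeriv_le
  have hK0 : 0 < K := by
    rw [hK]
    exact div_pos (by linarith) (by linarith)
  have hpi := Real.pi_pos
  have hC₁ := hC.pos₁
  have hC₂ := hC.pos₂
  have hc : 0 < 2 * D + 2 * Real.pi := by linarith
  have hα : 0 < (K ^ 2 + 1) / 2 := by positivity
  -- This `Δt₀` ensures `D Δt / 2 ≤ 1/10`. It is chosen before `M`; all smallness relative to the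
  -- data is put into `T`.
  refine ⟨1 / (5 * (D + 1)), by positivity, 2 * D + 2 * Real.pi, hc, fun M hM => ?_⟩
  set c := 2 * D + 2 * Real.pi with hcdef
  set y₀ := (2 + 2 * R) * M ^ 2 with hy₀def
  have hy₀ : 0 ≤ y₀ := by positivity
  -- The value for which the smallness hypothesis of `cfl_smallness` holds with equality.
  set η := √(C₂ * (L / (2 * K)) ^ 4 / C₁ ^ 3) with hηdef
  have hη : 0 < η := Real.sqrt_pos.2 (by positivity)
  have hη2 : C₁ ^ 3 * η ^ 2 ≤ C₂ * (L / (2 * K)) ^ 4 := by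
    rw [hηdef, Real.sq_sqrt (by positivity), mul_div_cancel₀ _ (by positivity)]
  -- With `y T ≤ 4 y₀` this cap on `T` gives `(2T)² y(T) ≤ 16 T² y₀ ≤ η`.
  obtain ⟨T, hT, hTτ, y, hy0, hyd, hynn, hyT⟩ := exists_majorant (τ := √(η / (16 * (y₀ + 1))))
    hc hα hy₀ (Real.sqrt_pos.2 (by positivity))
  obtain ⟨hmono, heuler⟩ := euler_le hc.le hα.le hyd hynn
  have hY : 0 ≤ y T := hynn T ⟨hT.le, le_rfl⟩
  set B := A * (Real.pi * (y T + 2 * T * (c * ((K ^ 2 + 1) / 2 * y T +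
    ((K ^ 2 + 1) / 2 * y T) ^ 2))) + 2 * T * ((K ^ 2 + 1) / 2 * y T)) with hBdef
  have hB : 0 ≤ B := by positivity
  have hTη : (2 * T) ^ 2 * y T ≤ η := by
    have h1 := pow_le_pow_left₀ hT.le hTτ 2
    rw [Real.sq_sqrt (by positivity), le_div_iff₀ (by positivity)] at h1
    have h2 := mul_le_mul_of_nonneg_left hyT (sq_nonneg (2 * T))
    linarith [sq_nonneg T]
  refine ⟨T, hT, √(y T) + B, y, ⟨hy0, fun t ht => (hyd t ht).hasDerivWithinAt⟩, ?_⟩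
  intro u₀ hu₀ Δx Δt hΔx hΔt hΔt₀ hcfl
  have hproj : ∀ v ∈ femSpace r Δx, (∀ z ∈ femSpace r Δx, ∫ x, (v x - u₀ x) * z x = 0) →
      wnorm φ v ^ 2 ≤ y 0 := by
    intro v hv hvp
    rw [hy0, hy₀def, ← hu₀]
    exact (hφ.wnorm_sq_le (memLp_of_mem hΔx hv)).trans
      (mul_le_mul_of_nonneg_left (integral_sq_projection_le hΔx hv (hvp v hv)) (by linarith))
  have hsqrt : ENNReal.ofReal √(y T) ≤ ENNReal.ofReal (√(y T) + B) :=
    ENNReal.ofReal_le_ofReal (by linarith)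
  -- Step `0` is taken exactly when `Δt/2 ≤ T`. In the first case `Δt² y(T) ≤ η` follows from the
  -- choice of `T`; in the second no step is taken and only the projection has to be bounded.
  rcases le_or_gt Δt (2 * T) with hle | hlt
  · have hκ := cfl_smallness hC₁ hC₂ hL0 hK0 hY hΔx hΔt.le hcfl
      ((mul_le_mul_of_nonneg_right (pow_le_pow_left₀ hΔt.le hle 2) hY).trans hTη) hη2
    have hδ : D * Δt / 2 ≤ 1 / 10 := by
      rw [le_div_iff₀ (by positivity)] at hΔt₀
      linarith
    have hstab : ∀ v ∈ femSpace r Δx, wnorm φ v ^ 2 ≤ y T →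
        IsStable r φ Δx Δt c ((K ^ 2 + 1) / 2) v := fun v hv hN =>
      isStable_of_le hφ hC hΔx hD0 hD hΔt.le hL0 hL1 hK hδ hκ hv hN
    refine ⟨exists_isSchemeSolution hΔx hΔt.le hc.le hα.le hstab hmono heuler u₀ hproj,
      fun u hu => ?_⟩
    obtain ⟨h1, h2⟩ := hu.bounds hφ hΔx hΔt hT.le hc.le hα.le hle hA0 hA hstab hmono heuler hproj
    exact ⟨fun n hn => (h1 n hn).trans hsqrt, h2.trans (by linarith [Real.sqrt_nonneg (y T)])⟩
  · obtain ⟨h0, h1⟩ := schemeSolution_of_lt hφ hΔx hΔt hlt fun v hv hvp =>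
      (hproj v hv hvp).trans (hmono ⟨le_rfl, hT.le⟩ ⟨hT.le, le_rfl⟩ hT.le)
    refine ⟨h0, fun u hu => ⟨fun n hn => ((h1 u hu).1 n hn).trans hsqrt,
      (h1 u hu).2.trans (by positivity)⟩⟩
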